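/- The following is a theorem of $\mathsf{ZF}+\mathsf{AD}$ (no choice is assumed; $\mathsf{AD}$ is the axiom that for every $A\subseteq\mathbb R={}^\omega\omega$ one of the two players has a winning strategy in the game on $\omega$ in which the players alternately play the values of $x\in\mathbb R$ and Player 1 wins iff $x\in A$). For every $\lambda<\omega_1$: (a) $\omega_1$ is $\lambda$-reasonable; (b) $\omega_1\rightarrow_*(\omega_1)^\lambda_2$; (c) $\omega_1\rightarrow(\omega_1)^\lambda_2$. In particular, $\omega_1$ is a weak partition cardinal. Here the notions are as follows. *Partition relations.* For an ordinal $\lambda\le\kappa$ and $A\subseteq\kappa$, $[A]^\lambda$ is the set of strictly increasing $f:\lambda\to A$, and $[A]^\lambda_*$ is the set of those $f\in[A]^\lambda$ of the correct type, i.e. such that $f(\alpha)>\sup\{f(\beta):\beta<\alpha\}$ for all $\alpha<\lambda$ and there is $g:\lambda\times\omega\to\kappa$ with $g(\alpha,m)<g(\alpha,n)$ for all $\alpha<\lambda$ and $m<n$, and $f(\alpha)=\sup\{g(\alpha,n):n\in\omega\}$ for all $\alpha<\lambda$. The relation $\kappa\rightarrow_*(\kappa)^\lambda_2$ says that for every $P:[\kappa]^\lambda_*\to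 2$ there are $i<2$ and a club $C\subseteq\kappa$ with $P(f)=i$ for all $f\in[C]^\lambda_*$. The relation $\kappa\rightarrow(\kappa)^\lambda_2$ says that for every $P:[\kappa]^\lambda\to 2$ there are $i<2$ and $A\subseteq\kappa$ with $|A|=\kappa$ and $P(f)=i$ for all $f\in[A]^\lambda$. A cardinal $\kappa$ is a weak partition cardinal if $\kappa\rightarrow(\kappa)^\lambda_2$ for all $\lambda<\kappa$. *Reasonableness.* $\kappa$ is $\lambda$-reasonable if $\kappa$ is a regular cardinal, $\lambda\le\kappa$ is an ordinal, and there is a good coding system for ${}^\lambda\kappa$, that is, a pointclass $\Gamma$ (a collection of subsets of the spaces $\mathbb R^n$, $n\in\omega$; put $\Delta=\Gamma\cap\check\Gamma$, where $\check\Gamma$ is the dual class of complements of sets in $\Gamma$) and a map $\mathrm{decode}:\mathbb R\to\mathcal P(\lambda\times\kappa)$ such that 1. $\Gamma$ is closed under continuous substitution and under $\exists^{\mathbb R}$ (projection from $\mathbb R^{n+1}$ to $\mathbb R^n$); 2. every $f:\lambda\to\kappa$ is $\mathrm{decode}(x)$ for some $x\in\mathbb R$; 3. for all $\beta<\lambda$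 and $\gamma<\kappa$, the set $\mathrm{GC}_{\beta,\gamma}=\{x\in\mathbb R:(\beta,\gamma)\in\mathrm{decode}(x)\wedge(\forall\gamma'<\kappa)((\beta,\gamma')\in\mathrm{decode}(x)\Rightarrow\gamma=\gamma')\}$ is in $\Delta$; 4. whenever $\beta<\lambda$, $A\subseteq\mathbb R$ is in $\exists^{\mathbb R}\Delta$ and $A\subseteq\bigcup_{\gamma<\kappa}\mathrm{GC}_{\beta,\gamma}$, there is $\delta<\kappa$ with $A\subseteq\bigcup_{\gamma<\delta}\mathrm{GC}_{\beta,\gamma}$; 5. $\Delta$ is closed under wellordered unions of length less than $\kappa$. -/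

import Mathlib

namespace SetModel

/-! Models of set theory.  A model is a type `M` with a binary relation, written `x ∈ a`.
The axiom schemes of ZF range over the relations on `M` that are first-order definable, with
parameters, in the language with one binary relation symbol.  All later notions are relations on
`M` that quantify over elements of `M` only, so each of them is the interpretation in `M` of a
formula of set theory. -/

/-- The relation symbols of the language of set theory. -/
inductive SetRel : ℕ → Type
  | mem : SetRel 2

/-- The first-order language of set theory. -/
def setLang : FirstOrder.Language := ⟨fun _ => Empty, SetRel⟩

instance setStructure (M : Type*) [Membership M M] : setLang.Structure M where
  funMap := fun f _ => Empty.elim f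
  RelMap := fun r =>
    match r with
    | SetRel.mem => fun v => v 0 ∈ v 1

/-! Kuratowski pairs, natural numbers, ordinals. -/

section

variable {M : Type*} [Membership M M]

/-- The class of elements of `a`. -/
def ext (a : M) : Set M := {x | x ∈ a}

def IsEmpty (a : M) : Prop := ∀ x : M, ¬ x ∈ a

/-- `s = n ∪ {n}`. -/
def IsSucc (s n : M) : Prop := ∀ x : M, x ∈ s ↔ x ∈ n ∨ x = n

/-- `a = {x, y}`. -/
def IsUPair (a x y : M) : Prop := ∀ z : M, z ∈ a ↔ z = x ∨ z = y

/-- `p = {{x}, {x, y}}`. -/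
def IsPair (p x y : M) : Prop := ∀ z : M, z ∈ p ↔ IsUPair z x x ∨ IsUPair z x y

end

/-- `M` is a model of the axioms of Zermelo–Fraenkel set theory, without choice. -/
structure ZF (M : Type*) [Membership M M] : Prop where
  extensionality : ∀ a b : M, (∀ x : M, x ∈ a ↔ x ∈ b) → a = b
  foundation : ∀ a : M, (∃ x : M, x ∈ a) → ∃ x : M, x ∈ a ∧ ∀ y : M, y ∈ x → ¬ y ∈ a
  pairing : ∀ x y : M, ∃ a : M, IsUPair a x y
  union : ∀ a : M, ∃ b : M, ∀ x : M, x ∈ b ↔ ∃ y : M, y ∈ a ∧ x ∈ y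
  powerset : ∀ a : M, ∃ b : M, ∀ x : M, x ∈ b ↔ ∀ y : M, y ∈ x → y ∈ a
  infinity : ∃ w : M, (∃ e : M, IsEmpty e ∧ e ∈ w) ∧
    ∀ n : M, n ∈ w → ∃ s : M, IsSucc s n ∧ s ∈ w
  separation : ∀ S : Set M, (Set.univ : Set M).Definable₁ setLang S →
    ∀ a : M, ∃ b : M, ∀ x : M, x ∈ b ↔ x ∈ a ∧ x ∈ S
  replacement : ∀ R : Set (M × M), (Set.univ : Set M).Definable₂ setLang R →
    ∀ a : M, (∀ x : M, x ∈ a → ∃! y : M, (x, y) ∈ R) →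
      ∃ b : M, ∀ y : M, y ∈ b ↔ ∃ x : M, x ∈ a ∧ (x, y) ∈ R

section

variable {M : Type*} [Membership M M]

/-- `f(x) = y`, that is, the pair of `x` and `y` belongs to `f`. -/
def Maps (f x y : M) : Prop := ∃ p : M, IsPair p x y ∧ p ∈ f

/-- The set `f` is a function from the class `A` to the class `B`. -/
def IsFun (f : M) (A B : Set M) : Prop :=
  (∀ p : M, p ∈ f → ∃ x ∈ A, ∃ y ∈ B, IsPair p x y) ∧ ∀ x ∈ A, ∃! y : M, Maps f x y

/-- The set `f` is an injective function from `A` to `B`. -/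
def IsInj (f : M) (A B : Set M) : Prop :=
  IsFun f A B ∧ ∀ x x' y : M, Maps f x y → Maps f x' y → x = x'

/-- The set `f` is a bijection from `A` to `B`. -/
def IsBij (f : M) (A B : Set M) : Prop :=
  IsInj f A B ∧ ∀ y ∈ B, ∃ x : M, Maps f x y

def IsTransitive (a : M) : Prop := ∀ x : M, x ∈ a → ∀ y : M, y ∈ x → y ∈ a

/-- Von Neumann ordinals (under foundation). -/
def IsOrd (a : M) : Prop := IsTransitive a ∧ ∀ x : M, x ∈ a → IsTransitive x

/-- The order of the ordinals. -/
def Le (a b : M) : Prop := a ∈ b ∨ a = b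

/-- Limit ordinals; zero is not one. -/
def IsLimit (a : M) : Prop :=
  IsOrd a ∧ (∃ x : M, x ∈ a) ∧ ∀ x : M, x ∈ a → ∃ y : M, y ∈ a ∧ x ∈ y

/-- The supremum, i.e. least upper bound, of a class of ordinals. -/
def IsSup (s : M) (X : Set M) : Prop :=
  IsOrd s ∧ (∀ x ∈ X, Le x s) ∧ ∀ t : M, IsOrd t → (∀ x ∈ X, Le x t) → Le s t

variable (M) in
/-- The natural numbers of the model: the ordinals `n` such that every ordinal up to `n` is zero
or a successor. -/
def omega : Set M :=
  {n | IsOrd n ∧ ∀ m : M, Le m n → IsEmpty m ∨ ∃ k : M, IsSucc m k}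

/-- `n = 1`. -/
def IsOne (n : M) : Prop := ∃ z : M, IsEmpty z ∧ IsSucc n z

variable (M) in
/-- The two elements of the ordinal `2`. -/
def two : Set M := {n | IsEmpty n ∨ IsOne n}

/-- `κ` is the first uncountable ordinal. -/
def IsOmega1 (κ : M) : Prop :=
  IsOrd κ ∧ (¬ ∃ f : M, IsInj f (ext κ) (omega M)) ∧
    ∀ α : M, α ∈ κ → ∃ f : M, IsInj f (ext α) (omega M)

/-- `κ` is an infinite regular cardinal. -/
def IsRegularCardinal (κ : M) : Prop :=
  IsOrd κ ∧ omega M ⊆ ext κ ∧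
  (∀ η : M, η ∈ κ → ¬ ∃ f : M, IsBij f (ext η) (ext κ)) ∧
  ∀ η h : M, η ∈ κ → IsFun h (ext η) (ext κ) →
    ∃ δ : M, δ ∈ κ ∧ ∀ x y : M, Maps h x y → y ∈ δ

/-! Partition relations. -/

/-- `C` is a closed unbounded subset of `κ`. -/
def IsClub (C κ : M) : Prop :=
  (∀ x : M, x ∈ C → x ∈ κ) ∧
  (∀ α : M, α ∈ κ → ∃ β : M, β ∈ C ∧ α ∈ β) ∧
  ∀ δ : M, δ ∈ κ → IsLimit δ →
    (∀ α : M, α ∈ δ → ∃ β : M, β ∈ C ∧ β ∈ δ ∧ α ∈ β) → δ ∈ C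

/-- `[A]^l`: the increasing functions from the ordinal `l` to the set of ordinals `A`. -/
def incr (A l : M) : Set M :=
  {f | IsFun f (ext l) (ext A) ∧
    ∀ α β u v : M, α ∈ β → Maps f α u → Maps f β v → u ∈ v}

/-- `f : l → κ` has uniform cofinality `ω`: there is a set `g : l × ω → κ`, increasing in the
second argument, such that `f(α) = sup {g(α, n) : n ∈ ω}` for all `α < l`. -/
def UniformCofOmega (f l κ : M) : Prop :=
  ∃ g : M,
    IsFun g {p | ∃ α n : M, α ∈ l ∧ n ∈ omega M ∧ IsPair p α n} (ext κ) ∧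
    (∀ α m n p q u v : M, m ∈ n → IsPair p α m → IsPair q α n →
      Maps g p u → Maps g q v → u ∈ v) ∧
    ∀ α v : M, Maps f α v →
      IsSup v {w | ∃ n p : M, n ∈ omega M ∧ IsPair p α n ∧ Maps g p w}

/-- `f(α) > sup {f(β) : β < α}` for all `α` in the domain of `f`. -/
def DiscontinuousEverywhere (f : M) : Prop :=
  ∀ α v : M, Maps f α v → ∃ s : M, IsSup s {w | ∃ β : M, β ∈ α ∧ Maps f β w} ∧ s ∈ v

/-- `[A]^l_*`, for `A ⊆ κ`: the increasing functions from `l` to `A` of the correct type. -/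
def incrCorrect (A l κ : M) : Set M :=
  {f | f ∈ incr A l ∧ UniformCofOmega f l κ ∧ DiscontinuousEverywhere f}

/-- The partition relation `κ → (κ)^l` for partitions into the colours in `K`. -/
def Arrow (κ l : M) (K : Set M) : Prop :=
  ∀ P : M, IsFun P (incr κ l) K →
    ∃ b ∈ K, ∃ A : M, (∀ x : M, x ∈ A → x ∈ κ) ∧ (∃ e : M, IsBij e (ext A) (ext κ)) ∧
      ∀ f ∈ incr A l, Maps P f b

/-- The correct type partition relation `κ →_* (κ)^l` for partitions into the colours in `K`. -/
def ArrowStar (κ l : M) (K : Set M) : Prop :=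
  ∀ P : M, IsFun P (incrCorrect κ l κ) K →
    ∃ b ∈ K, ∃ C : M, IsClub C κ ∧ ∀ f ∈ incrCorrect C l κ, Maps P f b

/-! Reals, games, determinacy. -/

variable (M) in
/-- The reals of the model: the functions from `ω` to `ω`. -/
def Baire : Set M := {x | IsFun x (omega M) (omega M)}

variable (M) in
/-- The finite sequences of natural numbers. -/
def FinSeq : Set M := {s | ∃ n ∈ omega M, IsFun s (ext n) (omega M)}

/-- `s` is the restriction of the real `x` to the natural number `n`. -/
def IsRestr (s x n : M) : Prop :=
  IsFun s (ext n) (omega M) ∧ ∀ k v : M, Maps s k v → Maps x k v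

/-- `n` is an even natural number: it belongs to the set `E` of natural numbers that contains `0`
and, for every `k`, contains exactly one of `k` and `k + 1`. -/
def IsEven (n : M) : Prop :=
  n ∈ omega M ∧ ∃ E : M, (∀ z : M, IsEmpty z → z ∈ E) ∧
    (∀ k ∈ omega M, ∀ s : M, IsSucc s k → (s ∈ E ↔ ¬ k ∈ E)) ∧ n ∈ E

/-- The run `x` is played according to the strategy `σ` at all positions of even length. -/
def FollowsI (σ x : M) : Prop :=
  ∀ n s v : M, IsEven n → IsRestr s x n → Maps σ s v → Maps x n v

/-- The run `x` is played according to the strategy `τ` at all positions of odd length. -/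
def FollowsII (τ x : M) : Prop :=
  ∀ n s v : M, n ∈ omega M → ¬ IsEven n → IsRestr s x n → Maps τ s v → Maps x n v

variable (M) in
/-- The axiom of determinacy: for every set `A` of reals, one of the players has a winning strategy
in the game in which the players alternately play the values of a real `x`, and Player 1, who
plays `x(0)`, wins if and only if `x ∈ A`. -/
def AD : Prop :=
  ∀ A : M, ext A ⊆ Baire M →
    (∃ σ : M, IsFun σ (FinSeq M) (omega M) ∧ ∀ x ∈ Baire M, FollowsI σ x → x ∈ A) ∨
    (∃ τ : M, IsFun τ (FinSeq M) (omega M) ∧ ∀ x ∈ Baire M, FollowsII τ x → ¬ x ∈ A)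

/-! Pointclasses. -/

/-- The space `ℝ^n`, for a natural number `n` of the model. -/
def RealPow (n : M) : Set M := {x | IsFun x (ext n) (Baire M)}

/-- A set of reals, viewed as a subset of `ℝ^1`. -/
def asPow (A : Set M) : Set M :=
  {z | ∃ n o x : M, IsOne n ∧ z ∈ RealPow n ∧ IsEmpty o ∧ Maps z o x ∧ x ∈ A}

/-- The points `x` and `y` of `ℝ^n` agree up to `k`: `x_i(j) = y_i(j)` for `i < n`, `j < k`. -/
def Agree (n k x y : M) : Prop :=
  ∀ i a b : M, i ∈ n → Maps x i a → Maps y i b → ∀ j t : M, j ∈ k → Maps a j t → Maps b j t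

/-- The set `F` is a continuous function from `ℝ^m` to `ℝ^n`. -/
def IsContinuous (F m n : M) : Prop :=
  IsFun F (RealPow m) (RealPow n) ∧
  ∀ x u : M, Maps F x u → ∀ k ∈ omega M, ∃ l ∈ omega M,
    ∀ y v : M, Maps F y v → Agree m l x y → Agree n k u v

/-- The projection `{x ∈ ℝ^n : (∃ y ∈ ℝ) x⌢y ∈ B}` of a subset `B` of `ℝ^(n+1)`. -/
def existsReal (n : M) (B : Set M) : Set M :=
  {x | x ∈ RealPow n ∧ ∃ z ∈ B, ∀ i v : M, Maps x i v → Maps z i v}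

/-- A pointclass is a set of pairs `(n, a)` with `a ⊆ ℝ^n`: it tells which subsets of the spaces
`ℝ^n` belong to it. -/
def IsPointclass (Γ : M) : Prop :=
  ∀ p : M, p ∈ Γ → ∃ n a : M, n ∈ omega M ∧ ext a ⊆ RealPow n ∧ IsPair p n a

/-- The class `A` is a set, and this subset of `ℝ^n` belongs to the pointclass `Γ`. -/
def InClass (Γ n : M) (A : Set M) : Prop := ∃ a : M, ext a = A ∧ Maps Γ n a

/-- `A` belongs to `Δ`, the intersection of `Γ` with its dual pointclass. -/
def InDelta (Γ n : M) (A : Set M) : Prop := InClass Γ n A ∧ InClass Γ n (RealPow n \ A)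

/-- The set of reals `A` belongs to `Δ`. -/
def RealInDelta (Γ : M) (A : Set M) : Prop := ∃ n : M, IsOne n ∧ InDelta Γ n (asPow A)

/-- The set of reals `A` belongs to `∃^ℝ Δ`. -/
def RealInExistsDelta (Γ : M) (A : Set M) : Prop :=
  ∃ (n m : M) (B : Set M), IsOne n ∧ IsSucc m n ∧ InDelta Γ m B ∧ asPow A = existsReal n B

def ClosedUnderContinuousSubstitution (Γ : M) : Prop :=
  ∀ (F m n : M) (A : Set M), m ∈ omega M → n ∈ omega M → IsContinuous F m n →
    InClass Γ n A → InClass Γ m {x | ∃ y ∈ A, Maps F x y}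

def ClosedUnderExistsReal (Γ : M) : Prop :=
  ∀ (n m : M) (B : Set M), n ∈ omega M → IsSucc m n → InClass Γ m B →
    InClass Γ n (existsReal n B)

/-- `Δ` is closed under wellordered unions of length less than `κ`. -/
def DeltaClosedUnderUnions (Γ κ : M) : Prop :=
  ∀ n δ S : M, n ∈ omega M → δ ∈ κ →
    IsFun S (ext δ) {a | InDelta Γ n (ext a)} →
    InDelta Γ n {x | ∃ α a : M, Maps S α a ∧ x ∈ a}

/-! Good coding systems. -/

/-- `decode(x)(β, γ)`, that is, `(β, γ) ∈ decode(x)`. -/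
def DecodesTo (d x β γ : M) : Prop := ∃ r : M, Maps d x r ∧ Maps r β γ

/-- `GC_{β,γ}`. -/
def GC (d κ β γ : M) : Set M :=
  {x | x ∈ Baire M ∧ DecodesTo d x β γ ∧ ∀ γ' : M, γ' ∈ κ → DecodesTo d x β γ' → γ = γ'}

/-- The pointclass `Γ` and the map `d` (`decode`) form a good coding system for the functions from
the ordinal `l` to `κ`.  The sets `GC_{β,γ}` are determined by `d`. -/
structure IsGoodCoding (Γ d κ l : M) : Prop where
  pointclass : IsPointclass Γ
  substitution : ClosedUnderContinuousSubstitution Γ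
  existsReal : ClosedUnderExistsReal Γ
  decode : IsFun d (Baire M) {r | ∀ p : M, p ∈ r → ∃ β γ : M, β ∈ l ∧ γ ∈ κ ∧ IsPair p β γ}
  decode_surj : ∀ f : M, IsFun f (ext l) (ext κ) → ∃ x ∈ Baire M, Maps d x f
  delta : ∀ β γ : M, β ∈ l → γ ∈ κ → RealInDelta Γ (GC d κ β γ)
  boundedness : ∀ (β : M) (A : Set M), β ∈ l → RealInExistsDelta Γ A →
    A ⊆ {x | ∃ γ : M, γ ∈ κ ∧ x ∈ GC d κ β γ} →
    ∃ δ : M, δ ∈ κ ∧ A ⊆ {x | ∃ γ : M, γ ∈ δ ∧ x ∈ GC d κ β γ}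
  unions : DeltaClosedUnderUnions Γ κ

/-- `κ` is a regular cardinal, `l ≤ κ` is an ordinal, and there is a good coding system for the
functions from `l` to `κ`. -/
def IsReasonable (κ l : M) : Prop :=
  IsRegularCardinal κ ∧ Le l κ ∧ ∃ Γ d : M, IsGoodCoding Γ d κ l

end

end SetModel

namespace SetModel

/-! Sets of the model are handled through types coded by classes of `M`: the types `El a`, `ISet M X`
and `IFun M X Y` consist of the elements of `a`, of the subsets of `X` and of the functions from `X`
to `Y` that exist in `M`. The classes `DP M P` and `DF M f` express that a predicate or a function is
definable over `M`, and instance search derives them from the shape of `P` and `f`.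

The pointclass of the good coding systems consists of the projections of closed sets. The ordinals
below the first uncountable ordinal are coded by the reals that list a wellfounded relation of that
rank, boundedness is proved by ranking a tree of attempts, and the partition relation is proved by
the game in which the players jointly code the values of a function. -/

/-! The argument takes place inside `M`, so every set, function and induction predicate must be
definable over `M`. This is settled once: `DP` and `DF` are closed under the logical operations, and
by separation `ISet` and `IFun` over set-coded types are exactly the subsets and functions that
belong to `M`. As `M` lacks choice, witnesses are singled out by `the`, usually as least elements;
determinacy adds countable choice for reals (`AD.choice`), through a game in which one player names
a number and the other must answer it.

A real codes a relation on the natural numbers, and it codes the ordinal `γ` when the node `0` has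
rank `γ` in that relation. Every ordinal below `κ` has a code, and choosing countably many codes at
once shows that `κ` is regular (`AD.exists_bound`). The pointclass is that of the projections of
closed sets, boldface Σ¹₁. The clause for "rank `γ`" quantifies only over numbers and over ordinals
below the countable `γ`, so the codes of `γ` form a set in Δ (`AD.biSuslin_rk`). The second pillar
is Σ¹₁-boundedness (`AD.exists_bound_of_closed`): if a continuous `F` maps a closed set into the
codes, the tree of attempts to find a point `w` of the set together with an infinite descent from
`0` in the relation `F w` has no infinite branch, and the rank of its root bounds all the ordinals
coded. Reasonableness follows by cutting a real into sections, one for each `β < l`.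

The correct type relation comes from Martin's game (`AD.exists_club`). The players build reals that
code ordinals at the places `(α, n)` in `l × ω`, and the first to miss a place, in lexicographic
order, loses. If nobody misses, the suprema over `n` of the ordinals of both players form a function
`f`, and `P f` decides the winner. Boundedness yields a monotone `b` such that the winner's ordinal
at a place is below `b δ` whenever the opponent's ordinals up to that place are below `δ`. Let `f`
be of the correct type with values among the closure points of `b`. The loser can code a witness `g`
of the uniform cofinality of `f`; the answers stay below `f α`, so the play produces exactly `f`,
and `P f` has the value that the winner guarantees.

For the plain relation, the homogeneous club is thinned to the limits of its points that are not
limits of such limits. Every increasing function into this set is automatically of the correct type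
(`AD.correct_of_isSimpleLimit`). -/

/-- A model of `ZF`, as a type class. -/
class ZFModel (M : Type*) [Membership M M] : Prop where
  zf : ZF M

/-! ### First-order definability with parameters -/

section FO
open FirstOrder Language
variable {M : Type*} [Membership M M]

/-- Relations on assignments that are first-order definable with parameters. -/
class FO (P : (ℕ → M) → Prop) : Prop where
  out : ∃ φ : (setLang.withConstants (Set.univ : Set M)).Formula ℕ, ∀ v, φ.Realize v ↔ P v

theorem FO.congr {P Q : (ℕ → M) → Prop} (h : FO P) (e : ∀ v, P v ↔ Q v) : FO Q := by
  obtain ⟨φ, hφ⟩ := h.out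
  exact ⟨φ, fun v => (hφ v).trans (e v)⟩

instance FO.mem (i j : ℕ) : FO (fun v : ℕ → M => v i ∈ v j) := by
  let r : (setLang.withConstants (Set.univ : Set M)).Relations 2 :=
    Sum.inl (SetRel.mem : setLang.Relations 2)
  refine ⟨r.formula₂ (Term.var i) (Term.var j), fun v => ?_⟩
  exact (Formula.realize_rel₂ (R := r)).trans (iff_of_eq
    (withConstants_relMap_sumInl (L := setLang) (α := (Set.univ : Set M))
    (R := (SetRel.mem : setLang.Relations 2))))

instance FO.eq (i j : ℕ) : FO (fun v : ℕ → M => v i = v j) := by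
  refine ⟨(Term.var i).equal (Term.var j), fun v => ?_⟩
  rw [Formula.realize_equal]; rfl

instance FO.eq_param (i : ℕ) (a : M) : FO (fun v : ℕ → M => v i = a) := by
  refine ⟨(Term.var i).equal (setLang.con (⟨a, trivial⟩ : (Set.univ : Set M))).term, fun v => ?_⟩
  rw [Formula.realize_equal, Term.realize_con]; rfl

instance FO.not {P : (ℕ → M) → Prop} [h : FO P] : FO (fun v => ¬ P v) := by
  obtain ⟨φ, hφ⟩ := h.out
  exact ⟨φ.not, fun v => by rw [Formula.realize_not, hφ]⟩

instance FO.imp {P Q : (ℕ → M) → Prop} [h : FO P] [h' : FO Q] : FO (fun v => P v → Q v) := by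
  obtain ⟨φ, hφ⟩ := h.out
  obtain ⟨ψ, hψ⟩ := h'.out
  exact ⟨φ.imp ψ, fun v => by rw [Formula.realize_imp, hφ, hψ]⟩

instance FO.and {P Q : (ℕ → M) → Prop} [h : FO P] [h' : FO Q] : FO (fun v => P v ∧ Q v) :=
  FO.congr (P := fun v => ¬ (P v → ¬ Q v)) inferInstance (fun v => by simp)

instance FO.or {P Q : (ℕ → M) → Prop} [h : FO P] [h' : FO Q] : FO (fun v => P v ∨ Q v) :=
  FO.congr (P := fun v => ¬ P v → Q v) inferInstance (fun v => by tauto)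

instance FO.iff {P Q : (ℕ → M) → Prop} [h : FO P] [h' : FO Q] : FO (fun v => P v ↔ Q v) :=
  FO.congr (P := fun v => (P v → Q v) ∧ (Q v → P v)) inferInstance (fun v => by tauto)

theorem FO.relabel {P : (ℕ → M) → Prop} (h : FO P) (g : ℕ → ℕ) :
    FO (fun v => P (fun n => v (g n))) := by
  obtain ⟨φ, hφ⟩ := h.out
  exact ⟨φ.relabel g, fun v => by rw [Formula.realize_relabel, hφ]; rfl⟩

/-- In the body of a quantifier, the variable `0` is the bound one. -/
instance FO.ex {P : (ℕ → M) → M → Prop} [h : FO (fun v => P (fun n => v (n + 1)) (v 0))] :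
    FO (fun v => ∃ y, P v y) := by
  obtain ⟨φ, hφ⟩ := h.out
  -- De Bruijn shift: variable `0` becomes the quantified one, variable `n + 1` the free variable
  -- `n`.
  let g : ℕ → ℕ ⊕ Fin 1 := fun n => Nat.casesOn n (Sum.inr 0) Sum.inl
  refine ⟨(BoundedFormula.relabel (n := 1) (k := 0) g φ).ex, fun v => ?_⟩
  unfold Formula.Realize
  rw [BoundedFormula.realize_ex]
  refine exists_congr fun a => ?_
  rw [BoundedFormula.realize_relabel]
  have := hφ (fun n => Nat.casesOn n a v)
  have e : (Sum.elim v ((Fin.snoc (default : Fin 0 → M) a : Fin 1 → M) ∘ Fin.castAdd 0)) ∘ g =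
      fun n => Nat.casesOn n a v := by
    funext n
    cases n <;> simp [g, Fin.snoc]
  erw [e]
  refine Iff.trans (iff_of_eq ?_) this
  exact _root_.congr rfl (funext fun i => i.elim0)

instance FO.all {P : (ℕ → M) → M → Prop} [h : FO (fun v => P (fun n => v (n + 1)) (v 0))] :
    FO (fun v => ∀ y, P v y) :=
  FO.congr (P := fun v => ¬ ∃ y, ¬ P v y) inferInstance (fun v => by simp)

/-- The classes of `M` that are first-order definable with parameters. -/
def DefC (S : M → Prop) : Prop := FO (fun v => S (v 0))

theorem DefC.definable {S : Set M} (h : DefC (· ∈ S)) :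
    (Set.univ : Set M).Definable₁ setLang S := by
  obtain ⟨φ, hφ⟩ := h.out
  -- The truth of `φ` depends on variable `0` alone, so all its variables may be identified.
  refine ⟨φ.relabel (fun _ => 0), ?_⟩
  ext v
  have := hφ (v ∘ fun _ => 0)
  simp [Set.mem_ofPred_eq, this]

theorem FO.of_defC {S : M → Prop} (h : DefC S) (i : ℕ) : FO (fun v => S (v i)) :=
  FO.relabel h (fun _ => i)

instance FO.isUPair (i j k : ℕ) : FO (fun v : ℕ → M => IsUPair (v i) (v j) (v k)) := by
  unfold IsUPair; infer_instance

instance FO.isPair (i j k : ℕ) : FO (fun v : ℕ → M => IsPair (v i) (v j) (v k)) := by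
  unfold IsPair; infer_instance

end FO
set_option linter.unusedSectionVars false
set_option synthInstance.maxSize 100000
set_option synthInstance.maxHeartbeats 1000000

/-! ### Extensionality, separation, ordered pairs and products -/

section Basic
variable {M : Type*} [Membership M M]

instance FO.mem_param (i : ℕ) (a : M) : FO (fun v : ℕ → M => v i ∈ a) :=
  FO.congr (P := fun v => ∃ y, y = a ∧ v i ∈ y) inferInstance (fun v => by simp)

variable [ZFModel M]

theorem ext_iff' {a b : M} : a = b ↔ ∀ x, x ∈ a ↔ x ∈ b :=
  ⟨fun h _ => h ▸ Iff.rfl, ZFModel.zf.extensionality a b⟩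

theorem exists_sep {S : M → Prop} (hS : DefC S) (a : M) : ∃ b : M, ∀ x, x ∈ b ↔ x ∈ a ∧ S x :=
  ZFModel.zf.separation {x | S x} (DefC.definable hS) a

theorem isUPair_unique {a b x y : M} (h : IsUPair a x y) (h' : IsUPair b x y) : a = b :=
  ext_iff'.2 fun z => (h z).trans (h' z).symm

theorem isPair_unique {a b x y : M} (h : IsPair a x y) (h' : IsPair b x y) : a = b :=
  ext_iff'.2 fun z => (h z).trans (h' z).symm

theorem exists_isPair (x y : M) : ∃ p : M, IsPair p x y := by
  obtain ⟨u, hu⟩ := ZFModel.zf.pairing x x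
  obtain ⟨v, hv⟩ := ZFModel.zf.pairing x y
  obtain ⟨p, hp⟩ := ZFModel.zf.pairing u v
  refine ⟨p, fun z => (hp z).trans (or_congr ?_ ?_)⟩
  · exact ⟨fun h => h ▸ hu, fun h => isUPair_unique h hu⟩
  · exact ⟨fun h => h ▸ hv, fun h => isUPair_unique h hv⟩

/-- The Kuratowski pair. -/
noncomputable def pr (x y : M) : M := (exists_isPair x y).choose

theorem isPair_pr (x y : M) : IsPair (pr x y) x y := (exists_isPair x y).choose_spec

theorem isPair_iff {p x y : M} : IsPair p x y ↔ p = pr x y :=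
  ⟨fun h => isPair_unique h (isPair_pr x y), fun h => h ▸ isPair_pr x y⟩

theorem pr_inj {x y x' y' : M} (h : pr x y = pr x' y') : x = x' ∧ y = y' := by
  have h1 := isPair_pr x y
  have h2 := isPair_pr x' y'
  rw [← h] at h2
  obtain ⟨u, hu⟩ := ZFModel.zf.pairing x x
  obtain ⟨v, hv⟩ := ZFModel.zf.pairing x y
  obtain ⟨u', hu'⟩ := ZFModel.zf.pairing x' x'
  obtain ⟨v', hv'⟩ := ZFModel.zf.pairing x' y'
  have hx : x = x' := by
    rcases (h2 u).1 ((h1 u).2 (Or.inl hu)) with h | h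
    · have := (hu x').1 ((h x').2 (Or.inl rfl)); tauto
    · have := (hu x').1 ((h x').2 (Or.inl rfl)); tauto
  subst hx
  refine ⟨rfl, ?_⟩
  have hy : y = x ∨ y = y' := by
    rcases (h2 v).1 ((h1 v).2 (Or.inr hv)) with h | h
    · have := (h y).1 ((hv y).2 (Or.inr rfl)); tauto
    · exact (h y).1 ((hv y).2 (Or.inr rfl))
  have hy' : y' = x ∨ y' = y := by
    rcases (h1 v').1 ((h2 v').2 (Or.inr hv')) with h | h
    · have := (h y').1 ((hv' y').2 (Or.inr rfl)); tauto
    · exact (h y').1 ((hv' y').2 (Or.inr rfl))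
  grind

theorem maps_iff {f x y : M} : Maps f x y ↔ pr x y ∈ f := by
  simp [Maps, isPair_iff]

theorem exists_prod (a b : M) : ∃ c : M, ∀ p, p ∈ c ↔ ∃ x y, x ∈ a ∧ y ∈ b ∧ p = pr x y := by
  -- Both members of a Kuratowski pair are subsets of `a ∪ b`, so all the pairs lie in its double
  -- power set, from which separation cuts out the product.
  obtain ⟨q, hq⟩ := ZFModel.zf.pairing a b
  obtain ⟨u, hu⟩ := ZFModel.zf.union q
  obtain ⟨P, hP⟩ := ZFModel.zf.powerset u
  obtain ⟨PP, hPP⟩ := ZFModel.zf.powerset P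
  have : DefC (fun p : M => ∃ x y, x ∈ a ∧ y ∈ b ∧ IsPair p x y) := by
    unfold DefC; infer_instance
  obtain ⟨c, hc⟩ := exists_sep this PP
  refine ⟨c, fun p => (hc p).trans ?_⟩
  simp only [isPair_iff, and_iff_right_iff_imp]
  rintro ⟨x, y, hx, hy, rfl⟩
  have hxu : x ∈ u := (hu x).2 ⟨a, (hq a).2 (Or.inl rfl), hx⟩
  have hyu : y ∈ u := (hu y).2 ⟨b, (hq b).2 (Or.inr rfl), hy⟩
  refine (hPP _).2 fun z hz => (hP z).2 fun w hw => ?_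
  rcases (isPair_pr x y z).1 hz with h | h
  · rcases (h w).1 hw with rfl | rfl <;> exact hxu
  · rcases (h w).1 hw with rfl | rfl <;> assumption

end Basic

/-- Types coded by definable classes of `M`. -/
class DType (M : Type*) [Membership M M] (X : Type*) where
  code : X → M
  code_inj : ∀ x y, code x = code y → x = y
  range_def : DefC (fun m => ∃ x, code x = m)

/-- Types coded by sets of `M`. -/
class SType (M : Type*) [Membership M M] (X : Type*) extends DType M X where
  carrier : M
  mem_carrier : ∀ m, m ∈ carrier ↔ ∃ x, code x = m

open DType (code)

/-! ### Definable predicates and functions on coded types -/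

section Internal
variable {M : Type*} [Membership M M] [ZFModel M]

theorem code_inj_iff {X : Type*} [DType M X] {x y : X} : (code x : M) = code y ↔ x = y :=
  ⟨DType.code_inj x y, fun h => h ▸ rfl⟩

instance : DType M M where
  code := id
  code_inj _ _ h := h
  range_def := FO.congr (P := fun v => v 0 = v 0) inferInstance (by simp)

noncomputable instance {X Y : Type*} [DType M X] [DType M Y] : DType M (X × Y) where
  code p := pr (code p.1) (code p.2)
  code_inj p q h := by
    obtain ⟨h1, h2⟩ := pr_inj h
    exact Prod.ext (DType.code_inj _ _ h1) (DType.code_inj _ _ h2)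
  range_def := by
    have hX (i) := FO.of_defC (DType.range_def (M := M) (X := X)) i
    have hY (i) := FO.of_defC (DType.range_def (M := M) (X := Y)) i
    refine FO.congr (P := fun v => ∃ x y, (∃ x' : X, code x' = x) ∧ (∃ y' : Y, code y' = y) ∧
      IsPair (v 0) x y) inferInstance fun v => ?_
    simp only [isPair_iff]
    constructor
    · rintro ⟨_, _, ⟨x, rfl⟩, ⟨y, rfl⟩, h⟩
      exact ⟨(x, y), h.symm⟩
    · rintro ⟨⟨x, y⟩, h⟩
      exact ⟨_, _, ⟨x, rfl⟩, ⟨y, rfl⟩, h.symm⟩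

noncomputable instance {X Y : Type*} [SType M X] [SType M Y] : SType M (X × Y) where
  carrier := (exists_prod (SType.carrier X : M) (SType.carrier Y)).choose
  mem_carrier m := by
    rw [(exists_prod _ _).choose_spec]
    simp only [SType.mem_carrier]
    constructor
    · rintro ⟨_, _, ⟨x, rfl⟩, ⟨y, rfl⟩, h⟩
      exact ⟨(x, y), h.symm⟩
    · rintro ⟨⟨x, y⟩, h⟩
      exact ⟨_, _, ⟨x, rfl⟩, ⟨y, rfl⟩, h.symm⟩

variable (M) in
/-- The predicate `P` is definable over `M`. -/
class DP {X : Type*} [DType M X] (P : X → Prop) : Prop where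
  out : ∃ S : M → Prop, DefC S ∧ ∀ x, P x ↔ S (code x)

variable (M) in
/-- The function `f` is definable over `M`. -/
class DF {X Y : Type*} [DType M X] [DType M Y] (f : X → Y) : Prop where
  out : DP M (fun p : X × Y => f p.1 = p.2)

variable {X Y Z : Type*} [DType M X] [DType M Y] [DType M Z]

theorem DP.congr {P Q : X → Prop} (h : DP M P) (e : ∀ x, P x ↔ Q x) : DP M Q := by
  rwa [← show P = Q from funext fun x => propext (e x)]

theorem DF.of_iff {P : X × Y → Prop} (h : DP M P) {f : X → Y} (e : ∀ x y, P (x, y) ↔ f x = y) :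
    DF M f :=
  ⟨h.congr fun p => e p.1 p.2⟩

instance DP.const (p : Prop) : DP M (no_index (fun _ : X => p)) := by
  by_cases h : p
  · exact ⟨fun m => m = m, inferInstanceAs (FO fun v => v 0 = v 0), by simp [h]⟩
  · exact ⟨fun m => ¬ m = m, inferInstanceAs (FO fun v => ¬ v 0 = v 0), by simp [h]⟩

instance DP.imp {P Q : X → Prop} [h : DP M (fun x => P x)] [h' : DP M (fun x => Q x)] : DP M (no_index (fun x => P x → Q x)) := by
  obtain ⟨S, hS, e⟩ := h.out
  obtain ⟨S', hS', e'⟩ := h'.out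
  have := FO.of_defC hS 0
  have := FO.of_defC hS' 0
  exact ⟨fun m => S m → S' m, FO.imp, fun x => by rw [e, e']⟩

instance DP.and {P Q : X → Prop} [h : DP M (fun x => P x)] [h' : DP M (fun x => Q x)] : DP M (no_index (fun x => P x ∧ Q x)) :=
  DP.congr (P := fun x => ¬ (P x → ¬ Q x)) inferInstance (fun v => by simp)

instance DP.or {P Q : X → Prop} [h : DP M (fun x => P x)] [h' : DP M (fun x => Q x)] : DP M (no_index (fun x => P x ∨ Q x)) :=
  DP.congr (P := fun x => ¬ P x → Q x) inferInstance (fun v => by tauto)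

instance DP.iff {P Q : X → Prop} [h : DP M (fun x => P x)] [h' : DP M (fun x => Q x)] : DP M (no_index (fun x => P x ↔ Q x)) :=
  DP.congr (P := fun x => (P x → Q x) ∧ (Q x → P x)) inferInstance (fun v => by tauto)

/-- The codes of `Y` form a definable class, so a quantifier over `Y` is a bounded quantifier over
`M`. -/
instance DP.ex {P : X → Y → Prop} [h : DP M (fun p : X × Y => P p.1 p.2)] :
    DP M (no_index (fun x => ∃ y, P x y)) := by
  obtain ⟨S, hS, e⟩ := h.out
  have h1 := FO.of_defC hS
  have h2 := FO.of_defC (DType.range_def (M := M) (X := Y))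
  refine ⟨fun m => ∃ y q, (∃ y' : Y, code y' = y) ∧ IsPair q m y ∧ S q, ?_, fun x => ?_⟩
  · unfold DefC; infer_instance
  · simp only [isPair_iff]
    constructor
    · rintro ⟨y, hy⟩
      exact ⟨_, _, ⟨y, rfl⟩, rfl, (e (x, y)).1 hy⟩
    · rintro ⟨_, _, ⟨y, rfl⟩, rfl, h⟩
      exact ⟨y, (e (x, y)).2 h⟩

instance DP.all {P : X → Y → Prop} [h : DP M (fun p : X × Y => P p.1 p.2)] :
    DP M (no_index (fun x => ∀ y, P x y)) :=
  DP.congr (P := fun x => ¬ ∃ y, ¬ P x y) inferInstance (fun v => by simp)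

theorem DP.comp {P : Y → Prop} (h : DP M P) {f : X → Y} (hf : DF M f) :
    DP M (fun x => P (f x)) := by
  obtain ⟨S, hS, e⟩ := h.out
  obtain ⟨G, hG, e'⟩ := hf.out.out
  have h1 := FO.of_defC hS
  have h2 := FO.of_defC hG
  have h3 := FO.of_defC (DType.range_def (M := M) (X := Y))
  refine ⟨fun m => ∃ y q, (∃ y' : Y, code y' = y) ∧ IsPair q m y ∧ G q ∧ S y, ?_, fun x => ?_⟩
  · unfold DefC; infer_instance
  · simp only [isPair_iff]
    constructor
    · intro h
      exact ⟨_, _, ⟨f x, rfl⟩, rfl, (e' (x, f x)).1 rfl, (e _).1 h⟩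
    · rintro ⟨_, _, ⟨y, rfl⟩, rfl, h, h'⟩
      rw [show f x = y from (e' (x, y)).2 h]
      exact (e _).2 h'

theorem DP.eq_base : DP M (fun p : Y × Y => p.1 = p.2) := by
  refine ⟨fun q => ∃ x, IsPair q x x, by unfold DefC; infer_instance, fun p => ?_⟩
  simp only [isPair_iff]
  constructor
  · rintro h
    exact ⟨code p.1, by rw [show p = (p.1, p.1) from Prod.ext rfl h.symm]; rfl⟩
  · rintro ⟨x, h⟩
    obtain ⟨h1, h2⟩ := pr_inj h
    exact DType.code_inj _ _ (h1.trans h2.symm)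

theorem DP.mem_base : DP M (fun p : M × M => p.1 ∈ p.2) := by
  refine ⟨fun q => ∃ x y, IsPair q x y ∧ x ∈ y, by unfold DefC; infer_instance, fun p => ?_⟩
  simp only [isPair_iff]
  constructor
  · rintro h
    exact ⟨p.1, p.2, rfl, h⟩
  · rintro ⟨x, y, h, h'⟩
    obtain ⟨h1, h2⟩ := pr_inj h
    rw [show p.1 = x from h1, show p.2 = y from h2]
    exact h'

instance DF.id : DF M (no_index (fun x : X => x)) := ⟨DP.eq_base⟩

/-- Parameters are allowed in definitions, so a constant enters through its code. -/
instance DF.const (y : Y) : DF M (no_index (fun _ : X => y)) := by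
  refine ⟨fun q => ∃ x, IsPair q x (code y), ?_, fun p => ?_⟩
  · exact FO.congr (P := fun v => ∃ z : M, z = code y ∧ ∃ x, IsPair (v 0) x z) inferInstance (by simp)
  · simp only [isPair_iff]
    constructor
    · rintro rfl
      exact ⟨_, rfl⟩
    · rintro ⟨x, h⟩
      exact (DType.code_inj _ _ (pr_inj h).2).symm

theorem DF.comp {f : Y → Z} (h : DF M f) {g : X → Y} (h' : DF M g) : DF M (fun x => f (g x)) := by
  obtain ⟨F, hF, e⟩ := h.out.out
  obtain ⟨G, hG, e'⟩ := h'.out.out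
  have h1 := FO.of_defC hF
  have h2 := FO.of_defC hG
  have h3 := FO.of_defC (DType.range_def (M := M) (X := Y))
  refine ⟨fun m => ∃ x y z q r, (∃ y' : Y, code y' = y) ∧ IsPair m x z ∧ IsPair q x y ∧
    IsPair r y z ∧ G q ∧ F r, ?_, fun p => ?_⟩
  · unfold DefC; infer_instance
  · simp only [isPair_iff]
    constructor
    · intro h
      exact ⟨_, _, _, _, _, ⟨g p.1, rfl⟩, rfl, rfl, rfl, (e' (p.1, g p.1)).1 rfl,
        (e (g p.1, p.2)).1 h⟩
    · rintro ⟨_, _, _, _, _, ⟨y, rfl⟩, h1, rfl, rfl, h, h'⟩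
      obtain ⟨rfl, rfl⟩ := pr_inj h1
      rw [show g p.1 = y from (e' (p.1, y)).2 h]
      exact (e (y, p.2)).2 h'

theorem DF.fst_base : DF M (fun p : X × Y => p.1) := by
  refine ⟨fun m => ∃ x y q, IsPair m q x ∧ IsPair q x y, by unfold DefC; infer_instance,
    fun p => ?_⟩
  simp only [isPair_iff]
  constructor
  · intro h
    exact ⟨code p.1.1, code p.1.2, _, congrArg (pr _ ·) (congrArg code h.symm), rfl⟩
  · rintro ⟨x, y, _, h, rfl⟩
    obtain ⟨h1, h2⟩ := pr_inj h
    obtain ⟨h1, h3⟩ := pr_inj h1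
    exact DType.code_inj _ _ (h1.trans h2.symm)

theorem DF.snd_base : DF M (fun p : X × Y => p.2) := by
  refine ⟨fun m => ∃ x y q, IsPair m q y ∧ IsPair q x y, by unfold DefC; infer_instance,
    fun p => ?_⟩
  simp only [isPair_iff]
  constructor
  · intro h
    exact ⟨code p.1.1, code p.1.2, _, congrArg (pr _ ·) (congrArg code h.symm), rfl⟩
  · rintro ⟨x, y, _, h, rfl⟩
    obtain ⟨h1, h2⟩ := pr_inj h
    obtain ⟨h1, h3⟩ := pr_inj h1
    exact DType.code_inj _ _ (h3.trans h2.symm)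

instance DF.fst {f : X → Y × Z} [h : DF M (fun x => f x)] : DF M (no_index (fun x => (f x).1)) := DF.comp DF.fst_base h
instance DF.snd {f : X → Y × Z} [h : DF M (fun x => f x)] : DF M (no_index (fun x => (f x).2)) := DF.comp DF.snd_base h

instance DF.pair {f : X → Y} {g : X → Z} [h : DF M (fun x => f x)] [h' : DF M (fun x => g x)] : DF M (no_index (fun x => (f x, g x))) := by
  obtain ⟨F, hF, e⟩ := h.out.out
  obtain ⟨G, hG, e'⟩ := h'.out.out
  have h1 := FO.of_defC hF
  have h2 := FO.of_defC hG
  refine ⟨fun m => ∃ x y z q r s, IsPair m x s ∧ IsPair s y z ∧ IsPair q x y ∧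
    IsPair r x z ∧ F q ∧ G r, ?_, fun p => ?_⟩
  · unfold DefC; infer_instance
  · simp only [isPair_iff]
    constructor
    · intro h
      refine ⟨code p.1, code (f p.1), code (g p.1), _, _, _, ?_, rfl, rfl, rfl,
        (e (p.1, f p.1)).1 rfl, (e' (p.1, g p.1)).1 rfl⟩
      rw [show p = (p.1, (f p.1, g p.1)) from Prod.ext rfl h.symm]; rfl
    · rintro ⟨_, _, _, _, _, _, h1, rfl, rfl, rfl, h, h'⟩
      obtain ⟨h2, h1⟩ := pr_inj h1
      obtain ⟨h3, h1⟩ := pr_inj h1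
      rw [← h2, ← h3] at h
      rw [← h2, ← h1] at h'
      exact Prod.ext ((e (p.1, p.2.1)).2 h) ((e' (p.1, p.2.2)).2 h')

instance DP.eq {f g : X → Y} [DF M (fun x => f x)] [DF M (fun x => g x)] : DP M (no_index (fun x => f x = g x)) :=
  DP.comp DP.eq_base (f := fun x => (f x, g x)) inferInstance

instance DP.mem {f g : X → M} [DF M (fun x => f x)] [DF M (fun x => g x)] : DP M (no_index (fun x => f x ∈ g x)) :=
  DP.comp DP.mem_base (f := fun x => (f x, g x)) inferInstance

instance DP.exUnique {P : X → Y → Prop} [h : DP M (fun p : X × Y => P p.1 p.2)] :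
    DP M (no_index (fun x => ∃! y, P x y)) := by
  have : DP M (fun p : (X × Y) × Y => P p.1.1 p.2) :=
    DP.comp h (f := fun p : (X × Y) × Y => (p.1.1, p.2)) inferInstance
  unfold ExistsUnique
  infer_instance

instance DF.code_base : DF M (no_index (fun x : X => (code x : M))) := by
  refine ⟨fun q => ∃ x, IsPair q x x, by unfold DefC; infer_instance, fun p => ?_⟩
  simp only [isPair_iff]
  constructor
  · rintro h
    exact ⟨code p.1, congrArg (pr _) h.symm⟩
  · rintro ⟨x, h⟩
    obtain ⟨h1, h2⟩ := pr_inj h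
    exact h1.trans h2.symm

instance DF.toCode {f : X → Y} [h : DF M (fun x => f x)] : DF M (no_index (fun x : X => (code (f x) : M))) :=
  DF.comp DF.code_base h

end Internal
-- Internal subsets and functions as coded types
section HigherTypes
variable {M : Type*} [Membership M M] [ZFModel M]

variable (M) in
/-- Functions definable over `M`; if `X` and `Y` are coded by sets, these are the functions that
belong to `M`. -/
structure IFun (X Y : Type*) [DType M X] [DType M Y] where
  toFun : X → Y
  df : DF M toFun

variable (M) in
/-- Subsets of `X` that are definable over `M`; if `X` is coded by a set, these are the subsets that
belong to `M`. -/
structure ISet (X : Type*) [DType M X] where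
  toPred : X → Prop
  dp : DP M toPred

instance (X Y : Type*) [DType M X] [DType M Y] : CoeFun (IFun M X Y) (fun _ => X → Y) :=
  ⟨IFun.toFun⟩

instance (X : Type*) [DType M X] : CoeFun (ISet M X) (fun _ => X → Prop) :=
  ⟨ISet.toPred⟩

theorem IFun.ext {X Y : Type*} [DType M X] [DType M Y] {f g : IFun M X Y} (h : ∀ x, f x = g x) :
    f = g := by
  cases f; cases g; congr; exact funext h

theorem ISet.ext {X : Type*} [DType M X] {f g : ISet M X} (h : ∀ x, f x ↔ g x) :
    f = g := by
  cases f; cases g; congr; exact funext fun x => propext (h x)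

/-- Separation for sets of pairs given by a definable predicate on a type. -/
theorem exists_code_set {X : Type*} [SType M X] {P : X → Prop} (h : DP M P) :
    ∃ a : M, ∀ m, m ∈ a ↔ ∃ x, code x = m ∧ P x := by
  obtain ⟨S, hS, e⟩ := h.out
  obtain ⟨a, ha⟩ := exists_sep hS (SType.carrier X)
  refine ⟨a, fun m => (ha m).trans ?_⟩
  rw [SType.mem_carrier]
  constructor
  · rintro ⟨⟨x, rfl⟩, h⟩
    exact ⟨x, rfl, (e x).2 h⟩
  · rintro ⟨x, rfl, h⟩
    exact ⟨⟨x, rfl⟩, (e x).1 h⟩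

instance DP.code_mem {X : Type*} [DType M X] (a : M) : DP M (no_index (fun x : X => code x ∈ a)) :=
  inferInstance

/-- A definable subset of a set is a set by separation, and a set `m` is definable from the
parameter `m`. Hence the codes are exactly the elements of the power set of the carrier. -/
noncomputable instance {X : Type*} [SType M X] : SType M (ISet M X) where
  code A := (exists_code_set A.dp).choose
  code_inj A B h := by
    refine ISet.ext fun x => ?_
    have h1 := (exists_code_set A.dp).choose_spec (code x)
    have h2 := (exists_code_set B.dp).choose_spec (code x)
    replace h : (exists_code_set A.dp).choose = (exists_code_set B.dp).choose := h
    rw [h, h2] at h1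
    simpa [code_inj_iff] using h1.symm
  carrier := (ZFModel.zf.powerset (SType.carrier X)).choose
  range_def := by
    refine FO.congr (P := fun v : ℕ → M => v 0 ∈ (ZFModel.zf.powerset
      (SType.carrier X : M)).choose) (FO.mem_param 0 _) fun v => ?_
    refine Iff.trans ((ZFModel.zf.powerset (SType.carrier X)).choose_spec _) ?_
    constructor
    · intro h
      refine ⟨⟨fun x => code x ∈ v 0, inferInstance⟩, ext_iff'.2 fun m => ?_⟩
      rw [(exists_code_set (DP.code_mem _)).choose_spec]
      exact ⟨fun ⟨x, hx, h⟩ => hx ▸ h, fun hm =>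
        let ⟨x, hx⟩ := (SType.mem_carrier m).1 (h m hm); ⟨x, hx, hx ▸ hm⟩⟩
    · rintro ⟨A, h⟩ y hy
      rw [← h, (exists_code_set A.dp).choose_spec] at hy
      obtain ⟨x, rfl, -⟩ := hy
      exact (SType.mem_carrier _).2 ⟨x, rfl⟩
  mem_carrier m := by
    rw [(ZFModel.zf.powerset (SType.carrier X)).choose_spec]
    constructor
    · intro h
      refine ⟨⟨fun x => code x ∈ m, inferInstance⟩, ext_iff'.2 fun n => ?_⟩
      rw [(exists_code_set (DP.code_mem m)).choose_spec]
      exact ⟨fun ⟨x, hx, h⟩ => hx ▸ show code x ∈ m from h, fun hm =>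
        let ⟨x, hx⟩ := (SType.mem_carrier n).1 (h n hm); ⟨x, hx, show code x ∈ m from hx ▸ hm⟩⟩
    · rintro ⟨A, h⟩ y hy
      rw [← h, (exists_code_set A.dp).choose_spec] at hy
      obtain ⟨x, rfl, -⟩ := hy
      exact (SType.mem_carrier _).2 ⟨x, rfl⟩

theorem ISet.mem_code {X : Type*} [SType M X] (A : ISet M X) (m : M) :
    m ∈ (code A : M) ↔ ∃ x, code x = m ∧ A x :=
  (exists_code_set A.dp).choose_spec m

theorem ISet.code_mem_code {X : Type*} [SType M X] (A : ISet M X) (x : X) :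
    (code x : M) ∈ (code A : M) ↔ A x := by
  simp [ISet.mem_code, code_inj_iff]

/-- Every set of codes is the code of an internal set. -/
theorem ISet.exists_code_eq {X : Type*} [SType M X] {a : M}
    (h : ∀ m, m ∈ a → ∃ x : X, code x = m) : ∃ A : ISet M X, code A = a := by
  refine ⟨⟨fun x => code x ∈ a, inferInstance⟩, ext_iff'.2 fun m => ?_⟩
  rw [ISet.mem_code]
  exact ⟨fun ⟨x, hx, h⟩ => hx ▸ show code x ∈ a from h, fun hm =>
    let ⟨x, hx⟩ := h m hm; ⟨x, hx, show code x ∈ a from hx ▸ hm⟩⟩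

/-- The graph of an internal function. -/
def IFun.graph {X Y : Type*} [DType M X] [DType M Y] (f : IFun M X Y) : ISet M (X × Y) :=
  ⟨fun p => f p.1 = p.2, f.df.out⟩

instance ISet.dp_mem {X Y : Type*} [DType M Y] [SType M X] {A : Y → ISet M X} {f : Y → X}
    [h : DF M (fun x => A x)] [DF M (fun x => f x)] : DP M (no_index (fun y => (A y) (f y))) := by
  refine DP.congr (P := fun y => (code (f y) : M) ∈ (code (A y) : M)) inferInstance fun y => ?_
  rw [ISet.code_mem_code]

/-- Functions are coded by their graphs; being the graph of a total function is a definable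
condition on a set of pairs. -/
noncomputable instance {X Y : Type*} [SType M X] [SType M Y] : DType M (IFun M X Y) where
  code f := code f.graph
  code_inj f g h := by
    have := DType.code_inj _ _ h
    refine IFun.ext fun x => ?_
    have := congrFun (congrArg ISet.toPred this) (x, f x)
    exact (of_eq_true (this.symm.trans (eq_true rfl)) : g x = f x).symm
  range_def := by
    have h : DP M (fun A : ISet M (X × Y) => ∀ x, ∃! y, A (x, y)) := inferInstance
    obtain ⟨S, hS, e⟩ := h.out
    have h1 := FO.of_defC hS
    have h2 := FO.of_defC (DType.range_def (M := M) (X := ISet M (X × Y)))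
    refine FO.congr (P := fun v => (∃ A : ISet M (X × Y), code A = v 0) ∧ S (v 0)) inferInstance
      fun v => ?_
    constructor
    · rintro ⟨⟨A, hA⟩, hv⟩
      rw [← hA, ← e] at hv
      choose f hf hf' using hv
      refine ⟨⟨f, DF.of_iff A.dp fun x y => ⟨fun h => (hf' x y h).symm, ?_⟩⟩, ?_⟩
      · rintro rfl; exact hf x
      · rw [← hA]
        refine congrArg code (ISet.ext fun p => ⟨?_, fun h => (hf' _ _ h).symm⟩)
        obtain ⟨a, b⟩ := p
        intro h
        cases (show f a = b from h)
        exact hf a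
    · rintro ⟨f, hf⟩
      rw [← hf, ← e]
      exact ⟨⟨f.graph, rfl⟩, fun x => ⟨f x, rfl, fun y h => h.symm⟩⟩

noncomputable instance {X Y : Type*} [SType M X] [SType M Y] : SType M (IFun M X Y) where
  carrier := (exists_sep (DType.range_def (M := M) (X := IFun M X Y))
    (SType.carrier (ISet M (X × Y)))).choose
  mem_carrier m := by
    rw [(exists_sep (DType.range_def (M := M) (X := IFun M X Y))
      (SType.carrier (ISet M (X × Y)))).choose_spec, SType.mem_carrier, and_iff_right_iff_imp]
    rintro ⟨f, rfl⟩
    exact ⟨f.graph, rfl⟩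

section
variable {X Y Z : Type*} [DType M X] [SType M Y] [SType M Z]

theorem IFun.maps_code (f : IFun M Y Z) (a b : M) :
    Maps (code f) a b ↔ ∃ y, code y = a ∧ code (f y) = b := by
  rw [maps_iff, show (code f : M) = code f.graph from rfl, ISet.mem_code]
  constructor
  · rintro ⟨⟨y, z⟩, h, h'⟩
    obtain ⟨h1, h2⟩ := pr_inj h
    exact ⟨y, h1, by rw [show f y = z from h', h2]⟩
  · rintro ⟨y, rfl, rfl⟩
    exact ⟨(y, f y), rfl, rfl⟩

theorem IFun.maps_code_code (f : IFun M Y Z) (y : Y) (z : Z) :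
    Maps (code f : M) (code y) (code z) ↔ f y = z := by
  simp [IFun.maps_code, code_inj_iff]

theorem IFun.exists_code_eq {a : M}
    (h : IsFun a {m | ∃ y : Y, code y = m} {m | ∃ z : Z, code z = m}) :
    ∃ f : IFun M Y Z, code f = a := by
  obtain ⟨A, hA⟩ := ISet.exists_code_eq (X := Y × Z) (a := a) (by
    intro m hm
    obtain ⟨_, ⟨y, rfl⟩, _, ⟨z, rfl⟩, h⟩ := h.1 m hm
    exact ⟨(y, z), (isPair_iff.1 h).symm⟩)
  have h1 : ∀ y, ∃ z, A (y, z) ∧ ∀ z', A (y, z') → z' = z := by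
    intro y
    obtain ⟨_, hz, hu⟩ := h.2 (code y) ⟨y, rfl⟩
    rw [maps_iff, ← hA, ISet.mem_code] at hz
    obtain ⟨⟨y', z⟩, hz, h1⟩ := hz
    obtain ⟨h2, h3⟩ := pr_inj hz
    cases DType.code_inj _ _ h2
    refine ⟨z, h1, fun z' hz' => ?_⟩
    have := hu (code z') (by
      show Maps _ _ _
      rw [maps_iff, ← hA, ISet.mem_code]
      exact ⟨(y', z'), rfl, hz'⟩)
    exact DType.code_inj _ _ (this.trans h3.symm)
  choose f hf hf' using h1
  refine ⟨⟨f, DF.of_iff A.dp fun x y => ⟨fun h => (hf' x y h).symm, ?_⟩⟩, ?_⟩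
  · rintro rfl; exact hf x
  · rw [← hA]
    refine congrArg code (ISet.ext fun p => ⟨?_, fun h => (hf' _ _ h).symm⟩)
    obtain ⟨a, b⟩ := p
    intro h
    cases (show f a = b from h)
    exact hf a

theorem IFun.isFun_code (f : IFun M Y Z) :
    IsFun (code f : M) {m | ∃ y : Y, code y = m} {m | ∃ z : Z, code z = m} := by
  constructor
  · intro p hp
    obtain ⟨q, rfl, h⟩ := (ISet.mem_code _ _).1 hp
    exact ⟨_, ⟨q.1, rfl⟩, _, ⟨q.2, rfl⟩, isPair_pr _ _⟩
  · rintro _ ⟨y, rfl⟩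
    refine ⟨code (f y), (f.maps_code_code _ _).2 rfl, fun z hz => ?_⟩
    obtain ⟨y', h, rfl⟩ := (f.maps_code _ _).1 hz
    cases DType.code_inj _ _ h
    rfl

instance IFun.df_app {f : X → IFun M Y Z} {g : X → Y} [DF M (fun x => f x)] [DF M (fun x => g x)] :
    DF M (no_index (fun x => (f x) (g x))) := by
  have : DP M (fun p : X × Z => pr (code (g p.1)) (code p.2) ∈ (code (f p.1) : M)) := by
    have h : DP M (fun p : X × Z => ∃ y z, y = g p.1 ∧ z = p.2 ∧
      (code (y, z) : M) ∈ (code (f p.1) : M)) := by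
      have h1 : DF M (fun p : X × Z => g p.1) := DF.comp ‹DF M g› inferInstance
      have h2 : DF M (fun p : X × Z => f p.1) := DF.comp ‹DF M f› inferInstance
      have h3 : DF M (fun p : (X × Z) × Y => g p.1.1) := DF.comp ‹DF M g› inferInstance
      have h4 : DF M (fun p : ((X × Z) × Y) × Z => g p.1.1.1) := DF.comp ‹DF M g› inferInstance
      have h5 : DF M (fun p : ((X × Z) × Y) × Z => f p.1.1.1) := DF.comp ‹DF M f› inferInstance
      infer_instance
    refine h.congr fun p => ?_
    constructor
    · rintro ⟨_, _, rfl, rfl, h⟩; exact h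
    · intro h; exact ⟨_, _, rfl, rfl, h⟩
  exact DF.of_iff this fun x z => by rw [← maps_iff, IFun.maps_code_code]

instance IFun.df_of (f : IFun M Y Z) : DF M (no_index (fun y => f y)) := f.df

end

/-- The unique element of `Y` with the property `P`. -/
noncomputable def the {Y : Type*} [Inhabited Y] (P : Y → Prop) : Y :=
  open Classical in if h : ∃! y, P y then h.choose else default

theorem the_eq {Y : Type*} [Inhabited Y] {P : Y → Prop} {y : Y} (h : P y)
    (hu : ∀ z, P z → z = y) : the P = y := by
  have h' : ∃! y, P y := ⟨y, h, hu⟩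
  rw [the, dif_pos h']
  exact hu _ h'.choose_spec.1

theorem the_spec {Y : Type*} [Inhabited Y] {P : Y → Prop} (h : ∃! y, P y) : P (the P) := by
  rw [the, dif_pos h]
  exact h.choose_spec.1

variable {X Y Z : Type*} [DType M X] [DType M Y] [DType M Z]

/-- The graph is defined by cases: the unique solution where there is one, the default value
elsewhere. -/
instance the.df [Inhabited Y] {P : X → Y → Prop} [h : DP M (fun p : X × Y => P p.1 p.2)] :
    DF M (no_index (fun x => the (P x))) := by
  have : DP M (fun p : (X × Y) × Y => P p.1.1 p.2) :=
    DP.comp h (f := fun p : (X × Y) × Y => (p.1.1, p.2)) inferInstance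
  have h' : DP M (fun p : X × Y => (P p.1 p.2 ∧ ∃! y, P p.1 y) ∨ (¬ ∃! y, P p.1 y) ∧ p.2 = default) :=
    inferInstance
  refine DF.of_iff h' fun x y => ?_
  unfold the
  by_cases hu : ∃! y, P x y
  · rw [dif_pos hu]
    simp only [hu, and_true, not_true, false_and, or_false]
    exact ⟨fun h => hu.unique hu.choose_spec.1 h, fun h => h ▸ hu.choose_spec.1⟩
  · rw [dif_neg hu]
    simp only [hu, and_false, false_or, not_false_iff, true_and]
    exact eq_comm

instance ite.df {P : X → Prop} [∀ x, Decidable (P x)] {f g : X → Y} [hP : DP M (fun x => P x)] [hf : DF M (fun x => f x)]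
    [hg : DF M (fun x => g x)] : DF M (no_index (fun x => if P x then f x else g x)) := by
  have h1 : DP M (fun p : X × Y => P p.1) := DP.comp hP inferInstance
  have h2 : DF M (fun p : X × Y => f p.1) := DF.comp hf inferInstance
  have h3 : DF M (fun p : X × Y => g p.1) := DF.comp hg inferInstance
  have h' : DP M (fun p : X × Y => (P p.1 ∧ f p.1 = p.2) ∨ (¬ P p.1) ∧ g p.1 = p.2) :=
    inferInstance
  refine DF.of_iff h' fun x y => ?_
  by_cases h : P x <;> simp [h]

variable (M) in
/-- The internal function with the given values. -/
noncomputable def IFun.of [Inhabited Y] (f : X → Y) : IFun M X Y :=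
  open Classical in if h : DF M f then ⟨f, h⟩ else ⟨fun _ => default, inferInstance⟩

@[simp] theorem IFun.of_apply [Inhabited Y] (f : X → Y) [h : DF M f] (x : X) :
    IFun.of M f x = f x := by
  rw [IFun.of, dif_pos h]

variable (M) in
/-- The internal set with the given members. -/
noncomputable def ISet.of (P : X → Prop) : ISet M X :=
  open Classical in if h : DP M P then ⟨P, h⟩ else ⟨fun _ => False, inferInstance⟩

@[simp] theorem ISet.of_apply (P : X → Prop) [h : DP M P] (x : X) :
    ISet.of M P x ↔ P x := by
  rw [ISet.of, dif_pos h]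

instance [Inhabited Y] : Inhabited (IFun M X Y) := ⟨⟨fun _ => default, inferInstance⟩⟩
instance : Inhabited (ISet M X) := ⟨⟨fun _ => False, inferInstance⟩⟩

theorem DP.section {P : X → Y → Prop} (h : DP M (fun p : X × Y => P p.1 p.2)) (x : X) :
    DP M (P x) :=
  DP.comp h (f := fun y => (x, y)) inferInstance

theorem DF.section {f : X → Y → Z} (h : DF M (fun p : X × Y => f p.1 p.2)) (x : X) :
    DF M (f x) :=
  DF.comp h (f := fun p : X × Y => f p.1 p.2) (g := fun y => (x, y)) inferInstance

/-- Comprehension is definable in its parameters because, by extensionality, a set equals the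
comprehension exactly when it has the same members. -/
instance ISet.of_df {X Y : Type*} [DType M X] [SType M Y] {P : X → Y → Prop}
    [h : DP M (fun p : X × Y => P p.1 p.2)] : DF M (no_index (fun x => ISet.of M (P x))) := by
  have : DP M (fun p : (X × ISet M Y) × Y => P p.1.1 p.2) :=
    DP.comp h (f := fun p : (X × ISet M Y) × Y => (p.1.1, p.2)) inferInstance
  refine DF.of_iff (P := fun p : X × ISet M Y => ∀ y, P p.1 y ↔ p.2 y) inferInstance fun x A => ?_
  have := DP.section h x
  exact ⟨fun h => ISet.ext fun y => (ISet.of_apply _ _).trans (h y),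
    fun h y => h ▸ (ISet.of_apply _ _).symm⟩

instance IFun.of_df {X Y Z : Type*} [DType M X] [SType M Y] [SType M Z] [Inhabited Z]
    {f : X → Y → Z} [h : DF M (fun p : X × Y => f p.1 p.2)] : DF M (no_index (fun x => IFun.of M (f x))) := by
  have : DF M (fun p : (X × IFun M Y Z) × Y => f p.1.1 p.2) :=
    DF.comp h (f := fun p : X × Y => f p.1 p.2)
      (g := fun p : (X × IFun M Y Z) × Y => (p.1.1, p.2)) inferInstance
  refine DF.of_iff (P := fun p : X × IFun M Y Z => ∀ y, f p.1 y = p.2 y) inferInstance fun x A => ?_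
  have := DF.section h x
  exact ⟨fun h => IFun.ext fun y => (IFun.of_apply _ _).trans (h y),
    fun h y => h ▸ (IFun.of_apply _ _).symm⟩

end HigherTypes

/-! ### Definability of the basic notions of set theory -/

section Definability
variable {M : Type*} [Membership M M] [ZFModel M] {X Y Z : Type*} [DType M X] [DType M Y] [DType M Z]

instance DP.isEmpty {f : X → M} [h : DF M (fun x => f x)] :
    DP M (no_index (fun x => IsEmpty (f x))) :=
  DP.comp (P := fun x : M => IsEmpty x) (by unfold IsEmpty; infer_instance) h

instance DP.isTransitive {f : X → M} [h : DF M (fun x => f x)] :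
    DP M (no_index (fun x => IsTransitive (f x))) :=
  DP.comp (P := fun x : M => IsTransitive x) (by unfold IsTransitive; infer_instance) h

instance DP.isOrd {f : X → M} [h : DF M (fun x => f x)] :
    DP M (no_index (fun x => IsOrd (f x))) :=
  DP.comp (P := fun x : M => IsOrd x) (by unfold IsOrd; infer_instance) h

instance DP.isLe {f g : X → M} [h : DF M (fun x => f x)] [h' : DF M (fun x => g x)] :
    DP M (no_index (fun x => Le (f x) (g x))) := by
  unfold Le; infer_instance

instance DP.isSucc {f g : X → M} [h : DF M (fun x => f x)] [h' : DF M (fun x => g x)] :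
    DP M (no_index (fun x => IsSucc (f x) (g x))) :=
  DP.comp (P := fun p : M × M => IsSucc p.1 p.2) (f := fun x => (f x, g x))
    (by unfold IsSucc; infer_instance) inferInstance

instance DP.isUPair {f g k : X → M} [h : DF M (fun x => f x)] [h' : DF M (fun x => g x)]
    [h'' : DF M (fun x => k x)] : DP M (no_index (fun x => IsUPair (f x) (g x) (k x))) :=
  DP.comp (P := fun p : M × M × M => IsUPair p.1 p.2.1 p.2.2) (f := fun x => (f x, g x, k x))
    (by unfold IsUPair; infer_instance) inferInstance

instance DP.isPair {f g k : X → M} [h : DF M (fun x => f x)] [h' : DF M (fun x => g x)]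
    [h'' : DF M (fun x => k x)] : DP M (no_index (fun x => IsPair (f x) (g x) (k x))) :=
  DP.comp (P := fun p : M × M × M => IsPair p.1 p.2.1 p.2.2) (f := fun x => (f x, g x, k x))
    (by unfold IsPair; infer_instance) inferInstance

instance DP.maps {f g k : X → M} [h : DF M (fun x => f x)] [h' : DF M (fun x => g x)]
    [h'' : DF M (fun x => k x)] : DP M (no_index (fun x => Maps (f x) (g x) (k x))) :=
  DP.comp (P := fun p : M × M × M => Maps p.1 p.2.1 p.2.2) (f := fun x => (f x, g x, k x))
    (by unfold Maps; infer_instance) inferInstance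

instance DP.mem_ext {f g : X → M} [h : DF M (fun x => f x)] [h' : DF M (fun x => g x)] :
    DP M (no_index (fun x => f x ∈ ext (g x))) :=
  inferInstanceAs (DP M (fun x => f x ∈ g x))

instance DP.mem_omega {f : X → M} [h : DF M (fun x => f x)] :
    DP M (no_index (fun x => f x ∈ omega M)) :=
  DP.comp (P := fun n : M => IsOrd n ∧ ∀ m : M, Le m n → IsEmpty m ∨ ∃ k : M, IsSucc m k)
    inferInstance h

theorem DP.defC {S : M → Prop} (h : DP M S) : DefC S := by
  obtain ⟨S', hS, e⟩ := h.out
  exact FO.congr hS fun v => (e (v 0)).symm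

theorem exists_sep' (S : M → Prop) [h : DP M S] (a : M) : ∃ b : M, ∀ x, x ∈ b ↔ x ∈ a ∧ S x :=
  exists_sep h.defC a

end Definability

/-! ### Ordinals: induction, comparison, recursion -/

section Ordinals
variable {M : Type*} [Membership M M] [ZFModel M]

theorem mem_irrefl (x : M) : ¬ x ∈ x := by
  intro h
  obtain ⟨a, ha⟩ := ZFModel.zf.pairing x x
  obtain ⟨y, hy, hy'⟩ := ZFModel.zf.foundation a ⟨x, (ha x).2 (Or.inl rfl)⟩
  have : y = x := by simpa using (ha y).1 hy
  subst this
  exact hy' y h hy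

theorem mem_asymm {x y : M} (h : x ∈ y) : ¬ y ∈ x := by
  intro h'
  obtain ⟨a, ha⟩ := ZFModel.zf.pairing x y
  obtain ⟨z, hz, hz'⟩ := ZFModel.zf.foundation a ⟨x, (ha x).2 (Or.inl rfl)⟩
  rcases (ha z).1 hz with rfl | rfl
  · exact hz' y h' ((ha y).2 (Or.inr rfl))
  · exact hz' x h ((ha x).2 (Or.inl rfl))

theorem IsOrd.of_mem {a x : M} (h : IsOrd a) (hx : x ∈ a) : IsOrd x :=
  ⟨h.2 x hx, fun y hy => h.2 y (h.1 x hx y hy)⟩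

theorem IsOrd.mem_trans {a x y : M} (h : IsOrd a) (hx : x ∈ a) (hy : y ∈ x) : y ∈ a :=
  h.1 x hx y hy

/-- Foundation speaks about sets only. Definability of `P` makes the counterexamples below `a` a
set, which then has a minimal element. -/
theorem IsOrd.induction (P : M → Prop) [DP M P]
    (step : ∀ a, IsOrd a → (∀ x, x ∈ a → P x) → P a) {a : M} (h : IsOrd a) : P a := by
  by_contra hP
  have hD : DP M (fun x => ¬ P x) := inferInstance
  obtain ⟨b, hb⟩ := exists_sep' (fun x => ¬ P x) a
  by_cases hne : ∃ x, x ∈ b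
  · obtain ⟨x, hx, hx'⟩ := ZFModel.zf.foundation b hne
    refine ((hb x).1 hx).2 (step x (h.of_mem ((hb x).1 hx).1) fun y hy => ?_)
    by_contra hy'
    exact hx' y hy ((hb y).2 ⟨h.mem_trans ((hb x).1 hx).1 hy, hy'⟩)
  · refine hP (step a h fun x hx => ?_)
    by_contra hx'
    exact hne ⟨x, (hb x).2 ⟨hx, hx'⟩⟩

/-- Double induction: if `a` and `b` were not comparable, both inductive hypotheses would show that
they have the same elements. -/
theorem IsOrd.trichotomy {a b : M} (ha : IsOrd a) (hb : IsOrd b) : a ∈ b ∨ a = b ∨ b ∈ a := by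
  refine IsOrd.induction (fun a => ∀ b, IsOrd b → a ∈ b ∨ a = b ∨ b ∈ a) ?_ ha b hb
  intro a ha iha b hb
  refine IsOrd.induction (fun b => a ∈ b ∨ a = b ∨ b ∈ a) ?_ hb
  intro b hb ihb
  by_contra hne
  push Not at hne
  refine hne.2.1 (ext_iff'.2 fun x => ⟨fun hx => ?_, fun hx => ?_⟩)
  · rcases iha x hx b hb with h | h | h
    · exact h
    · exact absurd (h ▸ hx) hne.2.2
    · exact absurd (ha.mem_trans hx h) hne.2.2
  · rcases ihb x hx with h | h | h
    · exact absurd (hb.mem_trans hx h) hne.1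
    · exact absurd (h ▸ hx) hne.1
    · exact h

/-- The type of elements of a set of `M`. -/
def El (a : M) : Type _ := {x : M // x ∈ a}

instance (a : M) : DType M (El a) where
  code x := x.1
  code_inj _ _ h := Subtype.ext h
  range_def := FO.congr (P := fun v => v 0 ∈ a) inferInstance fun v =>
    ⟨fun h => ⟨⟨v 0, h⟩, rfl⟩, fun ⟨x, h⟩ => h ▸ x.2⟩

instance (a : M) : SType M (El a) where
  carrier := a
  mem_carrier m := ⟨fun h => ⟨⟨m, h⟩, rfl⟩, fun ⟨x, h⟩ => h ▸ x.2⟩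

theorem El.code_eq {a : M} (x : El a) : code x = x.1 := rfl

instance El.df_val {X : Type*} [DType M X] {a : M} {f : X → El a} [h : DF M (fun x => f x)] :
    DF M (no_index (fun x => (f x).1)) :=
  inferInstanceAs (DF M (fun x => (code (f x) : M)))

theorem DF.of_toCode {X Y : Type*} [DType M X] [DType M Y] {f : X → Y}
    (h : DF M (fun x => (code (f x) : M))) : DF M f := by
  have : DF M (fun p : X × Y => (code (f p.1) : M)) :=
    DF.comp (f := fun x => (code (f x) : M)) h DF.fst_base
  have : DP M (fun p : X × Y => (code (f p.1) : M) = code p.2) := inferInstance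
  exact DF.of_iff this fun x y => code_inj_iff

/-- An element of `a`, as a term of type `El a`. -/
def El.mk {a : M} (x : M) (h : x ∈ a) : El a := ⟨x, h⟩

instance El.df_mk {X : Type*} [DType M X] {a : M} {f : X → M} {hf : ∀ x, f x ∈ a}
    [h : DF M (fun x => f x)] : DF M (no_index (fun x => El.mk (f x) (hf x))) :=
  DF.of_toCode h

/-- The set `a` is an ordinal. -/
class OrdSet (a : M) : Prop where
  isOrd : IsOrd a

variable {a : M} [ha : OrdSet a]

noncomputable instance : LinearOrder (El a) where
  le x y := Le x.1 y.1
  lt x y := x.1 ∈ y.1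
  le_refl x := Or.inr rfl
  le_trans x y z h h' := by
    rcases h with h | h
    · rcases h' with h' | h'
      · exact Or.inl ((ha.isOrd.of_mem z.2).mem_trans h' h)
      · exact Or.inl (h' ▸ h)
    · exact h ▸ h'
  le_antisymm x y h h' := by
    rcases h with h | h
    · rcases h' with h' | h'
      · exact absurd h (mem_asymm h')
      · exact Subtype.ext h'.symm
    · exact Subtype.ext h
  lt_iff_le_not_ge x y := by
    constructor
    · intro h
      refine ⟨Or.inl h, ?_⟩
      rintro (h' | h')
      · exact mem_asymm h h'
      · exact mem_irrefl _ (h' ▸ h)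
    · rintro ⟨h | h, h'⟩
      · exact h
      · exact absurd (Or.inr h.symm) h'
  le_total x y := by
    rcases (ha.isOrd.of_mem x.2).trichotomy (ha.isOrd.of_mem y.2) with h | h | h
    · exact Or.inl (Or.inl h)
    · exact Or.inl (Or.inr h)
    · exact Or.inr (Or.inl h)
  toDecidableLE := fun _ _ => Classical.propDecidable _

variable {X : Type*} [DType M X]

instance El.dp_lt {f g : X → El a} [h : DF M (fun x => f x)] [h' : DF M (fun x => g x)] :
    DP M (no_index (fun x => f x < g x)) :=
  inferInstanceAs (DP M (fun x => (f x).1 ∈ (g x).1))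

instance El.dp_le {f g : X → El a} [h : DF M (fun x => f x)] [h' : DF M (fun x => g x)] :
    DP M (no_index (fun x => f x ≤ g x)) :=
  inferInstanceAs (DP M (fun x => Le (f x).1 (g x).1))

/-- This is foundation, applied to the set of codes. It also replaces choice: least witnesses are
definable. -/
theorem El.exists_min (P : El a → Prop) [h : DP M P] (hP : ∃ x, P x) :
    ∃ x, P x ∧ ∀ y, y < x → ¬ P y := by
  obtain ⟨b, hb⟩ := exists_code_set h
  obtain ⟨x, hx⟩ := hP
  obtain ⟨m, hm, hm'⟩ := ZFModel.zf.foundation b ⟨_, (hb _).2 ⟨x, rfl, hx⟩⟩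
  obtain ⟨y, rfl, hy⟩ := (hb m).1 hm
  exact ⟨y, hy, fun z hz hz' => hm' _ hz ((hb _).2 ⟨z, rfl, hz'⟩)⟩

theorem El.induction (P : El a → Prop) [h : DP M P] (step : ∀ x, (∀ y, y < x → P y) → P x) (x : El a) :
    P x := by
  by_contra hx
  obtain ⟨y, hy, hy'⟩ := El.exists_min (fun x => ¬ P x) ⟨x, hx⟩
  exact hy (step y fun z hz => not_not.1 (hy' z hz))

/-- Recursion on ordinals. -/
theorem El.exists_rec {Y : Type*} [SType M Y] [Inhabited Y] (G : El a → IFun M (El a) Y → Y)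
    [hG : DF M (fun p : El a × IFun M (El a) Y => G p.1 p.2)]
    (loc : ∀ t f g, (∀ s, s < t → f s = g s) → G t f = G t g) :
    ∃ f : IFun M (El a) Y, ∀ t, f t = G t f := by
  have h1 : DF M (fun p : ((El a × Y) × IFun M (El a) Y) => G p.1.1 p.2) :=
    DF.comp hG (g := fun p : ((El a × Y) × IFun M (El a) Y) => (p.1.1, p.2)) inferInstance
  have h2 : DF M (fun p : ((El a × Y) × IFun M (El a) Y) × El a => G p.2 p.1.2) :=
    DF.comp hG (g := fun p : ((El a × Y) × IFun M (El a) Y) × El a => (p.2, p.1.2)) inferInstance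
  -- The value at `s` is computed by any total function that obeys the recursion below `s`. By
  -- locality its values from `s` on do not matter, so partial functions are not needed.
  let F : IFun M (El a) Y := IFun.of M fun s => the fun y =>
    ∃ f : IFun M (El a) Y, (∀ r, r < s → f r = G r f) ∧ y = G s f
  have hF : ∀ s, F s = the fun y =>
      ∃ f : IFun M (El a) Y, (∀ r, r < s → f r = G r f) ∧ y = G s f := fun s => IFun.of_apply _ _
  have h3 : DF M (fun s => G s F) :=
    DF.comp hG (g := fun s : El a => (s, F)) inferInstance
  refine ⟨F, El.induction (fun t => F t = G t F) fun t ih => ?_⟩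
  rw [hF]
  refine the_eq ⟨F, ih, rfl⟩ ?_
  -- Uniqueness: any other attempt agrees with `F` below `t`, by an inner induction.
  rintro _ ⟨f, hf, rfl⟩
  refine loc _ _ _ ?_
  have h4 : DF M (fun s => G s f) := DF.comp hG (g := fun s : El a => (s, f)) inferInstance
  refine El.induction (fun s => s < t → f s = F s) fun s ihs hs => ?_
  rw [hf s hs, ih s hs]
  exact loc _ _ _ fun r hr => ihs r hr (hr.trans hs)

theorem El.rec_unique {Y : Type*} [SType M Y] (G : El a → IFun M (El a) Y → Y)
    (loc : ∀ t f g, (∀ s, s < t → f s = g s) → G t f = G t g) {f g : IFun M (El a) Y}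
    (hf : ∀ t, f t = G t f) (hg : ∀ t, g t = G t g) : f = g := by
  refine IFun.ext (El.induction (fun t => f t = g t) fun t ih => ?_)
  rw [hf, hg]
  exact loc _ _ _ ih

end Ordinals

/-! ### The natural numbers of the model and primitive recursion -/

section Omega
variable {M : Type*} [Membership M M] [ZFModel M]

theorem isSucc_unique {s t n : M} (h : IsSucc s n) (h' : IsSucc t n) : s = t :=
  ext_iff'.2 fun x => (h x).trans (h' x).symm

theorem isEmpty_unique {s t : M} (h : IsEmpty s) (h' : IsEmpty t) : s = t :=
  ext_iff'.2 fun x => ⟨fun hx => absurd hx (h x), fun hx => absurd hx (h' x)⟩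

theorem isOrd_of_isEmpty {e : M} (h : IsEmpty e) : IsOrd e :=
  ⟨fun x hx => absurd hx (h x), fun x hx => absurd hx (h x)⟩

theorem IsOrd.succ {n s : M} (h : IsOrd n) (hs : IsSucc s n) : IsOrd s := by
  constructor
  · intro x hx y hy
    rcases (hs x).1 hx with hx | rfl
    · exact (hs y).2 (Or.inl (h.mem_trans hx hy))
    · exact (hs y).2 (Or.inl hy)
  · intro x hx
    rcases (hs x).1 hx with hx | rfl
    · exact h.2 x hx
    · exact h.1

theorem omega_of_mem {n m : M} (h : n ∈ omega M) (hm : m ∈ n) : m ∈ omega M := by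
  refine ⟨h.1.of_mem hm, fun k hk => h.2 k (Or.inl ?_)⟩
  rcases hk with hk | rfl
  · exact h.1.mem_trans hm hk
  · exact hm

theorem zero_mem_omega {e : M} (h : IsEmpty e) : e ∈ omega M := by
  refine ⟨isOrd_of_isEmpty h, fun m hm => Or.inl ?_⟩
  rcases hm with hm | rfl
  · exact absurd hm (h m)
  · exact h

theorem succ_mem_omega {n s : M} (h : n ∈ omega M) (hs : IsSucc s n) : s ∈ omega M := by
  refine ⟨h.1.succ hs, fun m hm => ?_⟩
  rcases hm with hm | rfl
  · rcases (hs m).1 hm with hm | rfl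
    · exact h.2 m (Or.inl hm)
    · exact h.2 m (Or.inr rfl)
  · exact Or.inr ⟨n, hs⟩

-- The inductive set given by the axiom of infinity contains every natural number, by induction on
-- ordinals; separation then removes the rest.
variable (M) in
theorem exists_omega : ∃ w : M, ∀ n, n ∈ w ↔ n ∈ omega M := by
  obtain ⟨w, ⟨e, he, hew⟩, hw⟩ := ZFModel.zf.infinity (M := M)
  obtain ⟨b, hb⟩ := exists_sep' (fun n => n ∈ omega M) w
  refine ⟨b, fun n => (hb n).trans (and_iff_right_of_imp fun hn => ?_)⟩
  refine IsOrd.induction (fun n => n ∈ omega M → n ∈ w) ?_ hn.1 hn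
  intro n _ ih hn
  rcases hn.2 n (Or.inr rfl) with h | ⟨k, hk⟩
  · exact isEmpty_unique h he ▸ hew
  · have hkn : k ∈ n := (hk k).2 (Or.inr rfl)
    obtain ⟨s, hs, hsw⟩ := hw k (ih k hkn (omega_of_mem hn hkn))
    exact isSucc_unique hk hs ▸ hsw

variable (M) in
/-- The set of natural numbers of `M`. -/
noncomputable def omegaSet : M := (exists_omega M).choose

theorem mem_omegaSet {n : M} : n ∈ omegaSet M ↔ n ∈ omega M := (exists_omega M).choose_spec n

instance : OrdSet (omegaSet M) where
  isOrd := ⟨fun _ hx _ hy => mem_omegaSet.2 (omega_of_mem (mem_omegaSet.1 hx) hy),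
    fun _ hx => (mem_omegaSet.1 hx).1.1⟩

variable (M) in
/-- The type of natural numbers of `M`. -/
abbrev N : Type _ := El (omegaSet M)

variable (M) in
/-- The type of reals of `M`. -/
abbrev R : Type _ := IFun M (N M) (N M)

theorem exists_empty : ∃ e : M, IsEmpty e := by
  obtain ⟨w, ⟨e, he, hew⟩, hw⟩ := ZFModel.zf.infinity (M := M)
  exact ⟨e, he⟩

theorem exists_succ (n : M) : ∃ s : M, IsSucc s n := by
  obtain ⟨a, ha⟩ := ZFModel.zf.pairing n n
  obtain ⟨b, hb⟩ := ZFModel.zf.pairing n a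
  obtain ⟨c, hc⟩ := ZFModel.zf.union b
  refine ⟨c, fun x => (hc x).trans ⟨?_, ?_⟩⟩
  · rintro ⟨y, hy, hx⟩
    rcases (hb y).1 hy with rfl | rfl
    · exact Or.inl hx
    · exact Or.inr (by simpa using (ha x).1 hx)
  · rintro (h | rfl)
    · exact ⟨n, (hb n).2 (Or.inl rfl), h⟩
    · exact ⟨a, (hb a).2 (Or.inr rfl), (ha x).2 (Or.inl rfl)⟩

noncomputable instance : Zero (N M) :=
  ⟨⟨(exists_empty (M := M)).choose, mem_omegaSet.2 (zero_mem_omega exists_empty.choose_spec)⟩⟩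

noncomputable instance : Inhabited (N M) := ⟨0⟩

theorem N.zero_val : IsEmpty (0 : N M).1 := exists_empty.choose_spec

theorem N.not_lt_zero (n : N M) : ¬ n < 0 := N.zero_val _

theorem N.zero_le (n : N M) : 0 ≤ n := not_lt.1 (N.not_lt_zero n)

/-- The successor. -/
noncomputable def N.succ (n : N M) : N M :=
  ⟨(exists_succ n.1).choose, mem_omegaSet.2
    (succ_mem_omega (mem_omegaSet.1 n.2) (exists_succ n.1).choose_spec)⟩

theorem N.isSucc_succ (n : N M) : IsSucc (N.succ n).1 n.1 := (exists_succ n.1).choose_spec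

instance N.df_succ {X : Type*} [DType M X] {f : X → N M} [h : DF M (fun x => f x)] :
    DF M (no_index (fun x => N.succ (f x))) :=
  DF.comp (DF.of_iff (P := fun p : N M × N M => IsSucc p.2.1 p.1.1) inferInstance fun n _ =>
    ⟨fun h => Subtype.ext (isSucc_unique (N.isSucc_succ n) h), fun h => h ▸ N.isSucc_succ n⟩) h

theorem N.lt_succ {m n : N M} : m < N.succ n ↔ m ≤ n := N.isSucc_succ n m.1

theorem N.lt_succ_self (n : N M) : n < N.succ n := N.lt_succ.2 le_rfl

theorem N.succ_le {m n : N M} : N.succ m ≤ n ↔ m < n := by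
  rw [← not_lt, N.lt_succ, not_le]

theorem N.succ_lt_succ {m n : N M} : N.succ m < N.succ n ↔ m < n := by
  rw [N.lt_succ, N.succ_le]

theorem N.succ_inj {m n : N M} : N.succ m = N.succ n ↔ m = n := by
  refine ⟨fun h => ?_, congrArg _⟩
  have h1 := N.lt_succ_self m
  have h2 := N.lt_succ_self n
  rw [h, N.lt_succ] at h1
  rw [← h, N.lt_succ] at h2
  exact le_antisymm h1 h2

theorem N.succ_ne_zero (n : N M) : N.succ n ≠ 0 := fun h =>
  N.not_lt_zero n (h ▸ N.lt_succ_self n)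

theorem N.eq_zero_or_succ (n : N M) : n = 0 ∨ ∃ m, n = N.succ m := by
  rcases (mem_omegaSet.1 n.2).2 n.1 (Or.inr rfl) with h | ⟨k, hk⟩
  · exact Or.inl (Subtype.ext (isEmpty_unique h N.zero_val))
  · have hkn : k ∈ n.1 := (hk k).2 (Or.inr rfl)
    exact Or.inr ⟨⟨k, mem_omegaSet.2 (omega_of_mem (mem_omegaSet.1 n.2) hkn)⟩,
      Subtype.ext (isSucc_unique hk (N.isSucc_succ _))⟩

theorem N.induction (P : N M → Prop) [h : DP M P] (zero : P 0)
    (succ : ∀ n, P n → P (N.succ n)) (n : N M) : P n := by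
  refine El.induction P (fun n ih => ?_) n
  rcases N.eq_zero_or_succ n with rfl | ⟨m, rfl⟩
  · exact zero
  · exact succ m (ih m (N.lt_succ_self m))

/-- Primitive recursion. -/
theorem N.exists_rec {Y : Type*} [SType M Y] [Inhabited Y] (y : Y) (h : N M → Y → Y)
    [hh : DF M (fun p : N M × Y => h p.1 p.2)] :
    ∃ f : IFun M (N M) Y, f 0 = y ∧ ∀ n, f (N.succ n) = h n (f n) := by
  have h1 : DF M (fun p : ((N M × IFun M (N M) Y) × Y) × N M => h p.2 (p.1.1.2 p.2)) :=
    DF.comp hh (g := fun p : ((N M × IFun M (N M) Y) × Y) × N M => (p.2, p.1.1.2 p.2)) inferInstance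
  let G : N M → IFun M (N M) Y → Y := fun n f =>
    the fun z => (n = 0 ∧ z = y) ∨ ∃ m, n = N.succ m ∧ z = h m (f m)
  have h2 : DF M (fun p : N M × IFun M (N M) Y => G p.1 p.2) := by
    dsimp only [G]; infer_instance
  obtain ⟨f, hf⟩ := El.exists_rec G (by
    intro t f g hfg
    dsimp only [G]
    congr 1
    funext z
    refine propext (or_congr_right (exists_congr fun m => and_congr_right ?_))
    rintro rfl
    rw [hfg m (N.lt_succ_self m)])
  refine ⟨f, ?_, fun n => ?_⟩
  · rw [hf]
    refine the_eq (Or.inl ⟨rfl, rfl⟩) ?_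
    rintro _ (h | ⟨_, hm, -⟩)
    · exact h.2
    · exact absurd hm.symm (N.succ_ne_zero _)
  · rw [hf]
    refine the_eq (Or.inr ⟨n, rfl, rfl⟩) ?_
    rintro z (h | ⟨m, hm, hz⟩)
    · exact absurd h.1 (N.succ_ne_zero n)
    · rw [hz, N.succ_inj.1 hm]

end Omega

/-! ### Doubling, halving and a pairing function -/

section Arithmetic
variable {M : Type*} [Membership M M] [ZFModel M] {X : Type*} [DType M X]

theorem exists_dbl : ∃ f : R M, f 0 = 0 ∧ ∀ n, f (N.succ n) = N.succ (N.succ (f n)) :=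
  N.exists_rec 0 (fun _ y => N.succ (N.succ y))

/-- Multiplication by two. -/
noncomputable def dbl : R M := exists_dbl.choose

theorem dbl_zero : (dbl : R M) 0 = 0 := exists_dbl.choose_spec.1
theorem dbl_succ (n : N M) : dbl (N.succ n) = N.succ (N.succ (dbl n)) := exists_dbl.choose_spec.2 n

theorem dbl_ne_succ_dbl (m n : N M) : dbl m ≠ N.succ (dbl n) := by
  refine N.induction (fun m => ∀ n, dbl m ≠ N.succ (dbl n)) ?_ ?_ m n
  · intro n h
    rw [dbl_zero] at h
    exact N.succ_ne_zero _ h.symm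
  · intro m ih n h
    rw [dbl_succ, N.succ_inj] at h
    rcases N.eq_zero_or_succ n with rfl | ⟨n, rfl⟩
    · rw [dbl_zero] at h; exact N.succ_ne_zero _ h
    · rw [dbl_succ, N.succ_inj] at h
      exact ih n h

theorem dbl_lt_dbl {m n : N M} (h : m < n) : dbl m < dbl n := by
  refine N.induction (fun n => m < n → dbl m < dbl n) ?_ ?_ n h
  · intro h; exact absurd h (N.not_lt_zero _)
  · intro n ih h
    rw [dbl_succ]
    rcases (N.lt_succ.1 h).lt_or_eq with h | rfl
    · exact (ih h).trans ((N.lt_succ_self _).trans (N.lt_succ_self _))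
    · exact (N.lt_succ_self _).trans (N.lt_succ_self _)

theorem dbl_inj {m n : N M} (h : dbl m = dbl n) : m = n := by
  rcases lt_trichotomy m n with h' | h' | h'
  · exact absurd h (dbl_lt_dbl h').ne
  · exact h'
  · exact absurd h (dbl_lt_dbl h').ne'

theorem exists_half (n : N M) : ∃ m, n = dbl m ∨ n = N.succ (dbl m) := by
  refine N.induction (fun n => ∃ m, n = dbl m ∨ n = N.succ (dbl m)) ⟨0, Or.inl dbl_zero.symm⟩ ?_ n
  rintro n ⟨m, rfl | rfl⟩
  · exact ⟨m, Or.inr rfl⟩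
  · exact ⟨N.succ m, Or.inl (dbl_succ m).symm⟩

/-- The integral part of the half of a natural number. -/
noncomputable def half (n : N M) : N M := the fun m => n = dbl m ∨ n = N.succ (dbl m)

theorem half_dbl (n : N M) : half (dbl n) = n := by
  refine the_eq (Or.inl rfl) ?_
  rintro z (h | h)
  · exact (dbl_inj h).symm
  · exact absurd h (dbl_ne_succ_dbl _ _)

theorem half_succ_dbl (n : N M) : half (N.succ (dbl n)) = n := by
  refine the_eq (Or.inr rfl) ?_
  rintro z (h | h)
  · exact absurd h.symm (dbl_ne_succ_dbl _ _)
  · exact (dbl_inj (N.succ_inj.1 h)).symm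

instance half.df {f : X → N M} [h : DF M (fun x => f x)] :
    DF M (no_index (fun x => half (f x))) :=
  DF.comp (f := half) (by unfold half; infer_instance) h

/-- Row `0` lists the odd numbers and every further row doubles the one before, so the pairing is
`2^i * (2 * j + 1)`. -/
theorem exists_pi : ∃ f : IFun M (N M) (R M), f 0 = IFun.of M (fun j => N.succ (dbl j)) ∧
    ∀ n, f (N.succ n) = IFun.of M (fun j => dbl (f n j)) :=
  N.exists_rec _ (fun _ y => IFun.of M (fun j => dbl (y j)))

/-- An injective pairing function with nonzero values. -/
noncomputable def pi (i j : N M) : N M := exists_pi.choose i j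

theorem pi_zero (j : N M) : pi 0 j = N.succ (dbl j) := by
  rw [pi, exists_pi.choose_spec.1, IFun.of_apply]

theorem pi_succ (i j : N M) : pi (N.succ i) j = dbl (pi i j) := by
  rw [pi, exists_pi.choose_spec.2, IFun.of_apply]; rfl

instance pi.df {f g : X → N M} [h : DF M (fun x => f x)] [h' : DF M (fun x => g x)] :
    DF M (no_index (fun x => pi (f x) (g x))) := by
  unfold pi; infer_instance

theorem pi_ne_zero (i j : N M) : pi i j ≠ 0 := by
  refine N.induction (fun i => pi i j ≠ 0) ?_ ?_ i
  · rw [pi_zero]; exact N.succ_ne_zero _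
  · intro i ih h
    rw [pi_succ, ← dbl_zero] at h
    exact ih (dbl_inj h)

theorem pi_inj {i j i' j' : N M} (h : pi i j = pi i' j') : i = i' ∧ j = j' := by
  refine N.induction (fun i => ∀ i', pi i j = pi i' j' → i = i' ∧ j = j') ?_ ?_ i i' h
  · intro i' h
    rcases N.eq_zero_or_succ i' with rfl | ⟨i', rfl⟩
    · rw [pi_zero, pi_zero, N.succ_inj] at h
      exact ⟨rfl, dbl_inj h⟩
    · rw [pi_zero, pi_succ] at h
      exact absurd h.symm (dbl_ne_succ_dbl _ _)
  · intro i ih i' h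
    rcases N.eq_zero_or_succ i' with rfl | ⟨i', rfl⟩
    · rw [pi_zero, pi_succ] at h
      exact absurd h (dbl_ne_succ_dbl _ _)
    · rw [pi_succ, pi_succ] at h
      obtain ⟨rfl, rfl⟩ := ih _ (dbl_inj h)
      exact ⟨rfl, rfl⟩

theorem N.exists_bound (f : R M) (n : N M) : ∃ b, ∀ i, i < n → f i < b := by
  refine N.induction (fun n => ∃ b, ∀ i, i < n → f i < b)
    ⟨0, fun i h => absurd h (N.not_lt_zero _)⟩ ?_ n
  rintro n ⟨b, hb⟩
  refine ⟨max b (N.succ (f n)), fun i h => ?_⟩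
  rcases (N.lt_succ.1 h).lt_or_eq with h | rfl
  · exact lt_max_of_lt_left (hb i h)
  · exact lt_max_of_lt_right (N.lt_succ_self _)

end Arithmetic

/-! ### Initial segments, sections and interleaving of reals -/

section Reals
variable {M : Type*} [Membership M M] [ZFModel M] {X : Type*} [DType M X]

/-- The reals `x` and `y` agree below `k`. -/
def agree (k : N M) (x y : R M) : Prop := ∀ j, j < k → x j = y j

theorem agree.refl (k : N M) (x : R M) : agree k x x := fun _ _ => rfl
theorem agree.symm {k : N M} {x y : R M} (h : agree k x y) : agree k y x := fun j hj => (h j hj).symm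
theorem agree.mono {k l : N M} (hl : l ≤ k) {x y : R M} (h : agree k x y) : agree l x y :=
  fun j hj => h j (hj.trans_le hl)

instance agree.dp {k : X → N M} {f g : X → R M} [h : DF M (fun x => k x)]
    [h' : DF M (fun x => f x)] [h'' : DF M (fun x => g x)] :
    DP M (no_index (fun x => agree (k x) (f x) (g x))) :=
  DP.comp (P := fun p : N M × R M × R M => agree p.1 p.2.1 p.2.2) (f := fun x => (k x, f x, g x))
    (by unfold agree; infer_instance) inferInstance

/-- The sequence of codes of the initial segments of `x`. -/
noncomputable def bar (x : R M) : R M := the fun f => f 0 = 0 ∧ ∀ k, f (N.succ k) = pi (f k) (x k)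

instance bar.df {f : X → R M} [h : DF M (fun x => f x)] :
    DF M (no_index (fun x => bar (f x))) :=
  DF.comp (f := bar) (by unfold bar; infer_instance) h

theorem bar_spec (x : R M) : bar x 0 = 0 ∧ ∀ k, bar x (N.succ k) = pi (bar x k) (x k) := by
  refine the_spec (P := fun f : R M => f 0 = 0 ∧ ∀ k, f (N.succ k) = pi (f k) (x k)) ?_
  obtain ⟨f, hf⟩ := N.exists_rec (0 : N M) (fun k y => pi y (x k))
  refine ⟨f, hf, fun g hg => IFun.ext (N.induction (fun n => g n = f n) ?_ ?_)⟩
  · rw [hf.1, hg.1]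
  · intro n ih
    rw [hf.2, hg.2, ih]

/-- Because `pi` is injective and never `0`, a code `0` can only stand for the empty sequence, and
any other code can be peeled off one entry at a time. So codes determine length and entries. -/
theorem bar_eq_iff {x y : R M} {k l : N M} : bar x k = bar y l ↔ k = l ∧ agree k x y := by
  constructor
  · intro h
    refine N.induction (fun k => ∀ l, bar x k = bar y l → k = l ∧ agree k x y) ?_ ?_ k l h
    · intro l h
      rcases N.eq_zero_or_succ l with rfl | ⟨l, rfl⟩
      · exact ⟨rfl, fun j hj => absurd hj (N.not_lt_zero _)⟩
      · rw [(bar_spec _).1, (bar_spec _).2] at h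
        exact absurd h.symm (pi_ne_zero _ _)
    · intro k ih l h
      rcases N.eq_zero_or_succ l with rfl | ⟨l, rfl⟩
      · rw [(bar_spec _).1, (bar_spec _).2] at h
        exact absurd h (pi_ne_zero _ _)
      · rw [(bar_spec _).2, (bar_spec _).2] at h
        obtain ⟨h1, h2⟩ := pi_inj h
        obtain ⟨rfl, h3⟩ := ih l h1
        refine ⟨rfl, fun j hj => ?_⟩
        rcases (N.lt_succ.1 hj).lt_or_eq with hj | rfl
        · exact h3 j hj
        · exact h2
  · rintro ⟨rfl, h⟩
    refine N.induction (fun k => agree k x y → bar x k = bar y k) ?_ ?_ k h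
    · intro _
      rw [(bar_spec _).1, (bar_spec _).1]
    · intro k ih h
      rw [(bar_spec _).2, (bar_spec _).2, ih (h.mono (N.lt_succ_self k).le), h k (N.lt_succ_self k)]

/-- The `i`-th section of a real. -/
noncomputable def sec (x : R M) (i : N M) : R M := IFun.of M fun j => x (pi i j)

@[simp] theorem sec_apply (x : R M) (i j : N M) : sec x i j = x (pi i j) := IFun.of_apply _ _

instance sec.df {f : X → R M} {g : X → N M} [h : DF M (fun x => f x)] [h' : DF M (fun x => g x)] :
    DF M (no_index (fun x => sec (f x) (g x))) :=
  DF.comp (f := fun p : R M × N M => sec p.1 p.2) (g := fun x => (f x, g x))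
    (by unfold sec; infer_instance) inferInstance

theorem exists_sec_eq (f : IFun M (N M) (R M)) : ∃ w : R M, ∀ i, sec w i = f i := by
  refine ⟨IFun.of M fun n => the fun v => ∃ i j, n = pi i j ∧ v = f i j, fun i => IFun.ext fun j => ?_⟩
  rw [sec_apply, IFun.of_apply]
  refine the_eq ⟨i, j, rfl, rfl⟩ ?_
  rintro _ ⟨i', j', h, rfl⟩
  obtain ⟨rfl, rfl⟩ := pi_inj h
  rfl

/-- The values of a real at even places. -/
noncomputable def evens (x : R M) : R M := IFun.of M fun j => x (dbl j)
/-- The values of a real at odd places. -/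
noncomputable def odds (x : R M) : R M := IFun.of M fun j => x (N.succ (dbl j))

@[simp] theorem evens_apply (x : R M) (j : N M) : evens x j = x (dbl j) := IFun.of_apply _ _
@[simp] theorem odds_apply (x : R M) (j : N M) : odds x j = x (N.succ (dbl j)) := IFun.of_apply _ _

instance evens.df {f : X → R M} [h : DF M (fun x => f x)] :
    DF M (no_index (fun x => evens (f x))) :=
  DF.comp (f := evens) (by unfold evens; infer_instance) h

instance odds.df {f : X → R M} [h : DF M (fun x => f x)] :
    DF M (no_index (fun x => odds (f x))) :=
  DF.comp (f := odds) (by unfold odds; infer_instance) h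

/-- The real with given values at even and at odd places. -/
noncomputable def join (x y : R M) : R M :=
  IFun.of M fun n => open Classical in if n = dbl (half n) then x (half n) else y (half n)

theorem evens_join (x y : R M) : evens (join x y) = x := IFun.ext fun n => by
  rw [evens_apply, join, IFun.of_apply, half_dbl, if_pos rfl]

theorem odds_join (x y : R M) : odds (join x y) = y := IFun.ext fun n => by
  rw [odds_apply, join, IFun.of_apply, half_succ_dbl, if_neg (dbl_ne_succ_dbl _ _).symm]

end Reals

/-! ### Consequences of determinacy: strategies as continuous functions, countable choice -/

section Games
variable {M : Type*} [Membership M M] [ZFModel M]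

theorem range_El (a : M) : {m | ∃ y : El a, code y = m} = ext a :=
  Set.ext fun _ => ⟨fun ⟨y, h⟩ => h ▸ y.2, fun h => ⟨⟨_, h⟩, rfl⟩⟩

theorem range_N : {m | ∃ y : N M, code y = m} = omega M :=
  (range_El _).trans (Set.ext fun _ => mem_omegaSet)

theorem mem_Baire {x : M} : x ∈ Baire M ↔ ∃ y : R M, code y = x := by
  constructor
  · intro h
    exact IFun.exists_code_eq (by rw [range_N]; exact h)
  · rintro ⟨y, rfl⟩
    have := y.isFun_code
    rw [range_N] at this
    exact this

theorem IsRestr.mem_iff {s : M} {x : R M} {n : N M} (h : IsRestr s (code x) n.1) (p : M) :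
    p ∈ s ↔ ∃ k : N M, k < n ∧ p = pr (code k) (code (x k)) := by
  constructor
  · intro hp
    obtain ⟨k, hk, v, hv, hp'⟩ := h.1.1 p hp
    have := h.2 k v ⟨p, hp', hp⟩
    obtain ⟨k', rfl, rfl⟩ := (IFun.maps_code _ _ _).1 this
    exact ⟨k', hk, isPair_iff.1 hp'⟩
  · rintro ⟨k, hk, rfl⟩
    obtain ⟨v, hv, -⟩ := h.1.2 (code k) hk
    obtain ⟨k', h1, rfl⟩ := (IFun.maps_code _ _ _).1 (h.2 _ _ hv)
    cases DType.code_inj _ _ h1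
    exact maps_iff.1 hv

theorem IsRestr.of_agree {s : M} {x y : R M} {n : N M} (h : IsRestr s (code x) n.1)
    (e : agree n x y) : IsRestr s (code y) n.1 := by
  refine ⟨h.1, fun k v hk => ?_⟩
  obtain ⟨k', hk', hp⟩ := (h.mem_iff _).1 (maps_iff.1 hk)
  obtain ⟨rfl, rfl⟩ := pr_inj hp
  rw [e k' hk', IFun.maps_code_code]

instance DP.isRestr {X : Type*} [DType M X] {f g k : X → M} [h : DF M (fun x => f x)]
    [h' : DF M (fun x => g x)] [h'' : DF M (fun x => k x)] :
    DP M (no_index (fun x => IsRestr (f x) (g x) (k x))) :=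
  DP.comp (P := fun p : M × M × M => IsRestr p.1 p.2.1 p.2.2) (f := fun x => (f x, g x, k x))
    (by unfold IsRestr IsFun; infer_instance) inferInstance

/-- Finite sequences are traded for pairs of a real and a length: the move depends only on the
restriction, which such a pair determines. -/
theorem exists_strategy {σ : M} (hσ : IsFun σ (FinSeq M) (omega M)) :
    ∃ S : IFun M (R M × N M) (N M), (∀ x y n, agree n x y → S (x, n) = S (y, n)) ∧
      ∀ (x : R M) (n : N M) (s v : M), IsRestr s (code x) n.1 → Maps σ s v → v = code (S (x, n)) := by
  let S : IFun M (R M × N M) (N M) := IFun.of M fun p =>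
    the fun v => ∃ s, IsRestr s (code p.1) p.2.1 ∧ Maps σ s (code v)
  have hS (p) : S p = the fun v => ∃ s, IsRestr s (code p.1) p.2.1 ∧ Maps σ s (code v) :=
    IFun.of_apply _ _
  refine ⟨S, fun x y n h => ?_, fun x n s v hs hv => ?_⟩
  · rw [hS, hS]
    congr 1
    funext v
    exact propext (exists_congr fun s => and_congr_left fun _ =>
      ⟨fun h' => h'.of_agree h, fun h' => h'.of_agree h.symm⟩)
  · have hsF : s ∈ FinSeq M := ⟨n.1, mem_omegaSet.1 n.2, hs.1⟩
    obtain ⟨w, hw, hu⟩ := hσ.2 s hsF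
    obtain ⟨_, _, z, hz, hp⟩ := hσ.1 _ (maps_iff.1 hv)
    obtain ⟨-, rfl⟩ := pr_inj (isPair_iff.1 hp)
    have : S (x, n) = ⟨v, mem_omegaSet.2 hz⟩ := by
      rw [hS]
      refine the_eq ⟨s, hs, hv⟩ ?_
      rintro z' ⟨s', hs', hz'⟩
      have : s' = s := ext_iff'.2 fun p => (hs'.mem_iff p).trans (hs.mem_iff p).symm
      subst this
      exact Subtype.ext ((hu _ hz').trans (hu _ hv).symm)
    rw [this]; rfl

theorem isEven_iff {n : M} : IsEven n ↔ ∃ m : N M, n = code (dbl m) := by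
  constructor
  · rintro ⟨hn, E, h0, hE, hnE⟩
    have key (m : N M) : (dbl m).1 ∈ E ∧ ¬ (N.succ (dbl m)).1 ∈ E := by
      have h1 (k : N M) (hk : k.1 ∈ E) : ¬ (N.succ k).1 ∈ E := fun h =>
        (hE k.1 (mem_omegaSet.1 k.2) _ (N.isSucc_succ k)).1 h hk
      have h2 (k : N M) (hk : ¬ k.1 ∈ E) : (N.succ k).1 ∈ E :=
        (hE k.1 (mem_omegaSet.1 k.2) _ (N.isSucc_succ k)).2 hk
      refine N.induction (fun m => (dbl m).1 ∈ E ∧ ¬ (N.succ (dbl m)).1 ∈ E) ?_ ?_ m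
      · rw [dbl_zero]
        exact ⟨h0 _ N.zero_val, h1 _ (h0 _ N.zero_val)⟩
      · intro m ih
        rw [dbl_succ]
        exact ⟨h2 _ ih.2, h1 _ (h2 _ ih.2)⟩
    obtain ⟨m, hm | hm⟩ := exists_half (⟨n, mem_omegaSet.2 hn⟩ : N M)
    · exact ⟨m, congrArg Subtype.val hm⟩
    · exact absurd hnE (by rw [show n = (N.succ (dbl m)).1 from congrArg Subtype.val hm]; exact (key m).2)
  · rintro ⟨m, rfl⟩
    have hE (k : N M) : k.1 ∈ (code (ISet.of M fun n : N M => ∃ m, n = dbl m) : M) ↔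
        ∃ m, k = dbl m := by
      rw [← El.code_eq, ISet.code_mem_code, ISet.of_apply]
    refine ⟨mem_omegaSet.1 (dbl m).2, code (ISet.of M fun n : N M => ∃ m, n = dbl m), ?_, ?_,
      (hE _).2 ⟨m, rfl⟩⟩
    · intro z hz
      rw [isEmpty_unique hz (N.zero_val (M := M)), hE]
      exact ⟨0, dbl_zero.symm⟩
    · intro k hk s hs
      obtain ⟨k, rfl⟩ : ∃ k' : N M, k = k'.1 := ⟨⟨k, mem_omegaSet.2 hk⟩, rfl⟩
      rw [isSucc_unique hs (N.isSucc_succ k), hE, hE]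
      constructor
      · rintro ⟨m, hm⟩ ⟨m', rfl⟩
        exact dbl_ne_succ_dbl _ _ hm.symm
      · intro h
        obtain ⟨m, rfl | rfl⟩ := exists_half k
        · exact absurd ⟨m, rfl⟩ h
        · exact ⟨N.succ m, (dbl_succ m).symm⟩

/-- Determinacy, with strategies as functions of a real and a length. -/
theorem AD.exists_strategy (hAD : AD M) (A : ISet M (R M)) :
    (∃ S : IFun M (R M × N M) (N M), (∀ x y n, agree n x y → S (x, n) = S (y, n)) ∧
      ∀ x, (∀ m, x (dbl m) = S (x, dbl m)) → A x) ∨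
    (∃ S : IFun M (R M × N M) (N M), (∀ x y n, agree n x y → S (x, n) = S (y, n)) ∧
      ∀ x, (∀ m, x (N.succ (dbl m)) = S (x, N.succ (dbl m))) → ¬ A x) := by
  have hsub : ext (code A : M) ⊆ Baire M := by
    intro m hm
    obtain ⟨x, rfl, -⟩ := (ISet.mem_code _ _).1 hm
    exact mem_Baire.2 ⟨x, rfl⟩
  rcases hAD (code A) hsub with ⟨σ, hσ, hw⟩ | ⟨σ, hσ, hw⟩
  · obtain ⟨S, hS, hS'⟩ := SetModel.exists_strategy hσ
    refine Or.inl ⟨S, hS, fun x hx => ?_⟩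
    rw [← ISet.code_mem_code]
    refine hw _ (mem_Baire.2 ⟨x, rfl⟩) ?_
    intro n s v hn hs hv
    obtain ⟨m, rfl⟩ := isEven_iff.1 hn
    rw [hS' x (dbl m) s v hs hv, IFun.maps_code_code, hx]
  · obtain ⟨S, hS, hS'⟩ := SetModel.exists_strategy hσ
    refine Or.inr ⟨S, hS, fun x hx => ?_⟩
    rw [← ISet.code_mem_code]
    refine hw _ (mem_Baire.2 ⟨x, rfl⟩) ?_
    intro n s v hn hn' hs hv
    obtain ⟨n, rfl⟩ : ∃ k' : N M, n = k'.1 := ⟨⟨n, mem_omegaSet.2 hn⟩, rfl⟩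
    obtain ⟨m, rfl | rfl⟩ := exists_half n
    · exact absurd (isEven_iff.2 ⟨m, rfl⟩) hn'
    · rw [hS' x _ s v hs hv]
      exact (IFun.maps_code_code _ _ _).2 (hx m)

/-- The run in which `S` plays at the positions in `Q` and `u` gives the other moves. -/
theorem exists_run (S : IFun M (R M × N M) (N M)) (hS : ∀ x y n, agree n x y → S (x, n) = S (y, n))
    (Q : N M → Prop) [hQ : DP M Q] :
    ∃ F : IFun M (R M) (R M), (∀ u n, (Q n → F u n = S (F u, n)) ∧ (¬ Q n → F u n = u n)) ∧
      ∀ u u' k, (∀ j, j < k → ¬ Q j → u j = u' j) → agree k (F u) (F u') := by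
  classical
  have hQ' : DP M (fun p : (R M × R M) × N M => Q p.2) := DP.comp hQ inferInstance
  let F : IFun M (R M) (R M) := IFun.of M fun u => the fun z => ∀ n,
    z n = if Q n then S (z, n) else u n
  have hF (u) : ∀ n, F u n = if Q n then S (F u, n) else u n := by
    rw [show F u = _ from IFun.of_apply _ _]
    refine the_spec (P := fun z : R M => ∀ n, z n = if Q n then S (z, n) else u n) ?_
    have hQ' : DP M (fun p : N M × R M => Q p.1) := DP.comp hQ inferInstance
    have loc : ∀ (t : N M) (f g : R M), (∀ s, s < t → f s = g s) →
        (if Q t then S (f, t) else u t) = (if Q t then S (g, t) else u t) := by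
      intro t f g h
      rw [hS f g t h]
    obtain ⟨f, hf⟩ := El.exists_rec (fun (n : N M) (z : R M) => if Q n then S (z, n) else u n) loc
    exact ⟨f, hf, fun g hg => El.rec_unique _ loc hg hf⟩
  refine ⟨F, fun u n => ⟨fun h => by rw [hF, if_pos h], fun h => by rw [hF, if_neg h]⟩, ?_⟩
  intro u u' k hk
  unfold agree
  refine El.induction (fun j => j < k → F u j = F u' j) fun j ih hj => ?_
  rw [hF, hF]
  by_cases h : Q j
  · rw [if_pos h, if_pos h]
    exact hS _ _ _ fun i hi => ih i hi (hi.trans hj)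
  · rw [if_neg h, if_neg h]
    exact hk j hj h

/-- Determinacy of the game in which the players produce the reals `x` and `y`. -/
theorem AD.game (hAD : AD M) (A : ISet M (R M × R M)) :
    (∃ F : IFun M (R M) (R M), (∀ y y' n, agree n y y' → agree (N.succ n) (F y) (F y')) ∧
      ∀ y, A (F y, y)) ∨
    (∃ F : IFun M (R M) (R M), (∀ x x' n, agree n x x' → agree n (F x) (F x')) ∧
      ∀ x, ¬ A (x, F x)) := by
  rcases hAD.exists_strategy (ISet.of M fun x => A (evens x, odds x)) with ⟨S, hS, hw⟩ | ⟨S, hS, hw⟩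
  · obtain ⟨F, hF, hF'⟩ := exists_run S hS (fun n => n = dbl (half n))
    -- Spreading `y` by `half` puts `y m` at the place `2m + 1`, where the opponent moves; the
    -- entries at even places are ignored by the run. The second case uses the same device at the
    -- even places.
    let G : IFun M (R M) (R M) := IFun.of M fun y => evens (F (IFun.of M fun n => y (half n)))
    have hG (y) : G y = evens (F (IFun.of M fun n => y (half n))) := IFun.of_apply _ _
    refine Or.inl ⟨G, fun y y' n h => ?_, fun y => ?_⟩
    · intro j hj
      rw [hG, hG, evens_apply, evens_apply]
      refine hF' _ _ (N.succ (dbl n)) (fun i hi hi' => ?_) _ ?_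
      · rw [IFun.of_apply, IFun.of_apply]
        refine h _ ?_
        obtain ⟨m, rfl | rfl⟩ := exists_half i
        · rw [half_dbl] at hi'; exact absurd rfl hi'
        · rw [half_succ_dbl]
          rw [N.succ_lt_succ] at hi
          by_contra hm
          rcases (not_lt.1 hm).lt_or_eq with hm | rfl
          · exact absurd (dbl_lt_dbl hm) hi.le.not_gt
          · exact lt_irrefl _ hi
      · rw [N.lt_succ]
        rcases (N.lt_succ.1 hj).lt_or_eq with hj | rfl
        · exact (dbl_lt_dbl hj).le
        · exact le_rfl
    · have h1 := hw (F (IFun.of M fun n => y (half n))) (fun m => (hF _ _).1 (by rw [half_dbl]))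
      rw [ISet.of_apply, ← hG] at h1
      convert h1 using 2
      refine IFun.ext fun n => ?_
      rw [odds_apply, (hF _ _).2 (by rw [half_succ_dbl]; exact (dbl_ne_succ_dbl _ _).symm),
        IFun.of_apply, half_succ_dbl]
  · obtain ⟨F, hF, hF'⟩ := exists_run S hS (fun n => ¬ n = dbl (half n))
    let G : IFun M (R M) (R M) := IFun.of M fun x => odds (F (IFun.of M fun n => x (half n)))
    have hG (x) : G x = odds (F (IFun.of M fun n => x (half n))) := IFun.of_apply _ _
    refine Or.inr ⟨G, fun y y' n h => ?_, fun y => ?_⟩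
    · intro j hj
      rw [hG, hG, odds_apply, odds_apply]
      refine hF' _ _ (dbl n) (fun i hi hi' => ?_) _ ?_
      · rw [IFun.of_apply, IFun.of_apply]
        refine h _ ?_
        rw [not_not] at hi'
        by_contra hm
        rw [hi'] at hi
        rcases (not_lt.1 hm).lt_or_eq with hm | hm
        · exact absurd (dbl_lt_dbl hm) hi.le.not_gt
        · rw [← hm] at hi; exact lt_irrefl _ hi
      · rw [← N.succ_le, ← dbl_succ]
        rcases (N.succ_le.2 hj).lt_or_eq with hj | rfl
        · exact (dbl_lt_dbl hj).le
        · exact le_rfl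
    · have h1 := hw (F (IFun.of M fun n => y (half n))) (fun m => (hF _ _).1 (by
        rw [half_succ_dbl]; exact (dbl_ne_succ_dbl _ _).symm))
      rw [ISet.of_apply, ← hG] at h1
      convert h1 using 3
      refine IFun.ext fun n => ?_
      rw [evens_apply, (hF _ _).2 (by rw [half_dbl, not_not]), IFun.of_apply, half_dbl]

/-- Countable choice for reals. -/
theorem AD.choice (hAD : AD M) (P : N M → R M → Prop) [hP : DP M (fun p : N M × R M => P p.1 p.2)]
    (h : ∀ n, ∃ x, P n x) : ∃ f : IFun M (N M) (R M), ∀ n, P n (f n) := by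
  have hP' : DP M (fun p : R M × R M => P (p.1 0) p.2) :=
    DP.comp hP (f := fun p : R M × R M => (p.1 0, p.2)) inferInstance
  -- The first player's opening move is the challenge `n`, and the second player must answer with a
  -- real satisfying `P n`.
  rcases hAD.game (ISet.of M fun p : R M × R M => ¬ P (p.1 0) p.2) with ⟨F, hF, hw⟩ | ⟨F, hF, hw⟩
  · obtain ⟨y, hy⟩ := h (F default 0)
    have h1 := hw y
    rw [ISet.of_apply] at h1
    refine absurd hy ?_
    -- The opening move is made before the opponent plays, so a suitable answer to it refutes a
    -- winning strategy of the first player.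
    rwa [hF default y 0 (fun j hj => absurd hj (N.not_lt_zero _)) 0 (N.lt_succ_self _)]
  · refine ⟨IFun.of M fun n => F (IFun.of M fun _ => n), fun n => ?_⟩
    have h1 := hw (IFun.of M fun _ => n)
    rw [ISet.of_apply, not_not] at h1
    simpa using h1

end Games

/-! ### Coding countable ordinals by ranks; regularity -/

section Omega1
variable {M : Type*} [Membership M M] [ZFModel M]

/-- The set `κ` is the first uncountable ordinal. -/
class Omega1 (κ : M) : Prop where
  out : IsOmega1 κ

variable {κ : M} [hκ : Omega1 κ]

instance : OrdSet κ := ⟨hκ.out.1⟩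

theorem Omega1.exists_enum (γ : El κ) :
    ∃ i : IFun M (El κ) (N M), ∀ α β, α < γ → β < γ → i α = i β → α = β := by
  obtain ⟨f, hf, hi⟩ := hκ.out.2.2 γ.1 γ.2
  have key (α : El κ) (h : α < γ) : ∃ n : N M, Maps f α.1 n.1 ∧ ∀ m : N M, Maps f α.1 m.1 → m = n := by
    obtain ⟨v, hv, hu⟩ := hf.2 α.1 h
    obtain ⟨_, _, z, hz, hp⟩ := hf.1 _ (maps_iff.1 hv)
    obtain ⟨-, rfl⟩ := pr_inj (isPair_iff.1 hp)
    exact ⟨⟨v, mem_omegaSet.2 hz⟩, hv, fun m hm => Subtype.ext (hu _ hm)⟩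
  refine ⟨IFun.of M fun α => the fun n : N M => Maps f α.1 n.1, fun α β hα hβ h => ?_⟩
  obtain ⟨n, hn, hn'⟩ := key α hα
  obtain ⟨m, hm, hm'⟩ := key β hβ
  rw [IFun.of_apply, IFun.of_apply, the_eq (P := fun n : N M => Maps f α.1 n.1) hn hn',
    the_eq (P := fun n : N M => Maps f β.1 n.1) hm hm'] at h
  subst h
  exact Subtype.ext (hi _ _ _ hn hm)

theorem Omega1.not_injective (i : IFun M (El κ) (N M)) : ∃ α β, i α = i β ∧ α ≠ β := by
  by_contra hne
  push Not at hne
  refine hκ.out.2.1 ⟨code i, ?_, ?_⟩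
  · have := i.isFun_code
    rwa [range_El, range_N] at this
  · intro x x' y h h'
    obtain ⟨a, rfl, rfl⟩ := (IFun.maps_code _ _ _).1 h
    obtain ⟨b, rfl, h2⟩ := (IFun.maps_code _ _ _).1 h'
    rw [hne a b (DType.code_inj _ _ h2.symm)]

noncomputable instance : Inhabited (El κ) := ⟨(Omega1.not_injective (κ := κ) default).choose⟩

/-- The enumeration of the ordinals below `γ` is shifted by one, which frees the number `0` for `γ`:
codes of ordinals are read off at the node `0`. -/
theorem Omega1.exists_enum_le (γ : El κ) : ∃ i : IFun M (El κ) (N M),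
    (∀ α β, α ≤ γ → β ≤ γ → i α = i β → α = β) ∧ i γ = 0 := by
  classical
  obtain ⟨i, hi⟩ := Omega1.exists_enum γ
  refine ⟨IFun.of M fun α => if α < γ then N.succ (i α) else 0, fun α β hα hβ h => ?_, ?_⟩
  · rw [IFun.of_apply, IFun.of_apply] at h
    rcases hα.lt_or_eq with h1 | rfl
    · rcases hβ.lt_or_eq with h2 | rfl
      · rw [if_pos h1, if_pos h2, N.succ_inj] at h
        exact hi _ _ h1 h2 h
      · rw [if_pos h1, if_neg (lt_irrefl _)] at h
        exact absurd h (N.succ_ne_zero _)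
    · rcases hβ.lt_or_eq with h2 | rfl
      · rw [if_pos h2, if_neg (lt_irrefl _)] at h
        exact absurd h.symm (N.succ_ne_zero _)
      · rfl
  · rw [IFun.of_apply, if_neg (lt_irrefl _)]

theorem Omega1.exists_gt (γ : El κ) : ∃ δ, γ < δ := by
  by_contra hne
  push Not at hne
  obtain ⟨i, hi, -⟩ := Omega1.exists_enum_le γ
  obtain ⟨α, β, h, h'⟩ := Omega1.not_injective i
  exact h' (hi _ _ (hne α) (hne β) h)

/-! Ranks of relations on the natural numbers. -/

/-- The relation on natural numbers coded by a real. -/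
def Edge (x : R M) (m n : N M) : Prop := x (pi m n) = 0

instance Edge.dp {X : Type*} [DType M X] {x : X → R M} {f g : X → N M} [h : DF M (fun t => x t)]
    [h' : DF M (fun t => f t)] [h'' : DF M (fun t => g t)] :
    DP M (no_index (fun t => Edge (x t) (f t) (g t))) := by
  unfold Edge; infer_instance

theorem exists_edge (E : N M → N M → Prop) [hE : DP M (fun p : N M × N M => E p.1 p.2)] :
    ∃ x : R M, ∀ m n, Edge x m n ↔ E m n := by
  classical
  have : DP M (fun q : (N M × N M) × N M => E q.1.2 q.2) :=
    DP.comp hE (f := fun q : (N M × N M) × N M => (q.1.2, q.2)) inferInstance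
  refine ⟨IFun.of M fun p => if ∃ m n, p = pi m n ∧ E m n then 0 else N.succ 0, fun m n => ?_⟩
  rw [Edge, IFun.of_apply]
  by_cases h : E m n
  · rw [if_pos ⟨m, n, rfl, h⟩]; simp [h]
  · rw [if_neg]
    · simp [h, N.succ_ne_zero]
    · rintro ⟨m', n', hp, h'⟩
      obtain ⟨rfl, rfl⟩ := pi_inj hp
      exact h h'

-- The clause for `γ` refers to ranks below `γ` only, so it is a recursion on `γ`. It does not ask
-- the whole relation to be wellfounded, and it quantifies only over numbers and ordinals below `γ`,
-- which is what later puts it in Δ.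
variable (κ) in
theorem exists_rkFun : ∃ f : IFun M (El κ) (ISet M (R M × N M)), ∀ γ x n, f γ (x, n) ↔
    (∀ m, Edge x m n → ∃ β, β < γ ∧ f β (x, m)) ∧
    ∀ β, β < γ → ∃ m, Edge x m n ∧ ∃ β', β ≤ β' ∧ β' < γ ∧ f β' (x, m) := by
  obtain ⟨f, hf⟩ := El.exists_rec (a := κ) (fun γ f => ISet.of M fun p : R M × N M =>
    (∀ m, Edge p.1 m p.2 → ∃ β, β < γ ∧ f β (p.1, m)) ∧
    ∀ β, β < γ → ∃ m, Edge p.1 m p.2 ∧ ∃ β', β ≤ β' ∧ β' < γ ∧ f β' (p.1, m)) (by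
      intro γ f g h
      congr 1
      funext p
      refine propext (and_congr (forall_congr' fun m => imp_congr_right fun _ =>
        exists_congr fun β => and_congr_right fun hβ => ?_) (forall_congr' fun β =>
        imp_congr_right fun _ => exists_congr fun m => and_congr_right fun _ => exists_congr fun β' =>
        and_congr_right fun _ => and_congr_right fun hβ => ?_)) <;> rw [h _ hβ])
  refine ⟨f, fun γ x n => ?_⟩
  conv_lhs => rw [hf]
  rw [ISet.of_apply]

/-- The node `n` has rank `γ` in the relation coded by `x`: the ordinal `γ` is the strict supremum
of the ranks of the predecessors of `n`. -/
noncomputable def Rk (x : R M) (n : N M) (γ : El κ) : Prop := (exists_rkFun κ).choose γ (x, n)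

theorem rk_iff {x : R M} {n : N M} {γ : El κ} : Rk x n γ ↔
    (∀ m, Edge x m n → ∃ β, β < γ ∧ Rk x m β) ∧
    ∀ β, β < γ → ∃ m, Edge x m n ∧ ∃ β', β ≤ β' ∧ β' < γ ∧ Rk x m β' :=
  (exists_rkFun κ).choose_spec γ x n

instance Rk.dp {X : Type*} [DType M X] {x : X → R M} {f : X → N M} {g : X → El κ}
    [h : DF M (fun t => x t)] [h' : DF M (fun t => f t)] [h'' : DF M (fun t => g t)] :
    DP M (no_index (fun t => Rk (x t) (f t) (g t))) := by
  unfold Rk; infer_instance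

/-- If `γ < γ'`, some predecessor has a rank at least `γ` by the clause for `γ'` and a rank below
`γ` by the clause for `γ`; this is a conflict at a smaller ordinal. -/
theorem Rk.unique {x : R M} {n : N M} {γ γ' : El κ} (h : Rk x n γ) (h' : Rk x n γ') : γ = γ' := by
  have key (γ : El κ) : ∀ n γ', Rk x n γ → Rk x n γ' → ¬ γ < γ' := by
    refine El.induction (fun γ => ∀ n γ', Rk x n γ → Rk x n γ' → ¬ γ < γ') ?_ γ
    intro γ ih n γ' h h' hlt
    obtain ⟨m, hm, β', h1, h2, h3⟩ := (rk_iff.1 h').2 γ hlt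
    obtain ⟨β, h4, h5⟩ := (rk_iff.1 h).1 m hm
    exact ih β h4 m β' h5 h3 (h4.trans_le h1)
  exact le_antisymm (not_lt.1 (key _ _ _ h' h)) (not_lt.1 (key _ _ _ h h'))

/-- The least rank occurring at or above `β` must be `β`: a node of larger rank would have a
predecessor whose rank is smaller and still at least `β`. -/
theorem Rk.exists_eq {x : R M} {n : N M} {γ β : El κ} (h : Rk x n γ) (hβ : β < γ) :
    ∃ m, Rk x m β := by
  obtain ⟨β', ⟨h1, m, h2⟩, h3⟩ := El.exists_min (fun β' => β ≤ β' ∧ ∃ m, Rk x m β') ⟨γ, hβ.le, n, h⟩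
  rcases h1.lt_or_eq with h4 | rfl
  · obtain ⟨k, -, β'', h5, h6, h7⟩ := (rk_iff.1 h2).2 β h4
    exact absurd ⟨h5, k, h7⟩ (h3 _ h6)
  · exact ⟨m, h2⟩

/-- Every countable ordinal is the rank of the node `0` of some real. -/
theorem exists_rk_zero (γ : El κ) : ∃ x : R M, Rk x 0 γ := by
  obtain ⟨i, hi, h0⟩ := Omega1.exists_enum_le γ
  -- The order of the ordinals up to `γ` is copied to the numbers along `i`, so that `i β` gets rank
  -- `β`.
  obtain ⟨x, hx⟩ := exists_edge (fun m n => ∃ α β, α < β ∧ β ≤ γ ∧ m = i α ∧ n = i β)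
  have key (β : El κ) : β ≤ γ → Rk x (i β) β := by
    refine El.induction (fun β => β ≤ γ → Rk x (i β) β) ?_ β
    intro β ih hβ
    refine rk_iff.2 ⟨fun m hm => ?_, fun β' hβ' => ?_⟩
    · obtain ⟨α, β', h1, h2, rfl, h4⟩ := (hx _ _).1 hm
      rw [← hi _ _ hβ h2 h4] at h1
      exact ⟨α, h1, ih α h1 (h1.le.trans hβ)⟩
    · exact ⟨i β', (hx _ _).2 ⟨β', β, hβ', hβ, rfl, rfl⟩, β', le_rfl, hβ',
        ih β' hβ' (hβ'.le.trans hβ)⟩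
  exact ⟨x, h0 ▸ key γ le_rfl⟩

/-- The first uncountable ordinal is regular. -/
theorem AD.exists_bound (hAD : AD M) (f : IFun M (N M) (El κ)) : ∃ δ, ∀ n, f n < δ := by
  -- Codes of all the `f n` are fixed at once. If the `f n` were unbounded, every ordinal below `κ`
  -- would be the rank of some node in some `g n`.
  obtain ⟨g, hg⟩ := hAD.choice (fun n x => Rk x 0 (f n)) (fun n => exists_rk_zero _)
  by_contra hne
  push Not at hne
  have h1 (δ : El κ) : ∃ k, ∃ n m, k = pi n m ∧ Rk (g n) m δ := by
    obtain ⟨δ', h⟩ := Omega1.exists_gt δ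
    obtain ⟨n, hn⟩ := hne δ'
    obtain ⟨m, hm⟩ := (hg n).exists_eq (h.trans_le hn)
    exact ⟨_, n, m, rfl, hm⟩
  -- The least number naming a node of rank `δ`. A node has only one rank, so this would inject `κ`
  -- into `ω`.
  let S : El κ → N M → Prop := fun δ k => (∃ n m, k = pi n m ∧ Rk (g n) m δ) ∧
    ∀ k', k' < k → ¬ ∃ n m, k' = pi n m ∧ Rk (g n) m δ
  have hS (δ) : ∃! k, S δ k := by
    obtain ⟨k, hk, hk'⟩ := El.exists_min (fun k => ∃ n m, k = pi n m ∧ Rk (g n) m δ) (h1 δ)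
    refine ⟨k, ⟨hk, hk'⟩, fun j hj => ?_⟩
    rcases lt_trichotomy j k with h | h | h
    · exact absurd hj.1 (hk' _ h)
    · exact h
    · exact absurd hk (hj.2 _ h)
  have : DP M (fun p : El κ × N M => S p.1 p.2) := by dsimp only [S]; infer_instance
  obtain ⟨α, β, h, h'⟩ := Omega1.not_injective (IFun.of M fun δ => the (S δ))
  rw [IFun.of_apply, IFun.of_apply] at h
  obtain ⟨⟨n, m, h2, h3⟩, -⟩ := the_spec (hS α)
  obtain ⟨⟨n', m', h4, h5⟩, -⟩ := the_spec (hS β)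
  rw [h, h4] at h2
  obtain ⟨rfl, rfl⟩ := pi_inj h2
  exact h' (h3.unique h5)

theorem AD.exists_bound_of_inj (hAD : AD M) {X : Type*} [SType M X] (i : IFun M X (N M))
    (Q : X → Prop) [hQ : DP M Q] (hi : ∀ s t, Q s → Q t → i s = i t → s = t)
    (f : IFun M X (El κ)) : ∃ δ, ∀ t, Q t → f t < δ := by
  have : DP M (fun p : (N M × El κ) × X => Q p.2) := DP.comp hQ inferInstance
  -- The family is reindexed by numbers along `i`; numbers outside the image receive a harmless
  -- default value.
  obtain ⟨δ, h⟩ := hAD.exists_bound (IFun.of M fun n => the fun δ : El κ => ∃ t, Q t ∧ i t = n ∧ δ = f t)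
  refine ⟨δ, fun t ht => ?_⟩
  have := h (i t)
  rw [IFun.of_apply, the_eq (y := f t) ⟨t, ht, rfl, rfl⟩] at this
  · exact this
  · rintro _ ⟨s, hs, e, rfl⟩
    rw [hi s t hs ht e]

/-- A node whose predecessors are ranked is ranked. -/
theorem AD.exists_rk (hAD : AD M) {x : R M} {n : N M}
    (h : ∀ m, Edge x m n → ∃ γ : El κ, Rk x m γ) : ∃ γ : El κ, Rk x n γ := by
  obtain ⟨δ, hδ⟩ := hAD.exists_bound (κ := κ) (IFun.of M fun m => the fun γ => Rk x m γ)
  have h1 : ∀ m, Edge x m n → ∃ β, β < δ ∧ Rk x m β := by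
    intro m hm
    obtain ⟨γ, hγ⟩ := h m hm
    have := hδ m
    rw [IFun.of_apply, the_eq hγ fun z hz => hz.unique hγ] at this
    exact ⟨γ, this, hγ⟩
  -- The least strict upper bound of the ranks of the predecessors is the rank of `n`.
  obtain ⟨γ, hγ, hγ'⟩ := El.exists_min (fun δ : El κ => ∀ m, Edge x m n → ∃ β, β < δ ∧ Rk x m β) ⟨δ, h1⟩
  refine ⟨γ, rk_iff.2 ⟨hγ, fun β hβ => ?_⟩⟩
  have := hγ' β hβ
  push Not at this
  obtain ⟨m, hm, h2⟩ := this
  obtain ⟨β', h3, h4⟩ := hγ m hm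
  refine ⟨m, hm, β', ?_, h3, h4⟩
  by_contra h5
  exact h2 β' (not_le.1 h5) h4

end Omega1

/-! ### Projections of closed sets and their closure properties -/

section Suslin
variable {M : Type*} [Membership M M] [ZFModel M]

/-! The topology of a space `X` is the initial topology of an internal function `e` from `X` to the
reals. -/

/-- The pair of `u` and `w` belongs to the closed set with code `c`. -/
def InClosed (c u w : R M) : Prop := ∀ k, c (pi (bar u k) (bar w k)) = 0

instance InClosed.dp {X : Type*} [DType M X] {c u w : X → R M} [h : DF M (fun t => c t)]
    [h' : DF M (fun t => u t)] [h'' : DF M (fun t => w t)] :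
    DP M (no_index (fun t => InClosed (c t) (u t) (w t))) :=
  DP.comp (P := fun p : R M × R M × R M => InClosed p.1 p.2.1 p.2.2) (f := fun t => (c t, u t, w t))
    (by unfold InClosed; infer_instance) inferInstance

variable {X Y : Type*} [SType M X] [SType M Y] (e : IFun M X (R M)) (e' : IFun M Y (R M))

/-- The set `A` is the projection of a closed set. -/
def Suslin (A : X → Prop) : Prop := ∃ c, ∀ x, A x ↔ ∃ w, InClosed c (e x) w

/-- The set `D` is closed in the product of `X` and the space of reals. -/
def IsClosedRel (D : X → R M → Prop) : Prop := ∀ x w, ¬ D x w →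
  ∃ k, ∀ x' w', agree k (e x) (e x') → agree k w w' → ¬ D x' w'

/-- The function `F` of two arguments is continuous. -/
def Continuous₂ (F : X → R M → R M) : Prop := ∀ x w k,
  ∃ l, ∀ x' w', agree l (e x) (e x') → agree l w w' → agree k (F x w) (F x' w')

variable {e e'}

theorem Suslin.congr {A B : X → Prop} (h : Suslin e A) (hAB : ∀ x, A x ↔ B x) : Suslin e B := by
  rwa [← show A = B from funext fun x => propext (hAB x)]

theorem Suslin.dp {A : X → Prop} (h : Suslin e A) : DP M A := by
  obtain ⟨c, hc⟩ := h
  exact DP.congr (P := fun x => ∃ w, InClosed c (e x) w) inferInstance fun x => (hc x).symm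

theorem isClosedRel_inClosed (c : R M) : IsClosedRel e (fun x w => InClosed c (e x) w) := by
  intro x w h
  unfold InClosed at h
  push Not at h
  obtain ⟨k, hk⟩ := h
  refine ⟨k, fun x' w' h1 h2 h3 => hk ?_⟩
  rw [bar_eq_iff.2 ⟨rfl, h1⟩, bar_eq_iff.2 ⟨rfl, h2⟩]
  exact h3 k

/-- The code accepts exactly the pairs of initial segments of points of `D`. A point outside the
closed set `D` has such a pair that no point of `D` extends. -/
theorem IsClosedRel.exists_inClosed (D : X → R M → Prop) [hD : DP M (fun p : X × R M => D p.1 p.2)]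
    (h : IsClosedRel e D) : ∃ c, ∀ x w, D x w ↔ InClosed c (e x) w := by
  classical
  have : DP M (fun p : ((N M × N M) × X) × R M => D p.1.2 p.2) :=
    DP.comp hD (f := fun p : ((N M × N M) × X) × R M => (p.1.2, p.2)) inferInstance
  have h1 : DP M (fun n : N M => ∃ k x w, n = pi (bar (e x) k) (bar w k) ∧ D x w) := by
    infer_instance
  refine ⟨IFun.of M fun n => if ∃ k x w, n = pi (bar (e x) k) (bar w k) ∧ D x w then 0 else N.succ 0,
    fun x w => ⟨fun hx k => ?_, fun hx => ?_⟩⟩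
  · rw [IFun.of_apply, if_pos ⟨k, x, w, rfl, hx⟩]
  · by_contra hn
    obtain ⟨k, hk⟩ := h x w hn
    have := hx k
    rw [IFun.of_apply] at this
    by_cases h2 : ∃ k' x' w', pi (bar (e x) k) (bar w k) = pi (bar (e x') k') (bar w' k') ∧ D x' w'
    · obtain ⟨k', x', w', h3, h4⟩ := h2
      obtain ⟨h5, h6⟩ := pi_inj h3
      obtain ⟨rfl, h7⟩ := bar_eq_iff.1 h5
      exact hk x' w' h7 (bar_eq_iff.1 h6).2 h4
    · rw [if_neg h2] at this
      exact N.succ_ne_zero _ this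

theorem IsClosedRel.suslin {D : X → R M → Prop} [hD : DP M (fun p : X × R M => D p.1 p.2)]
    (h : IsClosedRel e D) {A : X → Prop} (hA : ∀ x, A x ↔ ∃ w, D x w) : Suslin e A := by
  obtain ⟨c, hc⟩ := h.exists_inClosed D
  exact ⟨c, fun x => (hA x).trans (exists_congr fun w => hc x w)⟩

theorem IsClosedRel.comp {D : Y → R M → Prop} (h : IsClosedRel e' D) {F : X → R M → Y}
    {W : X → R M → R M} (hF : Continuous₂ e (fun x w => e' (F x w))) (hW : Continuous₂ e W) :
    IsClosedRel e (fun x w => D (F x w) (W x w)) := by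
  intro x w hn
  obtain ⟨k, hk⟩ := h _ _ hn
  obtain ⟨l, hl⟩ := hF x w k
  obtain ⟨l', hl'⟩ := hW x w k
  refine ⟨max l l', fun x' w' h1 h2 => hk _ _ ?_ ?_⟩
  · exact hl _ _ (h1.mono (le_max_left _ _)) (h2.mono (le_max_left _ _))
  · exact hl' _ _ (h1.mono (le_max_right _ _)) (h2.mono (le_max_right _ _))

theorem exists_modulus (h : R M) (k : N M) : ∃ l, ∀ w w' : R M, agree l w w' →
    ∀ j, j < k → w (h j) = w' (h j) := by
  obtain ⟨l, hl⟩ := N.exists_bound h k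
  exact ⟨l, fun w w' hw j hj => hw _ (hl j hj)⟩

theorem exists_modulus_sec (i k : N M) : ∃ l, ∀ w w' : R M, agree l w w' →
    agree k (sec w i) (sec w' i) := by
  obtain ⟨l, hl⟩ := exists_modulus (IFun.of M fun j => pi i j) k
  refine ⟨l, fun w w' h j hj => ?_⟩
  rw [sec_apply, sec_apply]
  simpa using hl w w' h j hj

theorem exists_modulus_evens (k : N M) : ∃ l, ∀ w w' : R M, agree l w w' →
    agree k (evens w) (evens w') := by
  obtain ⟨l, hl⟩ := exists_modulus dbl k
  refine ⟨l, fun w w' h j hj => ?_⟩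
  rw [evens_apply, evens_apply]
  exact hl w w' h j hj

theorem exists_modulus_odds (k : N M) : ∃ l, ∀ w w' : R M, agree l w w' →
    agree k (odds w) (odds w') := by
  obtain ⟨l, hl⟩ := exists_modulus (IFun.of M fun j => N.succ (dbl j)) k
  refine ⟨l, fun w w' h j hj => ?_⟩
  rw [odds_apply, odds_apply]
  simpa using hl w w' h j hj

theorem continuous₂_snd : Continuous₂ e (fun _ w => w) := fun _ _ k => ⟨k, fun _ _ _ h => h⟩

theorem continuous₂_evens : Continuous₂ e (fun _ w => evens w) := fun _ _ k =>
  let ⟨l, hl⟩ := exists_modulus_evens k; ⟨l, fun _ _ _ h => hl _ _ h⟩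

theorem continuous₂_odds : Continuous₂ e (fun _ w => odds w) := fun _ _ k =>
  let ⟨l, hl⟩ := exists_modulus_odds k; ⟨l, fun _ _ _ h => hl _ _ h⟩

theorem Suslin.comp {A : Y → Prop} (hA : Suslin e' A) (F : IFun M X Y)
    (hF : ∀ x k, ∃ l, ∀ x', agree l (e x) (e x') → agree k (e' (F x)) (e' (F x'))) :
    Suslin e (fun x => A (F x)) := by
  obtain ⟨c, hc⟩ := hA
  refine IsClosedRel.suslin (D := fun x w => InClosed c (e' (F x)) w)
    ((isClosedRel_inClosed (e := e') c).comp (F := fun x _ => F x) ?_ continuous₂_snd)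
    fun x => hc (F x)
  intro x w k
  obtain ⟨l, hl⟩ := hF x k
  exact ⟨l, fun x' w' h _ => hl x' h⟩

/-- Two existential reals merge into one: the even part is the quantified real, the odd part the
witness for membership. -/
theorem Suslin.exReal {A : Y → Prop} (hA : Suslin e' A) (F : IFun M (X × R M) Y)
    (hF : Continuous₂ e (fun x w => e' (F (x, w)))) :
    Suslin e (fun x => ∃ y, A (F (x, y))) := by
  obtain ⟨c, hc⟩ := hA
  refine IsClosedRel.suslin (D := fun x w => InClosed c (e' (F (x, evens w))) (odds w))
    ((isClosedRel_inClosed (e := e') c).comp (F := fun x w => F (x, evens w)) ?_ continuous₂_odds)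
    fun x => ?_
  · intro x w k
    obtain ⟨l, hl⟩ := hF x (evens w) k
    obtain ⟨l', hl'⟩ := continuous₂_evens (e := e) x w l
    exact ⟨max l l', fun x' w' h h' => hl x' (evens w') (h.mono (le_max_left _ _))
      (hl' x' w' (h.mono (le_max_right _ _)) (h'.mono (le_max_right _ _)))⟩
  · constructor
    · rintro ⟨y, hy⟩
      obtain ⟨w, hw⟩ := (hc _).1 hy
      exact ⟨join y w, by rwa [evens_join, odds_join]⟩
    · rintro ⟨w, hw⟩
      exact ⟨evens w, (hc _).2 ⟨_, hw⟩⟩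

theorem suslin_of_locallyConstant (A : X → Prop) [hA : DP M A]
    (h : ∀ x, ∃ k, ∀ x', agree k (e x) (e x') → (A x ↔ A x')) : Suslin e A := by
  have : DP M (fun p : X × R M => A p.1) := DP.comp hA inferInstance
  refine IsClosedRel.suslin (D := fun x _ => A x) ?_ fun x => ⟨fun h => ⟨default, h⟩, fun ⟨_, h⟩ => h⟩
  intro x w hx
  obtain ⟨k, hk⟩ := h x
  exact ⟨k, fun x' w' h1 _ h2 => hx ((hk x' h1).2 h2)⟩

theorem suslin_const (p : Prop) : Suslin e (fun _ => p) :=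
  suslin_of_locallyConstant _ fun _ => ⟨0, fun _ _ => Iff.rfl⟩

/-- Codes of the closed sets are picked by countable choice. The first entry of the new witness
names the index, and the rest is the witness for that index. -/
theorem AD.suslin_exNat (hAD : AD M) (A : N M → X → Prop) [hA : DP M (fun p : N M × X => A p.1 p.2)]
    (h : ∀ n, Suslin e (A n)) : Suslin e (fun x => ∃ n, A n x) := by
  have : DP M (fun p : (N M × R M) × X => A p.1.1 p.2) :=
    DP.comp hA (f := fun p : (N M × R M) × X => (p.1.1, p.2)) inferInstance
  obtain ⟨c, hc⟩ := hAD.choice (fun n c => ∀ x, A n x ↔ ∃ w, InClosed c (e x) w) h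
  refine IsClosedRel.suslin
    (D := fun x w => InClosed (c (w 0)) (e x) (IFun.of M fun n => w (N.succ n))) ?_ fun x => ?_
  · intro x w h
    obtain ⟨k, hk⟩ := isClosedRel_inClosed (e := e) (c (w 0)) _ _ h
    refine ⟨N.succ k, fun x' w' h1 h2 => ?_⟩
    show ¬ InClosed (c (w' 0)) _ _
    rw [← h2 0 (N.lt_succ.2 (N.zero_le _))]
    refine hk _ _ (h1.mono (N.lt_succ_self _).le) fun j hj => ?_
    rw [IFun.of_apply, IFun.of_apply]
    exact h2 _ (N.succ_lt_succ.2 hj)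
  · constructor
    · rintro ⟨n, hn⟩
      obtain ⟨w, hw⟩ := (hc n x).1 hn
      obtain ⟨v, hv⟩ := N.exists_rec n (fun k _ => w k)
      refine ⟨v, ?_⟩
      rw [hv.1, show (IFun.of M fun n => v (N.succ n)) = w from
        IFun.ext fun n => by rw [IFun.of_apply, hv.2]]
      exact hw
    · rintro ⟨w, hw⟩
      exact ⟨w 0, (hc _ x).2 ⟨_, hw⟩⟩

/-- Countable choice is used twice: for the codes, and then for the witnesses at a given point,
which become the sections of a single real. -/
theorem AD.suslin_allNat (hAD : AD M) (A : N M → X → Prop) [hA : DP M (fun p : N M × X => A p.1 p.2)]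
    (h : ∀ n, Suslin e (A n)) : Suslin e (fun x => ∀ n, A n x) := by
  have : DP M (fun p : (N M × R M) × X => A p.1.1 p.2) :=
    DP.comp hA (f := fun p : (N M × R M) × X => (p.1.1, p.2)) inferInstance
  obtain ⟨c, hc⟩ := hAD.choice (fun n c => ∀ x, A n x ↔ ∃ w, InClosed c (e x) w) h
  refine IsClosedRel.suslin (D := fun x w => ∀ n, InClosed (c n) (e x) (sec w n)) ?_ fun x => ?_
  · intro x w h
    push Not at h
    obtain ⟨n, hn⟩ := h
    obtain ⟨k, hk⟩ := isClosedRel_inClosed (e := e) (c n) _ _ hn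
    obtain ⟨l, hl⟩ := exists_modulus_sec n k
    exact ⟨max k l, fun x' w' h1 h2 h3 => hk x' (sec w' n) (h1.mono (le_max_left _ _))
      (hl _ _ (h2.mono (le_max_right _ _))) (h3 n)⟩
  · constructor
    · intro h
      obtain ⟨f, hf⟩ := hAD.choice (fun n w => InClosed (c n) (e x) w) (fun n => (hc n x).1 (h n))
      obtain ⟨w, hw⟩ := exists_sec_eq f
      exact ⟨w, fun n => by rw [hw]; exact hf n⟩
    · rintro ⟨w, hw⟩ n
      exact (hc _ x).2 ⟨_, hw n⟩

theorem AD.suslin_and (hAD : AD M) {A B : X → Prop} (hA : Suslin e A) (hB : Suslin e B) :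
    Suslin e (fun x => A x ∧ B x) := by
  have h1 : DP M (fun p : N M × X => A p.2) := DP.comp hA.dp inferInstance
  have h2 : DP M (fun p : N M × X => B p.2) := DP.comp hB.dp inferInstance
  refine (hAD.suslin_allNat (e := e) (fun n x => (n = 0 → A x) ∧ (n ≠ 0 → B x)) fun n => ?_).congr
    fun x => ⟨fun h => ⟨(h 0).1 rfl, (h (N.succ 0)).2 (N.succ_ne_zero _)⟩,
      fun h n => ⟨fun _ => h.1, fun _ => h.2⟩⟩
  by_cases hn : n = 0
  · exact hA.congr fun x => by simp [hn]
  · exact hB.congr fun x => by simp [hn]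

theorem AD.suslin_or (hAD : AD M) {A B : X → Prop} (hA : Suslin e A) (hB : Suslin e B) :
    Suslin e (fun x => A x ∨ B x) := by
  have h1 : DP M (fun p : N M × X => A p.2) := DP.comp hA.dp inferInstance
  have h2 : DP M (fun p : N M × X => B p.2) := DP.comp hB.dp inferInstance
  refine (hAD.suslin_exNat (e := e) (fun n x => (n = 0 ∧ A x) ∨ (n ≠ 0 ∧ B x)) fun n => ?_).congr
    fun x => ⟨?_, ?_⟩
  · by_cases hn : n = 0
    · exact hA.congr fun x => by simp [hn]
    · exact hB.congr fun x => by simp [hn]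
  · rintro ⟨n, h | h⟩
    · exact Or.inl h.2
    · exact Or.inr h.2
  · rintro (h | h)
    · exact ⟨0, Or.inl ⟨rfl, h⟩⟩
    · exact ⟨N.succ 0, Or.inr ⟨N.succ_ne_zero _, h⟩⟩

variable {T : Type*} [SType M T] {Q : T → Prop} [hQ : DP M Q]

/-- The union over a countable index set is moved to the numbers along `i`; numbers outside the
image contribute the empty set. -/
theorem AD.suslin_ex (hAD : AD M) (i : IFun M T (N M)) (hi : ∀ s t, Q s → Q t → i s = i t → s = t)
    (A : T → X → Prop) [hA : DP M (fun p : T × X => A p.1 p.2)]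
    (h : ∀ t, Q t → Suslin e (A t)) : Suslin e (fun x => ∃ t, Q t ∧ A t x) := by
  have h1 : DP M (fun p : (N M × X) × T => A p.2 p.1.2) :=
    DP.comp hA (f := fun p : (N M × X) × T => (p.2, p.1.2)) inferInstance
  have h2 : DP M (fun p : (N M × X) × T => Q p.2) := DP.comp hQ inferInstance
  refine (hAD.suslin_exNat (e := e) (fun n x => ∃ t, Q t ∧ i t = n ∧ A t x) fun n => ?_).congr fun x =>
    ⟨fun ⟨n, t, ht, _, h⟩ => ⟨t, ht, h⟩, fun ⟨t, ht, h⟩ => ⟨i t, t, ht, rfl, h⟩⟩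
  by_cases hn : ∃ t, Q t ∧ i t = n
  · obtain ⟨t, ht, rfl⟩ := hn
    refine (h t ht).congr fun x => ⟨fun h => ⟨t, ht, rfl, h⟩, ?_⟩
    rintro ⟨s, hs, e, h⟩
    rwa [← hi s t hs ht e]
  · refine (suslin_const (e := e) False).congr fun x => ⟨False.elim, ?_⟩
    rintro ⟨t, ht, e, -⟩
    exact hn ⟨t, ht, e⟩

theorem AD.suslin_all (hAD : AD M) (i : IFun M T (N M)) (hi : ∀ s t, Q s → Q t → i s = i t → s = t)
    (A : T → X → Prop) [hA : DP M (fun p : T × X => A p.1 p.2)]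
    (h : ∀ t, Q t → Suslin e (A t)) : Suslin e (fun x => ∀ t, Q t → A t x) := by
  have h1 : DP M (fun p : (N M × X) × T => A p.2 p.1.2) :=
    DP.comp hA (f := fun p : (N M × X) × T => (p.2, p.1.2)) inferInstance
  have h2 : DP M (fun p : (N M × X) × T => Q p.2) := DP.comp hQ inferInstance
  refine (hAD.suslin_allNat (e := e) (fun n x => ∀ t, Q t → i t = n → A t x) fun n => ?_).congr fun x =>
    ⟨fun h t ht => h _ t ht rfl, fun h n t ht _ => h t ht⟩
  by_cases hn : ∃ t, Q t ∧ i t = n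
  · obtain ⟨t, ht, rfl⟩ := hn
    refine (h t ht).congr fun x => ⟨fun h s hs e => ?_, fun h => h t ht rfl⟩
    rwa [hi s t hs ht e]
  · exact (suslin_const (e := e) True).congr fun x => ⟨fun _ t ht e => absurd ⟨t, ht, e⟩ hn, fun _ => trivial⟩

variable (e) in
/-- The set `A` and its complement are projections of closed sets. -/
def BiSuslin (A : X → Prop) : Prop := Suslin e A ∧ Suslin e (fun x => ¬ A x)

theorem BiSuslin.not {A : X → Prop} (h : BiSuslin e A) : BiSuslin e (fun x => ¬ A x) :=
  ⟨h.2, h.1.congr fun _ => not_not.symm⟩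

theorem BiSuslin.congr {A B : X → Prop} (h : BiSuslin e A) (hAB : ∀ x, A x ↔ B x) :
    BiSuslin e B := by
  rwa [← show A = B from funext fun x => propext (hAB x)]

theorem BiSuslin.comp {A : Y → Prop} (hA : BiSuslin e' A) (F : IFun M X Y)
    (hF : ∀ x k, ∃ l, ∀ x', agree l (e x) (e x') → agree k (e' (F x)) (e' (F x'))) :
    BiSuslin e (fun x => A (F x)) :=
  ⟨hA.1.comp F hF, hA.2.comp F hF⟩

theorem biSuslin_of_locallyConstant (A : X → Prop) [hA : DP M A]
    (h : ∀ x, ∃ k, ∀ x', agree k (e x) (e x') → (A x ↔ A x')) : BiSuslin e A :=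
  ⟨suslin_of_locallyConstant A h, suslin_of_locallyConstant _ fun x =>
    let ⟨k, hk⟩ := h x; ⟨k, fun x' hx => not_congr (hk x' hx)⟩⟩

theorem AD.biSuslin_and (hAD : AD M) {A B : X → Prop} (hA : BiSuslin e A) (hB : BiSuslin e B) :
    BiSuslin e (fun x => A x ∧ B x) :=
  ⟨hAD.suslin_and hA.1 hB.1, (hAD.suslin_or hA.2 hB.2).congr fun _ => not_and_or.symm⟩

theorem AD.biSuslin_or (hAD : AD M) {A B : X → Prop} (hA : BiSuslin e A) (hB : BiSuslin e B) :
    BiSuslin e (fun x => A x ∨ B x) :=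
  ⟨hAD.suslin_or hA.1 hB.1, (hAD.suslin_and hA.2 hB.2).congr fun _ => not_or.symm⟩

theorem AD.biSuslin_ex (hAD : AD M) (i : IFun M T (N M)) (hi : ∀ s t, Q s → Q t → i s = i t → s = t)
    (A : T → X → Prop) [hA : DP M (fun p : T × X => A p.1 p.2)]
    (h : ∀ t, Q t → BiSuslin e (A t)) : BiSuslin e (fun x => ∃ t, Q t ∧ A t x) :=
  ⟨hAD.suslin_ex i hi A fun t ht => (h t ht).1,
    (hAD.suslin_all i hi (fun t x => ¬ A t x) fun t ht => (h t ht).2).congr fun x => by simp⟩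

theorem AD.biSuslin_all (hAD : AD M) (i : IFun M T (N M)) (hi : ∀ s t, Q s → Q t → i s = i t → s = t)
    (A : T → X → Prop) [hA : DP M (fun p : T × X => A p.1 p.2)]
    (h : ∀ t, Q t → BiSuslin e (A t)) : BiSuslin e (fun x => ∀ t, Q t → A t x) :=
  ⟨hAD.suslin_all i hi A fun t ht => (h t ht).1,
    (hAD.suslin_ex i hi (fun t x => ¬ A t x) fun t ht => (h t ht).2).congr fun x => by simp⟩

theorem AD.biSuslin_exNat (hAD : AD M) (A : N M → X → Prop) [hA : DP M (fun p : N M × X => A p.1 p.2)]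
    (h : ∀ n, BiSuslin e (A n)) : BiSuslin e (fun x => ∃ n, A n x) :=
  ⟨hAD.suslin_exNat A fun t => (h t).1,
    (hAD.suslin_allNat (fun t x => ¬ A t x) fun t => (h t).2).congr fun x => by simp⟩

theorem AD.biSuslin_allNat (hAD : AD M) (A : N M → X → Prop) [hA : DP M (fun p : N M × X => A p.1 p.2)]
    (h : ∀ n, BiSuslin e (A n)) : BiSuslin e (fun x => ∀ n, A n x) :=
  ⟨hAD.suslin_allNat A fun t => (h t).1,
    (hAD.suslin_exNat (fun t x => ¬ A t x) fun t => (h t).2).congr fun x => by simp⟩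

end Suslin

/-! ### Codes of a fixed ordinal are in Δ; boundedness -/

section Boundedness
variable {M : Type*} [Membership M M] [ZFModel M] {κ : M} [hκ : Omega1 κ]

variable (M) in
/-- The identity function of the space of reals. -/
def idR : IFun M (R M) (R M) := ⟨fun x => x, inferInstance⟩

/-- Induction on `γ`: edges are clopen conditions, and the defining clause consists of quantifiers
over numbers and over the countably many ordinals below `γ`. -/
theorem AD.biSuslin_rk (hAD : AD M) (γ : El κ) (n : N M) : BiSuslin (idR M) (fun x => Rk x n γ) := by
  refine El.induction (fun γ : El κ => ∀ n, BiSuslin (idR M) (fun x => Rk x n γ))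
    (h := by unfold BiSuslin Suslin; infer_instance) (fun γ ih n => ?_) γ n
  obtain ⟨i, hi⟩ := Omega1.exists_enum γ
  have hE (m) : BiSuslin (idR M) (fun x => Edge x m n) :=
    biSuslin_of_locallyConstant _ fun x => ⟨N.succ (pi m n), fun x' h => by
      have h1 : x (pi m n) = x' (pi m n) := h _ (N.lt_succ_self _)
      unfold Edge; rw [h1]⟩
  have hi' : ∀ s t, s < γ → t < γ → i s = i t → s = t := hi
  refine BiSuslin.congr ?_ fun x => rk_iff.symm
  refine hAD.biSuslin_and (hAD.biSuslin_allNat _ fun m => ?_)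
    (hAD.biSuslin_all i hi' _ fun β hβ => hAD.biSuslin_exNat _ fun m => ?_)
  · refine (hAD.biSuslin_or (hE m).not (hAD.biSuslin_ex i hi' (fun β x => Rk x m β)
      fun β hβ => ih β hβ m)).congr fun x => imp_iff_not_or.symm
  · refine hAD.biSuslin_and (hE m) ?_
    refine (hAD.biSuslin_ex i hi' (fun β' x => β ≤ β' ∧ Rk x m β') fun β' hβ' => ?_).congr
      fun x => exists_congr fun β' => by tauto
    exact hAD.biSuslin_and (biSuslin_of_locallyConstant _ fun x => ⟨0, fun _ _ => Iff.rfl⟩) (ih β' hβ' m)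

/-- The code of the initial segments of `w` and `v` of length `k` and `k + 1`. -/
noncomputable def node (w v : R M) (k : N M) : N M := pi (bar w k) (bar v (N.succ k))

theorem node_eq_iff {w v w' v' : R M} {k l : N M} :
    node w v k = node w' v' l ↔ k = l ∧ agree k w w' ∧ agree (N.succ k) v v' := by
  constructor
  · intro h
    obtain ⟨h1, h2⟩ := pi_inj h
    exact ⟨(bar_eq_iff.1 h1).1, (bar_eq_iff.1 h1).2, (bar_eq_iff.1 h2).2⟩
  · rintro ⟨rfl, h1, h2⟩
    rw [node, node, bar_eq_iff.2 ⟨rfl, h1⟩, bar_eq_iff.2 ⟨rfl, h2⟩]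

instance node.df {X : Type*} [DType M X] {w v : X → R M} {k : X → N M} [h : DF M (fun t => w t)]
    [h' : DF M (fun t => v t)] [h'' : DF M (fun t => k t)] :
    DF M (no_index (fun t => node (w t) (v t) (k t))) := by
  unfold node; infer_instance

/-- The sequence `v` descends from `0` in the relation coded by `x` as far as `k`. -/
def Descends (x v : R M) (k : N M) : Prop := v 0 = 0 ∧ ∀ i, i < k → Edge x (v (N.succ i)) (v i)

instance Descends.dp {X : Type*} [DType M X] {w v : X → R M} {k : X → N M}
    [h : DF M (fun t => w t)] [h' : DF M (fun t => v t)] [h'' : DF M (fun t => k t)] :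
    DP M (no_index (fun t => Descends (w t) (v t) (k t))) :=
  DP.comp (P := fun p : R M × R M × N M => Descends p.1 p.2.1 p.2.2) (f := fun t => (w t, v t, k t))
    (by unfold Descends; infer_instance) inferInstance

/-- Along a descent from a ranked node every node would be ranked, with ever smaller ranks. -/
theorem Rk.not_descends {x v : R M} {γ : El κ} (h : Rk x 0 γ) : ¬ ∀ k, Descends x v k := by
  intro hv
  have key (γ : El κ) : ∀ i, ¬ Rk x (v i) γ := by
    refine El.induction (fun γ : El κ => ∀ i, ¬ Rk x (v i) γ) (fun γ ih i hi => ?_) γ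
    obtain ⟨β, hβ, h'⟩ := (rk_iff.1 hi).1 _ ((hv (N.succ i)).2 i (N.lt_succ_self i))
    exact ih β hβ _ h'
  exact key γ 0 ((hv 0).1.symm ▸ h)

/-- A branch through a tree of nodes. -/
theorem exists_branch (s : R M) (Q : ISet M ((R M × R M) × N M))
    (h : ∀ k, ∃ w v, Q ((w, v), N.succ k) ∧ s k = node w v k ∧ s (N.succ k) = node w v (N.succ k)) :
    ∃ w v : R M, ∀ k, ∃ w' v' : R M, Q ((w', v'), N.succ k) ∧ agree (N.succ k) w w' ∧
      agree (N.succ (N.succ k)) v v' := by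
  -- The code `s k` determines all the earlier ones, so the entries of the limits `W` and `V` are
  -- well defined.
  have coh (k : N M) : ∀ w v, s k = node w v k → ∀ j, j ≤ k → s j = node w v j := by
    refine N.induction (fun k => ∀ w v, s k = node w v k → ∀ j, j ≤ k → s j = node w v j) ?_ ?_ k
    · intro w v h j hj
      rwa [le_antisymm hj (N.zero_le _)]
    · intro k ih w v hwv j hj
      rcases hj.lt_or_eq with hj | rfl
      · refine ih w v ?_ j (N.lt_succ.1 hj)
        obtain ⟨w', v', -, h1, h2⟩ := h k
        rw [h1]
        obtain ⟨-, h3, h4⟩ := node_eq_iff.1 (h2.symm.trans hwv)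
        exact node_eq_iff.2 ⟨rfl, h3.mono (N.lt_succ_self _).le, h4.mono (N.lt_succ_self _).le⟩
      · exact hwv
  let W : R M := IFun.of M fun k => the fun a => ∃ w v, s (N.succ k) = node w v (N.succ k) ∧ a = w k
  let V : R M := IFun.of M fun k => the fun a => ∃ w v, s k = node w v k ∧ a = v k
  refine ⟨W, V, fun k => ?_⟩
  obtain ⟨w, v, hQ, -, h2⟩ := h k
  refine ⟨w, v, hQ, fun j hj => ?_, fun j hj => ?_⟩
  · rw [show W j = _ from IFun.of_apply _ _]
    have hj' := coh _ w v h2 (N.succ j) (N.succ_le.2 hj)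
    refine the_eq ⟨w, v, hj', rfl⟩ ?_
    rintro _ ⟨w', v', h3, rfl⟩
    exact ((node_eq_iff.1 (h3.symm.trans hj')).2.1) j (N.lt_succ_self j)
  · rw [show V j = _ from IFun.of_apply _ _]
    have hj' := coh _ w v h2 j (N.lt_succ.1 hj)
    refine the_eq ⟨w, v, hj', rfl⟩ ?_
    rintro _ ⟨w', v', h3, rfl⟩
    exact ((node_eq_iff.1 (h3.symm.trans hj')).2.2) j (N.lt_succ_self j)

/-- An unranked node has an infinite sequence of unranked nodes below it. -/
theorem AD.exists_unranked_sequence (hAD : AD M) {x : R M} {n : N M}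
    (h : ¬ ∃ γ : El κ, Rk x n γ) : ∃ s : R M, s 0 = n ∧ ∀ k, Edge x (s (N.succ k)) (s k) := by
  let U : N M → Prop := fun n => ¬ ∃ γ : El κ, Rk x n γ
  -- Always taking the least unranked predecessor avoids dependent choice.
  let C : N M → N M → Prop := fun n m =>
    (Edge x m n ∧ U m) ∧ ∀ l, l < m → ¬ (Edge x l n ∧ U l)
  have hU : DP M U := by dsimp only [U]; infer_instance
  have hC : DP M (fun p : N M × N M => C p.1 p.2) := by dsimp only [C, U]; infer_instance
  obtain ⟨s, hs0, hs⟩ := N.exists_rec (M := M) n (fun (_ : N M) (m : N M) => the (C m)) (hh := by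
    have : DP M (fun p : (N M × N M) × N M => C p.1.2 p.2) := by dsimp only [C, U]; infer_instance
    infer_instance)
  have step (m : N M) (hm : U m) : C m (the (C m)) := by
    refine the_spec ?_
    have h1 : ∃ l, Edge x l m ∧ U l := by
      by_contra hne
      push Not at hne
      exact hm (hAD.exists_rk fun l hl => not_not.1 (hne l hl))
    have hEU : DP M (fun l => Edge x l m ∧ U l) := by dsimp only [U]; infer_instance
    obtain ⟨l, hl, hl'⟩ := El.exists_min _ h1
    refine ⟨l, ⟨hl, hl'⟩, fun j hj => ?_⟩
    rcases lt_trichotomy j l with h | h | h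
    · exact absurd hj.1 (hl' _ h)
    · exact h
    · exact absurd hl (hj.2 _ h)
  have hUs (k) : U (s k) := by
    refine N.induction (fun k => U (s k)) (h := by dsimp only [U]; infer_instance) ?_ ?_ k
    · rw [hs0]; exact h
    · intro k ih
      rw [hs]
      exact (step _ ih).1.2
  exact ⟨s, hs0, fun k => by rw [hs]; exact (step _ (hUs k)).1.1⟩

/-- Boundedness: a continuous function from a closed set to the codes of ordinals is bounded. -/
theorem AD.exists_bound_of_closed (hAD : AD M) (D : ISet M (R M))
    (hD : ∀ w, ¬ D w → ∃ k, ∀ w', agree k w w' → ¬ D w') (F : IFun M (R M) (R M))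
    (hF : ∀ w k, ∃ l, ∀ w', agree l w w' → agree k (F w) (F w'))
    (h : ∀ w, D w → ∃ γ : El κ, Rk (F w) 0 γ) :
    ∃ δ : El κ, ∀ w (γ : El κ), D w → Rk (F w) 0 γ → γ < δ := by
  let Q : ISet M ((R M × R M) × N M) := ISet.of M fun p => D p.1.1 ∧ Descends (F p.1.1) p.1.2 p.2
  have hQ (w v k) : Q ((w, v), k) ↔ D w ∧ Descends (F w) v k := ISet.of_apply _ _
  -- The tree of attempts: a node records an initial segment of a point `w` of `D` and of a descent
  -- `v` in `F w`, and longer attempts are placed below shorter ones.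
  obtain ⟨e, he⟩ := exists_edge (fun m n : N M => ∃ w v k, Q ((w, v), N.succ k) ∧ n = node w v k ∧
    m = node w v (N.succ k))
  -- The default real is constantly `0`, so this node is the pair of the empty sequence and `⟨0⟩`,
  -- the common root of all attempts. If it were unranked, the tree would have an infinite branch.
  have hr : ∃ ρ : El κ, Rk e (node default default 0) ρ := by
    by_contra hne
    obtain ⟨s, hs0, hs⟩ := hAD.exists_unranked_sequence hne
    have hs' (k) : ∃ w v, Q ((w, v), N.succ k) ∧ s k = node w v k ∧
        s (N.succ k) = node w v (N.succ k) := by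
      refine N.induction (fun k => ∃ w v, Q ((w, v), N.succ k) ∧ s k = node w v k ∧
        s (N.succ k) = node w v (N.succ k)) ?_ ?_ k
      · obtain ⟨w, v, k, h1, h2, h3⟩ := (he _ _).1 (hs 0)
        rw [hs0] at h2
        obtain ⟨rfl, -, -⟩ := node_eq_iff.1 h2
        exact ⟨w, v, h1, hs0.trans h2, h3⟩
      · rintro k ⟨w', v', -, -, h4⟩
        obtain ⟨w, v, l, h1, h2, h3⟩ := (he _ _).1 (hs (N.succ k))
        obtain ⟨rfl, -, -⟩ := node_eq_iff.1 (h4.symm.trans h2)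
        exact ⟨w, v, h1, h2, h3⟩
    obtain ⟨W, V, hWV⟩ := exists_branch s Q hs'
    have hDW : D W := by
      by_contra hn
      obtain ⟨k, hk⟩ := hD W hn
      obtain ⟨w', v', h1, h2, -⟩ := hWV k
      exact hk w' (h2.mono (N.lt_succ_self _).le) ((hQ _ _ _).1 h1).1
    obtain ⟨γ, hγ⟩ := h W hDW
    refine hγ.not_descends (v := V) fun k => ⟨?_, fun i _ => ?_⟩
    · obtain ⟨w', v', h1, -, h3⟩ := hWV 0
      rw [h3 0 ((N.zero_le _).trans_lt (N.lt_succ_self _))]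
      exact ((hQ _ _ _).1 h1).2.1
    · obtain ⟨l, hl⟩ := hF W (N.succ (pi (V (N.succ i)) (V i)))
      obtain ⟨w', v', h1, h2, h3⟩ := hWV (max l i)
      have h4 := hl w' (h2.mono ((le_max_left l i).trans (N.lt_succ_self _).le)) _ (N.lt_succ_self _)
      have h5 := ((hQ _ _ _).1 h1).2.2 i (N.lt_succ.2 (le_max_right _ _))
      unfold Edge
      rw [h4, h3 (N.succ i) (N.succ_lt_succ.2 (N.lt_succ.2 (le_max_right _ _))),
        h3 i ((N.lt_succ.2 (le_max_right _ _)).trans (N.lt_succ_self _))]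
      exact h5
  obtain ⟨ρ, hρ⟩ := hr
  -- A descent can be prolonged by any predecessor of its last entry, and this leads to a node below
  -- in the tree. So the rank of `v k` in `F w` is at most the rank of the tree node.
  have key (γ : El κ) : ∀ w v k, Q ((w, v), k) → Rk (F w) (v k) γ →
      ∀ ρ : El κ, Rk e (node w v k) ρ → γ ≤ ρ := by
    refine El.induction (fun γ : El κ => ∀ w v k, Q ((w, v), k) → Rk (F w) (v k) γ →
      ∀ ρ : El κ, Rk e (node w v k) ρ → γ ≤ ρ) ?_ γ
    intro γ ih w v k hwv hγ ρ hρ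
    by_contra hlt
    obtain ⟨m, hm, β', h1, h2, h3⟩ := (rk_iff.1 hγ).2 ρ (not_le.1 hlt)
    classical
    let v' : R M := IFun.of M fun j => if j = N.succ k then m else v j
    have hv1 : v' (N.succ k) = m := by rw [show v' _ = _ from IFun.of_apply _ _, if_pos rfl]
    have hv2 : agree (N.succ k) v v' := fun j hj => by
      rw [show v' _ = _ from IFun.of_apply _ _, if_neg hj.ne]
    obtain ⟨hw, hv0, hv⟩ := (hQ _ _ _).1 hwv
    have hQ' : Q ((w, v'), N.succ k) := by
      refine (hQ _ _ _).2 ⟨hw, ?_, fun i hi => ?_⟩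
      · rw [← hv2 0 (N.lt_succ.2 (N.zero_le _)), hv0]
      · rw [← hv2 i hi]
        rcases (N.lt_succ.1 hi).lt_or_eq with hi | rfl
        · rw [← hv2 _ (N.succ_lt_succ.2 hi)]
          exact hv i hi
        · rw [hv1]; exact hm
    obtain ⟨ρ', h4, h5⟩ := (rk_iff.1 hρ).1 (node w v' (N.succ k))
      ((he _ _).2 ⟨w, v', k, hQ', node_eq_iff.2 ⟨rfl, agree.refl _ _, hv2⟩, rfl⟩)
    have h6 := ih β' h2 w v' (N.succ k) hQ' (hv1 ▸ h3) ρ' h5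
    exact absurd (h1.trans h6) (not_le.2 h4)
  obtain ⟨δ, hδ⟩ := Omega1.exists_gt ρ
  refine ⟨δ, fun w γ hw hγ => (key γ w (IFun.of M fun _ => 0) 0 ?_ ?_ ρ ?_).trans_lt hδ⟩
  · refine (hQ _ _ _).2 ⟨hw, IFun.of_apply _ _, fun i hi => absurd hi (N.not_lt_zero _)⟩
  · rwa [IFun.of_apply]
  · convert hρ using 1
    refine node_eq_iff.2 ⟨rfl, fun j hj => absurd hj (N.not_lt_zero _), fun j _ => ?_⟩
    rw [IFun.of_apply]
    rfl

/-- The projection is replaced by the closed set of its points joined with their witnesses, on which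
the function reads the even part only. -/
theorem AD.exists_bound_of_suslin (hAD : AD M) {A : R M → Prop} (hA : Suslin (idR M) A)
    (F : IFun M (R M) (R M)) (hF : ∀ w k, ∃ l, ∀ w', agree l w w' → agree k (F w) (F w'))
    (h : ∀ w, A w → ∃ γ : El κ, Rk (F w) 0 γ) :
    ∃ δ : El κ, ∀ w (γ : El κ), A w → Rk (F w) 0 γ → γ < δ := by
  obtain ⟨c, hc⟩ := hA
  let D : ISet M (R M) := ISet.of M fun w => InClosed c (evens w) (odds w)
  let G : IFun M (R M) (R M) := IFun.of M fun w => F (evens w)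
  have eD (w) : D w ↔ InClosed c (evens w) (odds w) := ISet.of_apply _ _
  have eG (w) : G w = F (evens w) := IFun.of_apply _ _
  have h1 : ∀ w, ¬ D w → ∃ k, ∀ w', agree k w w' → ¬ D w' := by
    intro w hw
    rw [eD] at hw
    obtain ⟨k, hk⟩ := isClosedRel_inClosed (e := idR M) c (evens w) (odds w) hw
    obtain ⟨l, hl⟩ := exists_modulus_evens (M := M) k
    obtain ⟨l', hl'⟩ := exists_modulus_odds (M := M) k
    refine ⟨max l l', fun w' hw' => ?_⟩
    rw [eD]
    exact hk (evens w') (odds w') (hl _ _ (hw'.mono (le_max_left _ _)))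
      (hl' _ _ (hw'.mono (le_max_right _ _)))
  have h2 : ∀ w k, ∃ l, ∀ w', agree l w w' → agree k (G w) (G w') := by
    intro w k
    obtain ⟨l, hl⟩ := hF (evens w) k
    obtain ⟨l', hl'⟩ := exists_modulus_evens (M := M) l
    refine ⟨l', fun w' hw' => ?_⟩
    rw [eG, eG]
    exact hl _ (hl' _ _ hw')
  have h3 : ∀ w, D w → ∃ γ : El κ, Rk (G w) 0 γ := by
    intro w hw
    rw [eD] at hw
    rw [eG]
    exact h _ ((hc _).2 ⟨_, hw⟩)
  obtain ⟨δ, hδ⟩ := hAD.exists_bound_of_closed D h1 G h2 h3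
  refine ⟨δ, fun w γ hw hγ => ?_⟩
  obtain ⟨y, hy⟩ := (hc w).1 hw
  refine hδ (join w y) γ ?_ ?_
  · rw [eD, evens_join, odds_join]; exact hy
  · rwa [eG, evens_join]

end Boundedness

/-! ### Suprema and closed unbounded sets -/

section Club
variable {M : Type*} [Membership M M] [ZFModel M] {κ : M} [hκ : Omega1 κ]

theorem El.exists_sup {a : M} [OrdSet a] (P : El a → Prop) [h : DP M P] (hb : ∃ ε, ∀ x, P x → x ≤ ε) :
    ∃ s, (∀ x, P x → x ≤ s) ∧ ∀ t, t < s → ∃ x, P x ∧ t < x := by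
  have : DP M (fun p : El a × El a => P p.2) := DP.comp h inferInstance
  obtain ⟨s, hs, hs'⟩ := El.exists_min (fun s => ∀ x, P x → x ≤ s) hb
  refine ⟨s, hs, fun t ht => ?_⟩
  by_contra hne
  push Not at hne
  exact hs' t ht hne

/-- The sequence of iterates of an unboundedly growing function has a supremum. -/
theorem AD.exists_sup_iterate (hAD : AD M) (b : IFun M (El κ) (El κ)) (hb : ∀ δ, δ < b δ) (α : El κ) :
    ∃ (c : IFun M (N M) (El κ)) (γ : El κ), c 0 = α ∧ (∀ n, c (N.succ n) = b (c n)) ∧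
      (∀ n, c n < γ) ∧ ∀ δ, δ < γ → ∃ n, δ < c n := by
  obtain ⟨c, h0, hc⟩ := N.exists_rec (M := M) α (fun (_ : N M) (δ : El κ) => b δ)
  obtain ⟨ε, hε⟩ := hAD.exists_bound c
  obtain ⟨γ, h1, h2⟩ := El.exists_sup (fun δ : El κ => ∃ n, c n = δ)
    ⟨ε, by rintro _ ⟨n, rfl⟩; exact (hε n).le⟩
  refine ⟨c, γ, h0, hc, fun n => ?_, fun δ hδ => ?_⟩
  · refine lt_of_lt_of_le ?_ (h1 _ ⟨N.succ n, rfl⟩)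
    rw [hc]; exact hb _
  · obtain ⟨_, ⟨n, rfl⟩, h⟩ := h2 δ hδ
    exact ⟨n, h⟩

/-- The closure points of a monotone function form a closed unbounded set. -/
theorem AD.isClub_of_mono (hAD : AD M) (b : IFun M (El κ) (El κ)) (hb : ∀ δ ε, δ ≤ ε → b δ ≤ b ε)
    (C : ISet M (El κ)) (hC : ∀ γ, C γ ↔ ∀ δ, δ < γ → b δ ≤ γ) : IsClub (code C) κ := by
  refine ⟨fun x hx => ?_, fun α hα => ?_, fun δ hδ hl h => ?_⟩
  · obtain ⟨y, rfl, -⟩ := (ISet.mem_code _ _).1 hx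
    exact y.2
  · let s : El κ → El κ := fun δ => the fun ε => (δ < ε ∧ b δ ≤ ε) ∧ ∀ ε', ε' < ε → ¬ (δ < ε' ∧ b δ ≤ ε')
    have hs (δ) : δ < s δ ∧ b δ ≤ s δ := by
      refine (the_spec (P := fun ε => (δ < ε ∧ b δ ≤ ε) ∧ ∀ ε', ε' < ε → ¬ (δ < ε' ∧ b δ ≤ ε')) ?_).1
      obtain ⟨ε, hε⟩ := Omega1.exists_gt (max δ (b δ))
      obtain ⟨ε, h1, h2⟩ := El.exists_min (fun ε => δ < ε ∧ b δ ≤ ε)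
        ⟨ε, (le_max_left _ _).trans_lt hε, (le_max_right _ _).trans hε.le⟩
      refine ⟨ε, ⟨h1, h2⟩, fun ε' h' => ?_⟩
      rcases lt_trichotomy ε ε' with h | h | h
      · exact absurd h1 (h'.2 _ h)
      · exact h.symm
      · exact absurd h'.1 (h2 _ h)
    have : DF M (fun δ => s δ) := by dsimp only [s]; infer_instance
    obtain ⟨c, γ, h0, hc, h1, h2⟩ := hAD.exists_sup_iterate (IFun.of M s)
      (fun δ => by rw [IFun.of_apply]; exact (hs δ).1) ⟨α, hα⟩
    refine ⟨γ.1, (ISet.code_mem_code _ _).2 ((hC γ).2 fun δ hδ => ?_), ?_⟩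
    · obtain ⟨n, hn⟩ := h2 δ hδ
      refine (hb _ _ hn.le).trans (((hs (c n)).2).trans ?_)
      have := h1 (N.succ n)
      rw [hc, IFun.of_apply] at this
      exact this.le
    · have := h1 0
      rw [h0] at this
      exact this
  · refine (ISet.code_mem_code C (⟨δ, hδ⟩ : El κ)).2 ((hC _).2 fun ε hε => ?_)
    obtain ⟨β, h1, h2, h3⟩ := h ε.1 hε
    obtain ⟨β, rfl, h4⟩ := (ISet.mem_code _ _).1 h1
    exact ((hC _).1 h4 ε h3).trans (show β < (⟨δ, hδ⟩ : El κ) from h2).le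

end Club

/-! ### Games with promises -/

section Response
variable {M : Type*} [Membership M M] [ZFModel M]

/-- In a game where each player has to keep certain promises as long as the opponent does, one of
the players can do so and achieve their aim. -/
theorem AD.exists_response (hAD : AD M) {T : Type*} [SType M T] (K : R M → T → Prop)
    [hK : DP M (fun p : R M × T => K p.1 p.2)] (r : T → T → Prop)
    [hr : DP M (fun p : T × T => r p.1 p.2)] (hr' : ∀ s t, r s t ∨ r t s) (W : R M → R M → Prop)
    [hW : DP M (fun p : R M × R M => W p.1 p.2)] :
    ∃ F : IFun M (R M) (R M), (∀ y y' n, agree n y y' → agree n (F y) (F y')) ∧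
      (∀ y t, (∀ s, r s t → K y s) → K (F y) t) ∧
      ((∀ y, (∀ t, K y t) → W (F y) y) ∨ ∀ y, (∀ t, K y t) → ¬ W y (F y)) := by
  have hrr (t) : r t t := (hr' t t).elim id id
  -- The first player wins by keeping all promises up to and including some `t` that the opponent
  -- breaks, or if nobody breaks any and `W` holds. Either winning strategy therefore keeps each
  -- promise as long as the opponent has kept those up to it.
  let G : R M × R M → Prop := fun p => (∃ t, (∀ s, r s t → K p.1 s) ∧ ¬ K p.2 t) ∨
    ((∀ t, K p.1 t) ∧ (∀ t, K p.2 t) ∧ W p.1 p.2)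
  have hG : DP M G := by
    have h1 : DP M (fun p : ((R M × R M) × T) × T => r p.2 p.1.2) :=
      DP.comp hr (f := fun p : ((R M × R M) × T) × T => (p.2, p.1.2)) inferInstance
    have h2 : DP M (fun p : ((R M × R M) × T) × T => K p.1.1.1 p.2) :=
      DP.comp hK (f := fun p : ((R M × R M) × T) × T => (p.1.1.1, p.2)) inferInstance
    have h3 : DP M (fun p : (R M × R M) × T => K p.1.2 p.2) :=
      DP.comp hK (f := fun p : (R M × R M) × T => (p.1.2, p.2)) inferInstance
    have h4 : DP M (fun p : (R M × R M) × T => K p.1.1 p.2) :=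
      DP.comp hK (f := fun p : (R M × R M) × T => (p.1.1, p.2)) inferInstance
    dsimp only [G]; infer_instance
  have eG (x y) : (ISet.of M G) (x, y) ↔ G (x, y) := ISet.of_apply _ _
  rcases hAD.game (ISet.of M G) with ⟨F, hF, h⟩ | ⟨F, hF, h⟩
  · have h (y) := (eG _ _).1 (h y)
    refine ⟨F, fun y y' n e => (hF y y' n e).mono (N.lt_succ_self n).le, fun y t ht => ?_,
      Or.inl fun y hy => ?_⟩
    · rcases h y with ⟨t', h1, h2⟩ | h1
      · rcases hr' t t' with h3 | h3
        · exact h1 t h3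
        · exact absurd (ht _ h3) h2
      · exact h1.1 t
    · rcases h y with ⟨t', h1, h2⟩ | h1
      · exact absurd (hy _) h2
      · exact h1.2.2
  · have h (y) := mt (eG _ _).2 (h y)
    have key (y t) (ht : ∀ s, r s t → K y s) : K (F y) t := by
      by_contra hn
      exact h y (Or.inl ⟨t, ht, hn⟩)
    exact ⟨F, hF, key, Or.inr fun y hy hW => h y (Or.inr ⟨hy, fun t => key y t fun s _ => hy s, hW⟩)⟩

end Response

/-! ### Martin's game and the homogeneous club -/

section Partition
variable {M : Type*} [Membership M M] [ZFModel M] {κ : M} [hκ : Omega1 κ]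

/-- The ordinal at the place `n` of the family of ordinals coded by `x` is `γ`. -/
def Val (x : R M) (n : N M) (γ : El κ) : Prop := Rk (sec x n) 0 γ

instance Val.dp {X : Type*} [DType M X] {x : X → R M} {f : X → N M} {g : X → El κ}
    [h : DF M (fun t => x t)] [h' : DF M (fun t => f t)] [h'' : DF M (fun t => g t)] :
    DP M (no_index (fun t => Val (x t) (f t) (g t))) := by
  unfold Val; infer_instance

theorem Val.unique {x : R M} {n : N M} {γ γ' : El κ} (h : Val x n γ) (h' : Val x n γ') : γ = γ' :=
  Rk.unique h h'

theorem AD.biSuslin_val (hAD : AD M) (n : N M) (γ : El κ) :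
    BiSuslin (idR M) (fun x => Val x n γ) :=
  (BiSuslin.comp (e := idR M) (hAD.biSuslin_rk γ 0) (IFun.of M fun x => sec x n) fun x k => by
    obtain ⟨l, hl⟩ := exists_modulus_sec n k
    refine ⟨l, fun x' h => ?_⟩
    rw [IFun.of_apply, IFun.of_apply]
    exact hl _ _ h).congr fun x => by unfold Val; rw [IFun.of_apply]

/-- Boundedness for strategies. -/
theorem AD.exists_bound_of_response (hAD : AD M) {T : Type*} [SType M T] (i : IFun M T (N M))
    (hi : ∀ s t, i s = i t → s = t) (r : T → T → Prop) [hr : DP M (fun p : T × T => r p.1 p.2)]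
    (F : IFun M (R M) (R M)) (hF : ∀ y y' n, agree n y y' → agree n (F y) (F y'))
    (h : ∀ y t, (∀ s, r s t → ∃ γ : El κ, Val y (i s) γ) → ∃ γ : El κ, Val (F y) (i t) γ) (δ : El κ) :
    ∃ ε : El κ, ∀ t y γ, (∀ s, r s t → ∃ β, β < δ ∧ Val y (i s) β) → Val (F y) (i t) γ → γ < ε := by
  let B : T → El κ → Prop := fun t ε =>
    ∀ y γ, (∀ s, r s t → ∃ β, β < δ ∧ Val y (i s) β) → Val (F y) (i t) γ → γ < ε
  have hB : DP M (fun p : T × El κ => B p.1 p.2) := by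
    have : DP M (fun p : (((T × El κ) × R M) × El κ) × T => r p.2 p.1.1.1.1) :=
      DP.comp hr (f := fun p : (((T × El κ) × R M) × El κ) × T => (p.2, p.1.1.1.1)) inferInstance
    dsimp only [B]; infer_instance
  have key (t) : ∃ ε, B t ε := by
    obtain ⟨j, hj⟩ := Omega1.exists_enum δ
    have hrt : DP M (fun s => r s t) := DP.comp hr (f := fun s => (s, t)) inferInstance
    -- There are countably many places and countably many ordinals below `δ`, so the restriction on
    -- the opponent's play is a projection of a closed set and boundedness applies to the answer at
    -- `t`.
    have hS : Suslin (idR M) (fun y => ∀ s, r s t → ∃ β, β < δ ∧ Val y (i s) β) :=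
      hAD.suslin_all i (fun s t _ _ => hi s t) (fun s y => ∃ β, β < δ ∧ Val y (i s) β)
        fun s _ => hAD.suslin_ex j hj (fun β y => Val y (i s) β) fun β _ => (hAD.biSuslin_val _ _).1
    obtain ⟨ε, hε⟩ := hAD.exists_bound_of_suslin (κ := κ) hS (IFun.of M fun y => sec (F y) (i t))
      (fun w k => by
        obtain ⟨l, hl⟩ := exists_modulus_sec (M := M) (i t) k
        refine ⟨l, fun w' hw => ?_⟩
        rw [IFun.of_apply, IFun.of_apply]
        exact hl _ _ (hF _ _ _ hw))
      (fun w hw => by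
        rw [IFun.of_apply]
        exact h w t fun s hs => let ⟨β, _, hβ⟩ := hw s hs; ⟨β, hβ⟩)
    exact ⟨ε, fun y γ h1 h2 => hε y γ h1 (by rw [IFun.of_apply]; exact h2)⟩
  -- Least bounds are definable from the place; regularity then bounds these countably many ordinals
  -- by one `ε`.
  let m : T → El κ → Prop := fun t ε => B t ε ∧ ∀ ε', ε' < ε → ¬ B t ε'
  have hm : DP M (fun p : T × El κ => m p.1 p.2) := by
    have : DP M (fun p : (T × El κ) × El κ => B p.1.1 p.2) :=
      DP.comp hB (f := fun p : (T × El κ) × El κ => (p.1.1, p.2)) inferInstance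
    dsimp only [m]; infer_instance
  have key' (t) : m t (the (m t)) := by
    have : DP M (B t) := DP.comp hB (f := fun ε => (t, ε)) inferInstance
    obtain ⟨ε, h1, h2⟩ := El.exists_min _ (key t)
    refine the_spec ⟨ε, ⟨h1, h2⟩, fun ε' h' => ?_⟩
    rcases lt_trichotomy ε ε' with h | h | h
    · exact absurd h1 (h'.2 _ h)
    · exact h.symm
    · exact absurd h'.1 (h2 _ h)
  obtain ⟨ε, hε⟩ := hAD.exists_bound_of_inj i (fun _ => True) (fun s t _ _ => hi s t)
    (IFun.of M fun t => the (m t))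
  refine ⟨ε, fun t y γ h1 h2 => ((key' t).1 y γ h1 h2).trans ?_⟩
  have := hε t trivial
  rwa [IFun.of_apply] at this

variable {l : M} [hl : OrdSet l]

/-- The function `g` witnesses that `f` has uniform cofinality `ω`. -/
def UniformlyCofinal (f : IFun M (El l) (El κ)) (g : IFun M (El l × N M) (El κ)) : Prop :=
  (∀ α m n, m < n → g (α, m) < g (α, n)) ∧ (∀ α n, g (α, n) < f α) ∧
    ∀ α β, β < f α → ∃ n, β ≤ g (α, n)

/-- The function `f` is increasing and of the correct type. -/
def Correct (f : IFun M (El l) (El κ)) : Prop :=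
  (∀ α β, α < β → f α < f β) ∧ (∃ g, UniformlyCofinal f g) ∧
    ∀ α, ∃ s, s < f α ∧ ∀ β, β < α → f β ≤ s

instance Correct.dp {X : Type*} [DType M X] {f : X → IFun M (El l) (El κ)}
    [h : DF M (fun t => f t)] : DP M (no_index (fun t => Correct (f t))) :=
  DP.comp (P := Correct) (by unfold Correct UniformlyCofinal; infer_instance) h

/-- The values of `f` are the suprema of the ordinals coded by `x` and `y` together. -/
def SupRel (i : IFun M (El l) (N M)) (x y : R M) (f : IFun M (El l) (El κ)) : Prop :=
  ∀ α, (∀ n γ, Val x (pi (i α) n) γ ∨ Val y (pi (i α) n) γ → γ < f α) ∧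
    ∀ β, β < f α → ∃ n γ, β ≤ γ ∧ (Val x (pi (i α) n) γ ∨ Val y (pi (i α) n) γ)

theorem SupRel.symm {i : IFun M (El l) (N M)} {x y : R M} {f : IFun M (El l) (El κ)}
    (h : SupRel i x y f) : SupRel i y x f := fun α =>
  ⟨fun n γ h' => (h α).1 n γ h'.symm, fun β hβ =>
    let ⟨n, γ, h1, h2⟩ := (h α).2 β hβ; ⟨n, γ, h1, h2.symm⟩⟩

theorem SupRel.unique {i : IFun M (El l) (N M)} {x y : R M} {f g : IFun M (El l) (El κ)}
    (h : SupRel i x y f) (h' : SupRel i x y g) : f = g := by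
  refine IFun.ext fun α => ?_
  rcases lt_trichotomy (f α) (g α) with h1 | h1 | h1
  · obtain ⟨n, γ, h2, h3⟩ := (h' α).2 _ h1
    exact absurd ((h α).1 n γ h3) (not_lt.2 h2)
  · exact h1
  · obtain ⟨n, γ, h2, h3⟩ := (h α).2 _ h1
    exact absurd ((h' α).1 n γ h3) (not_lt.2 h2)

/-- Both players contribute to the same function: the promise at `(α, n)` is to code some ordinal
there, and `f α` is the supremum of what both code at the places of `α`. Against a winning strategy,
the opponent can force any correct `f` whose values are closed under the bounds of the strategy. -/
theorem AD.exists_club (hAD : AD M) (i : IFun M (El l) (N M)) (hi : ∀ α β, i α = i β → α = β)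
    (P : IFun M (El l) (El κ) → Prop) [hP : DP M P] :
    ∃ C : ISet M (El κ), IsClub (code C) κ ∧
      ((∀ f, Correct f → (∀ α, C (f α)) → P f) ∨ ∀ f, Correct f → (∀ α, C (f α)) → ¬ P f) := by
  let T := El l × N M
  let j : IFun M (El l × N M) (N M) := IFun.of M fun t => pi (i t.1) t.2
  have ej (α n) : j (α, n) = pi (i α) n := IFun.of_apply _ _
  have hj : ∀ s t, j s = j t → s = t := by
    rintro ⟨α, n⟩ ⟨β, m⟩ h
    rw [ej, ej] at h
    obtain ⟨h1, h2⟩ := pi_inj h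
    exact Prod.ext (hi _ _ h1) h2
  -- Lexicographic order: the answer at `(α, n)` is controlled by the opponent's ordinals at the
  -- places of smaller `β` and at `(α, k)` for `k ≤ n`, and these will be bounded strictly below `f
  -- α`.
  let r : El l × N M → El l × N M → Prop := fun s t => s.1 < t.1 ∨ s.1 = t.1 ∧ s.2 ≤ t.2
  have hr : DP M (fun p : (El l × N M) × (El l × N M) => r p.1 p.2) := by
    dsimp only [r]; infer_instance
  have hr' : ∀ s t, r s t ∨ r t s := by
    intro s t
    rcases lt_trichotomy s.1 t.1 with h | h | h
    · exact Or.inl (Or.inl h)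
    · rcases le_total s.2 t.2 with h' | h'
      · exact Or.inl (Or.inr ⟨h, h'⟩)
      · exact Or.inr (Or.inr ⟨h.symm, h'⟩)
    · exact Or.inr (Or.inl h)
  let K : R M → El l × N M → Prop := fun x t => ∃ γ : El κ, Val x (j t) γ
  let W : R M → R M → Prop := fun x y => ∃ f, Correct f ∧ SupRel i x y f ∧ P f
  have hK : DP M (fun p : R M × (El l × N M) => K p.1 p.2) := by dsimp only [K]; infer_instance
  have hW : DP M (fun p : R M × R M => W p.1 p.2) := by
    have : DP M (fun p : (R M × R M) × IFun M (El l) (El κ) => P p.2) := DP.comp hP inferInstance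
    dsimp only [W]; unfold SupRel; infer_instance
  obtain ⟨F, hF, hFK, hFW⟩ := hAD.exists_response K r hr' W
  have hbd := hAD.exists_bound_of_response j hj r F hF hFK
  let B : El κ → El κ → Prop := fun δ ε => ∀ t y γ,
    (∀ s, r s t → ∃ β, β < δ ∧ Val y (j s) β) → Val (F y) (j t) γ → γ < ε
  let m : El κ → El κ → Prop := fun δ ε => B δ ε ∧ ∀ ε', ε' < ε → ¬ B δ ε'
  have hB : DP M (fun p : El κ × El κ => B p.1 p.2) := by dsimp only [B, r]; infer_instance
  have hm : DP M (fun p : El κ × El κ => m p.1 p.2) := by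
    have : DP M (fun p : (El κ × El κ) × El κ => B p.1.1 p.2) :=
      DP.comp hB (f := fun p : (El κ × El κ) × El κ => (p.1.1, p.2)) inferInstance
    dsimp only [m]; infer_instance
  have hm' (δ) : m δ (the (m δ)) := by
    have : DP M (B δ) := DP.comp hB (f := fun ε => (δ, ε)) inferInstance
    obtain ⟨ε, h1, h2⟩ := El.exists_min _ (hbd δ)
    refine the_spec ⟨ε, ⟨h1, h2⟩, fun ε' h' => ?_⟩
    rcases lt_trichotomy ε ε' with h | h | h
    · exact absurd h1 (h'.2 _ h)
    · exact h.symm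
    · exact absurd h'.1 (h2 _ h)
  -- Being least bounds, the values of `b` are monotone: a bound that is valid for a larger `δ` is
  -- valid for a smaller one.
  let b : IFun M (El κ) (El κ) := IFun.of M fun δ => the (m δ)
  have eb (δ) : m δ (b δ) := by rw [show b δ = _ from IFun.of_apply _ _]; exact hm' δ
  have hb : ∀ δ ε, δ ≤ ε → b δ ≤ b ε := by
    intro δ ε h
    by_contra hlt
    refine (eb δ).2 _ (not_le.1 hlt) fun t y γ h1 h2 => (eb ε).1 t y γ (fun s hs => ?_) h2
    obtain ⟨β, h3, h4⟩ := h1 s hs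
    exact ⟨β, h3.trans_le h, h4⟩
  let C : ISet M (El κ) := ISet.of M fun γ => ∀ δ, δ < γ → b δ ≤ γ
  have hC (γ) : C γ ↔ ∀ δ, δ < γ → b δ ≤ γ := ISet.of_apply _ _
  have key (f : IFun M (El l) (El κ)) (hf : Correct f) (hfC : ∀ α, C (f α)) :
      ∃ z, (∀ t, K z t) ∧ SupRel i z (F z) f := by
    obtain ⟨hinc, ⟨g, hg1, hg2, hg3⟩, hdis⟩ := hf
    -- The opponent plays codes of all the ordinals `g t`, chosen simultaneously; places that belong
    -- to no `t` carry no condition.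
    obtain ⟨z', hz'⟩ := hAD.choice (fun n x => ∀ t, j t = n → Rk x 0 (g t)) fun n => by
      by_cases h : ∃ t, j t = n
      · obtain ⟨t, rfl⟩ := h
        obtain ⟨x, hx⟩ := exists_rk_zero (g t)
        exact ⟨x, fun s hs => hj _ _ hs ▸ hx⟩
      · exact ⟨default, fun t ht => absurd ⟨t, ht⟩ h⟩
    obtain ⟨z, hz⟩ := exists_sec_eq z'
    have hzg (t) : Val z (j t) (g t) := by
      unfold Val
      rw [hz]
      exact hz' _ t rfl
    refine ⟨z, fun t => ⟨_, hzg t⟩, fun α => ⟨fun n γ h => ?_, fun β hβ => ?_⟩⟩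
    · rw [← ej] at h
      rcases h with h | h
      · rw [h.unique (hzg _)]; exact hg2 _ _
      · obtain ⟨s, hs, hs'⟩ := hdis α
        obtain ⟨n1, h1⟩ := hg3 α s hs
        have h2 : s < g (α, N.succ (max n n1)) :=
          h1.trans_lt (hg1 _ _ _ (N.lt_succ.2 (le_max_right _ _)))
        refine ((eb (g (α, N.succ (max n n1)))).1 (α, n) z γ ?_ h).trans_le
          ((hC _).1 (hfC α) _ (hg2 _ _))
        rintro ⟨β, k⟩ (h3 | ⟨h3, h4⟩)
        · exact ⟨_, ((hg2 β k).trans_le (hs' β h3)).trans h2, hzg _⟩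
        · obtain rfl : β = α := h3
          exact ⟨_, hg1 _ _ _ (N.lt_succ.2 ((show k ≤ n from h4).trans (le_max_left _ _))), hzg _⟩
    · obtain ⟨n, hn⟩ := hg3 α β hβ
      exact ⟨n, _, hn, Or.inl (ej α n ▸ hzg _)⟩
  refine ⟨C, hAD.isClub_of_mono b hb C hC, ?_⟩
  rcases hFW with h | h
  · refine Or.inl fun f hf hfC => ?_
    obtain ⟨z, hz, hs⟩ := key f hf hfC
    -- The play determines its function uniquely and symmetrically in the players, so `f'` is `f`.
    obtain ⟨f', -, h1, h2⟩ := h z hz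
    rwa [hs.symm.unique h1]
  · refine Or.inr fun f hf hfC hPf => ?_
    obtain ⟨z, hz, hs⟩ := key f hf hfC
    exact h z hz ⟨f, hf, hs, hPf⟩

end Partition

/-! ### From functions coded in the model to internal functions -/

section Translation
variable {M : Type*} [Membership M M]

theorem IsFun.mono {f : M} {A B B' : Set M} (h : IsFun f A B) (hB : B ⊆ B') : IsFun f A B' :=
  ⟨fun p hp => let ⟨x, hx, y, hy, e⟩ := h.1 p hp; ⟨x, hx, y, hB hy, e⟩, h.2⟩

theorem incr_mono {A B l : M} (h : ∀ x, x ∈ A → x ∈ B) {f : M} (hf : f ∈ incr A l) : f ∈ incr B l :=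
  ⟨hf.1.mono h, hf.2⟩

variable [ZFModel M]

theorem IsFun.mem_of_maps {f : M} {A B : Set M} (h : IsFun f A B) {x y : M} (hm : Maps f x y) :
    x ∈ A ∧ y ∈ B := by
  obtain ⟨x', hx, y', hy, hp⟩ := h.1 _ (maps_iff.1 hm)
  obtain ⟨rfl, rfl⟩ := pr_inj (isPair_iff.1 hp)
  exact ⟨hx, hy⟩

theorem IsFun.maps_unique {f : M} {A B : Set M} (h : IsFun f A B) {x y y' : M} (hm : Maps f x y)
    (hm' : Maps f x y') : y = y' :=
  (h.2 x (h.mem_of_maps hm).1).unique hm hm'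

theorem exists_ifun_El {f a b : M} (h : IsFun f (ext a) (ext b)) :
    ∃ g : IFun M (El a) (El b), code g = f :=
  IFun.exists_code_eq (by rwa [range_El, range_El])

variable {κ : M} [hκ : Omega1 κ]

theorem Omega1.exists_inj {l : M} (hl : l ∈ κ) :
    ∃ i : IFun M (El l) (N M), ∀ α β, i α = i β → α = β := by
  obtain ⟨f, hf, hi⟩ := hκ.out.2.2 l hl
  obtain ⟨i, rfl⟩ : ∃ i : IFun M (El l) (N M), code i = f :=
    IFun.exists_code_eq (by rwa [range_El, range_N])
  exact ⟨i, fun α β h => DType.code_inj _ _ (hi (code α) (code β) (code (i β))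
    ((IFun.maps_code_code _ _ _).2 h) ((IFun.maps_code_code _ _ _).2 rfl))⟩

variable {l : M} [hl : OrdSet l]

theorem exists_increasing {A f : M} (hA : ∀ x, x ∈ A → x ∈ κ) (hf : f ∈ incr A l) :
    ∃ g : IFun M (El l) (El κ), code g = f ∧ (∀ α β, α < β → g α < g β) ∧ ∀ α, (g α).1 ∈ A := by
  obtain ⟨g, rfl⟩ := exists_ifun_El (hf.1.mono hA)
  have hg (α : El l) : Maps (code g) α.1 (g α).1 := (IFun.maps_code_code g α _).2 rfl
  exact ⟨g, rfl, fun α β h => hf.2 _ _ _ _ h (hg α) (hg β), fun α => (hf.1.mem_of_maps (hg α)).2⟩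

theorem exists_correct {A f : M} (hA : ∀ x, x ∈ A → x ∈ κ) (hf : f ∈ incrCorrect A l κ) :
    ∃ g : IFun M (El l) (El κ), code g = f ∧ Correct g ∧ ∀ α, (g α).1 ∈ A := by
  obtain ⟨h1, ⟨u, hu1, hu2, hu3⟩, h3⟩ := hf
  obtain ⟨f, rfl, hinc, hfA⟩ := exists_increasing hA h1
  have hm (α : El l) : Maps (code f) α.1 (f α).1 := (IFun.maps_code_code f α _).2 rfl
  obtain ⟨g, rfl⟩ : ∃ g : IFun M (El l × N M) (El κ), code g = u := by
    refine IFun.exists_code_eq ?_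
    rw [range_El]
    convert hu1 using 1
    ext m
    constructor
    · rintro ⟨⟨α, n⟩, rfl⟩
      exact ⟨_, _, α.2, mem_omegaSet.1 n.2, isPair_pr _ _⟩
    · rintro ⟨α, n, hα, hn, hp⟩
      exact ⟨(⟨α, hα⟩, ⟨n, mem_omegaSet.2 hn⟩), (isPair_iff.1 hp).symm⟩
  have hg (α : El l) (n : N M) : Maps (code g) (pr α.1 n.1) (g (α, n)).1 :=
    (IFun.maps_code_code g (α, n) _).2 rfl
  have hg1 (α : El l) (m n : N M) (h : m < n) : g (α, m) < g (α, n) :=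
    hu2 _ _ _ _ _ _ _ h (isPair_pr _ _) (isPair_pr _ _) (hg α m) (hg α n)
  refine ⟨f, rfl, ⟨hinc, ⟨g, hg1, fun α n => ?_, fun α β hβ => ?_⟩, fun α => ?_⟩, hfA⟩
  · have h := (hu3 _ _ (hm α)).2.1 _ ⟨_, _, mem_omegaSet.1 (N.succ n).2, isPair_pr _ _, hg α _⟩
    exact (hg1 α n _ (N.lt_succ_self n)).trans_le h
  · by_contra hne
    push Not at hne
    have h := (hu3 _ _ (hm α)).2.2 β.1 (OrdSet.isOrd.of_mem β.2) ?_
    · exact absurd hβ (not_lt.2 h)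
    · rintro w ⟨n, p, hn, hp, hw⟩
      rw [isPair_iff.1 hp] at hw
      obtain rfl : w = (g (α, ⟨n, mem_omegaSet.2 hn⟩)).1 :=
        hu1.maps_unique hw (hg α ⟨n, mem_omegaSet.2 hn⟩)
      exact (hne _).le
  · obtain ⟨s, hs, hs'⟩ := h3 _ _ (hm α)
    have hsκ : s ∈ κ := OrdSet.isOrd.mem_trans (f α).2 hs'
    exact ⟨⟨s, hsκ⟩, hs', fun β hβ => hs.2.1 _ ⟨β.1, hβ, hm β⟩⟩

end Translation

/-! ### The two partition relations -/

section Arrows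
variable {M : Type*} [Membership M M] [ZFModel M] {κ : M} [hκ : Omega1 κ]

theorem mem_two_iff {v : M} : v ∈ two M ↔ v = (0 : N M).1 ∨ v = (N.succ (0 : N M)).1 := by
  constructor
  · rintro (h | ⟨z, hz, h⟩)
    · exact Or.inl (isEmpty_unique h N.zero_val)
    · rw [isEmpty_unique hz N.zero_val] at h
      exact Or.inr (isSucc_unique h (N.isSucc_succ 0))
  · rintro (rfl | rfl)
    · exact Or.inl N.zero_val
    · exact Or.inr ⟨_, N.zero_val, N.isSucc_succ 0⟩

theorem AD.arrowStar (hAD : AD M) {l : M} (hl : l ∈ κ) : ArrowStar κ l (two M) := by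
  have : OrdSet l := ⟨hκ.out.1.of_mem hl⟩
  intro P hP
  obtain ⟨i, hi⟩ := Omega1.exists_inj hl
  obtain ⟨C, hC, h⟩ := hAD.exists_club i hi
    (fun f : IFun M (El l) (El κ) => Maps P (code f) (0 : N M).1)
  have hmem (f : IFun M (El l) (El κ)) (hf : ∀ α, (f α).1 ∈ (code C : M)) (α) : C (f α) :=
    (ISet.code_mem_code _ _).1 (hf α)
  rcases h with h | h
  · refine ⟨_, mem_two_iff.2 (Or.inl rfl), code C, hC, fun f hf => ?_⟩
    obtain ⟨f, rfl, hf1, hf2⟩ := exists_correct hC.1 hf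
    exact h f hf1 (hmem f hf2)
  · refine ⟨_, mem_two_iff.2 (Or.inr rfl), code C, hC, fun f hf => ?_⟩
    obtain ⟨v, hv, -⟩ := hP.2 f ⟨incr_mono hC.1 hf.1, hf.2⟩
    obtain ⟨f, rfl, hf1, hf2⟩ := exists_correct hC.1 hf
    rcases mem_two_iff.1 (hP.mem_of_maps hv).2 with rfl | rfl
    · exact absurd hv (h f hf1 (hmem f hf2))
    · exact hv

/-- Unbounded subsets of `κ` have the cardinality of `κ`. -/
theorem AD.exists_isBij (hAD : AD M) (A : ISet M (El κ)) (hA : ∀ α, ∃ β, A β ∧ α < β) :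
    ∃ e : M, IsBij e (ext (code A : M)) (ext κ) := by
  -- The increasing enumeration of `A`: at each stage the least element of `A` above all earlier
  -- values. It never stops, because a stage has countably many predecessors, `κ` is regular and `A`
  -- is unbounded.
  let B : El κ → IFun M (El κ) (El κ) → El κ → Prop := fun δ f a => A a ∧ ∀ β, β < δ → f β < a
  let m : El κ → IFun M (El κ) (El κ) → El κ → Prop := fun δ f a => B δ f a ∧ ∀ a', a' < a → ¬ B δ f a'
  obtain ⟨h, hh⟩ := El.exists_rec (a := κ) (fun δ f => the (m δ f))
    (hG := by dsimp only [m, B]; infer_instance) (by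
      intro t f g hfg
      have : ∀ a, B t f a ↔ B t g a := fun a =>
        and_congr_right fun _ => forall_congr' fun β => imp_congr_right fun hβ => by rw [hfg β hβ]
      congr 1
      funext a
      simp only [m, this])
  have hm (δ) : m δ h (h δ) := by
    have hB : DP M (B δ h) := by dsimp only [B]; infer_instance
    obtain ⟨j, hj⟩ := Omega1.exists_enum δ
    obtain ⟨ε, hε⟩ := hAD.exists_bound_of_inj j (fun β => β < δ) (fun s t hs ht => hj s t hs ht) h
    obtain ⟨a, ha, ha'⟩ := hA ε
    obtain ⟨a, h1, h2⟩ := El.exists_min (B δ h) ⟨a, ha, fun β hβ => (hε β hβ).trans ha'⟩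
    rw [hh]
    refine the_spec ⟨a, ⟨h1, h2⟩, fun a' h' => ?_⟩
    rcases lt_trichotomy a a' with h | h | h
    · exact absurd h1 (h'.2 _ h)
    · exact h.symm
    · exact absurd h'.1 (h2 _ h)
  have hinc (α β) (hαβ : α < β) : h α < h β := (hm β).1.2 α hαβ
  have hinj (α β) (e : h α = h β) : α = β := by
    rcases lt_trichotomy α β with h1 | h1 | h1
    · exact absurd e (hinc _ _ h1).ne
    · exact h1
    · exact absurd e (hinc _ _ h1).ne'
  have hle (δ) : δ ≤ h δ := by
    refine El.induction (fun δ => δ ≤ h δ) (fun δ ih => ?_) δ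
    by_contra hlt
    exact absurd (hinc _ _ (not_le.1 hlt)) (not_lt.2 (ih _ (not_le.1 hlt)))
  have hsurj (a) (ha : A a) : ∃ δ, h δ = a := by
    -- At the first stage whose value reaches `a`, the element `a` is itself a candidate, so the
    -- value is `a`.
    obtain ⟨δ, h1, h2⟩ := El.exists_min (fun δ => a ≤ h δ) ⟨a, hle a⟩
    refine ⟨δ, le_antisymm (le_of_not_gt fun hlt => (hm δ).2 a hlt ⟨ha, fun β hβ => ?_⟩) h1⟩
    exact not_le.1 (h2 β hβ)
  let e : IFun M (El (code A : M)) (El κ) := IFun.of M fun a => the fun δ => (h δ).1 = a.1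
  have he (a δ) (hδ : (h δ).1 = a.1) : e a = δ := by
    rw [show e a = _ from IFun.of_apply _ _]
    exact the_eq hδ fun z hz => hinj _ _ (Subtype.ext (hz.trans hδ.symm))
  have hA' (δ) : (h δ).1 ∈ (code A : M) := (ISet.code_mem_code A (h δ)).2 (hm δ).1.1
  have hcode (a : El (code A : M)) : ∃ δ, (h δ).1 = a.1 := by
    obtain ⟨b, hb, hb'⟩ := (ISet.mem_code _ _).1 a.2
    obtain ⟨δ, rfl⟩ := hsurj b hb'
    exact ⟨δ, hb⟩
  refine ⟨code e, ⟨?_, fun x x' y hx hx' => ?_⟩, fun y hy => ?_⟩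
  · have := e.isFun_code
    rwa [range_El, range_El] at this
  · obtain ⟨a, rfl, rfl⟩ := (IFun.maps_code _ _ _).1 hx
    obtain ⟨a', rfl, h'⟩ := (IFun.maps_code _ _ _).1 hx'
    have h' := DType.code_inj _ _ h'
    obtain ⟨δ, hδ⟩ := hcode a
    obtain ⟨δ', hδ'⟩ := hcode a'
    rw [he a δ hδ, he a' δ' hδ'] at h'
    subst h'
    exact hδ.symm.trans hδ'
  · exact ⟨(h ⟨y, hy⟩).1, (IFun.maps_code_code e ⟨_, hA' ⟨y, hy⟩⟩ ⟨y, hy⟩).2 (he _ _ rfl)⟩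

/-- The point `γ` is a limit of points of `C`. -/
def IsLimitOf (C : ISet M (El κ)) (γ : El κ) : Prop :=
  (∃ β, β < γ) ∧ ∀ β, β < γ → ∃ c, C c ∧ β < c ∧ c < γ

/-- The limits of points of `C` that are not limits of limits. -/
def IsSimpleLimit (C : ISet M (El κ)) (γ : El κ) : Prop :=
  IsLimitOf C γ ∧ ∃ s, s < γ ∧ ∀ γ', γ' < γ → IsLimitOf C γ' → γ' ≤ s

instance IsLimitOf.dp {C : ISet M (El κ)} {X : Type*} [DType M X] {f : X → El κ}
    [h : DF M (fun t => f t)] : DP M (no_index (fun t => IsLimitOf C (f t))) :=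
  DP.comp (P := fun γ => IsLimitOf C γ) (by unfold IsLimitOf; infer_instance) h

instance IsSimpleLimit.dp {C : ISet M (El κ)} {X : Type*} [DType M X] {f : X → El κ}
    [h : DF M (fun t => f t)] : DP M (no_index (fun t => IsSimpleLimit C (f t))) :=
  DP.comp (P := fun γ => IsSimpleLimit C γ) (by unfold IsSimpleLimit; infer_instance) h

theorem exists_next {C : ISet M (El κ)} (hC : ∀ α, ∃ β, C β ∧ α < β) :
    ∃ b : IFun M (El κ) (El κ), ∀ δ, δ < b δ ∧ C (b δ) ∧ ∀ c, C c → δ < c → b δ ≤ c := by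
  refine ⟨IFun.of M fun δ => the fun a => (C a ∧ δ < a) ∧ ∀ c, C c → δ < c → a ≤ c, fun δ => ?_⟩
  rw [IFun.of_apply]
  have h := the_spec (P := fun a : El κ => (C a ∧ δ < a) ∧ ∀ c, C c → δ < c → a ≤ c) (by
    obtain ⟨a, h1, h2⟩ := El.exists_min (fun a => C a ∧ δ < a) (hC δ)
    exact ⟨a, ⟨h1, fun c hc hc' => not_lt.1 fun hlt => h2 c hlt ⟨hc, hc'⟩⟩,
      fun a' h' => le_antisymm (h'.2 a h1.1 h1.2)
        (not_lt.1 fun hlt => h2 a' hlt h'.1)⟩)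
  exact ⟨h.1.2, h.1.1, h.2⟩

/-- Iterating "next element of `C`" from `α` and taking the supremum produces a limit above `α`. -/
theorem AD.exists_isLimitOf (hAD : AD M) {C : ISet M (El κ)} (hC : ∀ α, ∃ β, C β ∧ α < β) (α : El κ) :
    ∃ γ, α < γ ∧ IsLimitOf C γ := by
  obtain ⟨b, hb⟩ := exists_next hC
  obtain ⟨c, γ, h0, hc, h1, h2⟩ := hAD.exists_sup_iterate b (fun δ => (hb δ).1) α
  refine ⟨γ, h0 ▸ h1 0, ⟨c 0, h1 0⟩, fun β hβ => ?_⟩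
  obtain ⟨n, hn⟩ := h2 β hβ
  refine ⟨c (N.succ n), ?_, hn.trans ?_, h1 _⟩
  · rw [hc]; exact (hb _).2.1
  · rw [hc]; exact (hb _).1

/-- The least limit above `α` is simple: all smaller limits are at most `α`. -/
theorem AD.exists_isSimpleLimit (hAD : AD M) {C : ISet M (El κ)} (hC : ∀ α, ∃ β, C β ∧ α < β)
    (α : El κ) : ∃ γ, IsSimpleLimit C γ ∧ α < γ := by
  obtain ⟨γ, ⟨h1, h2⟩, h3⟩ := El.exists_min (fun γ => α < γ ∧ IsLimitOf C γ) (hAD.exists_isLimitOf hC α)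
  exact ⟨γ, ⟨h2, α, h1, fun γ' h h' => not_lt.1 fun hlt => h3 γ' h ⟨hlt, h'⟩⟩, h1⟩

theorem IsClub.mem_of_isLimitOf {C : ISet M (El κ)} (hC : IsClub (code C) κ) {γ : El κ}
    (h : IsLimitOf C γ) : C γ := by
  refine (ISet.code_mem_code C γ).1 (hC.2.2 γ.1 γ.2 ⟨OrdSet.isOrd.of_mem γ.2, ?_, ?_⟩ ?_)
  · obtain ⟨β, hβ⟩ := h.1
    exact ⟨β.1, hβ⟩
  · intro x hx
    obtain ⟨c, -, h1, h2⟩ := h.2 ⟨x, OrdSet.isOrd.mem_trans γ.2 hx⟩ hx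
    exact ⟨c.1, h2, h1⟩
  · intro x hx
    obtain ⟨c, h0, h1, h2⟩ := h.2 ⟨x, OrdSet.isOrd.mem_trans γ.2 hx⟩ hx
    exact ⟨c.1, (ISet.code_mem_code C c).2 h0, h2, h1⟩

/-- A simple limit `γ` determines its own cofinal `ω`-sequence: start from the least bound of the
earlier limits and iterate "next element of `C`". This makes the cofinality uniform without choice.
Discontinuity holds because earlier values of `f` are limits, hence below that bound. -/
theorem AD.correct_of_isSimpleLimit (hAD : AD M) {C : ISet M (El κ)} (hC : ∀ α, ∃ β, C β ∧ α < β)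
    {l : M} [OrdSet l] {f : IFun M (El l) (El κ)} (hf : ∀ α β, α < β → f α < f β)
    (hfC : ∀ α, IsSimpleLimit C (f α)) : Correct f := by
  obtain ⟨b, hb⟩ := exists_next hC
  let m : El κ → El κ → Prop := fun γ s => (s < γ ∧ ∀ γ', γ' < γ → IsLimitOf C γ' → γ' ≤ s) ∧
    ∀ s', s' < s → ¬ (s' < γ ∧ ∀ γ', γ' < γ → IsLimitOf C γ' → γ' ≤ s')
  have hm (α) : m (f α) (the (m (f α))) := by
    obtain ⟨s, h1, h2⟩ := El.exists_min
      (fun s => s < f α ∧ ∀ γ', γ' < f α → IsLimitOf C γ' → γ' ≤ s) (hfC α).2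
    refine the_spec ⟨s, ⟨h1, h2⟩, fun s' h' => ?_⟩
    rcases lt_trichotomy s s' with h | h | h
    · exact absurd h1 (h'.2 _ h)
    · exact h.symm
    · exact absurd h'.1 (h2 _ h)
  let it : El κ → IFun M (N M) (El κ) → Prop := fun δ c => c 0 = δ ∧ ∀ n, c (N.succ n) = b (c n)
  have hit (δ c) (hc : it δ c) : the (it δ) = c := by
    refine the_eq hc fun c' hc' => IFun.ext fun n => ?_
    refine N.induction (fun n => c' n = c n) (hc'.1.trans hc.1.symm) (fun n ih => ?_) n
    rw [hc'.2, hc.2, ih]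
  let g : IFun M (El l × N M) (El κ) := IFun.of M fun t => (the (it (the (m (f t.1))))) t.2
  refine ⟨hf, ⟨g, ?_⟩, fun α => ?_⟩
  · have key (α) : ∃ c : IFun M (N M) (El κ), (∀ n, g (α, n) = c n) ∧ (∀ n, c (N.succ n) = b (c n)) ∧
        (∀ n, c n < f α) ∧ ∀ β, β < f α → ∃ n, β < c n := by
      obtain ⟨c, γ, h0, hc, h1, h2⟩ := hAD.exists_sup_iterate b (fun δ => (hb δ).1) (the (m (f α)))
      have h3 (n) : c n < f α := by
        refine N.induction (fun n => c n < f α) (h0 ▸ (hm α).1.1) (fun n ih => ?_) n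
        obtain ⟨d, h4, h5, h6⟩ := (hfC α).1.2 _ ih
        rw [hc]
        exact ((hb _).2.2 d h4 h5).trans_lt h6
      refine ⟨c, fun n => ?_, hc, h3, fun β hβ => h2 β (hβ.trans_le (not_lt.1 fun hlt => ?_))⟩
      · rw [show g (α, n) = _ from IFun.of_apply _ _, hit _ c ⟨h0, hc⟩]
      -- If the iterates converged below `f α`, their supremum would be a limit of `C` strictly
      -- above the bound of all such limits.
      · refine absurd ((hm α).1.2 γ hlt ⟨⟨c 0, h1 0⟩, fun β hβ => ?_⟩) (not_le.2 (h0 ▸ h1 0))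
        obtain ⟨n, hn⟩ := h2 β hβ
        refine ⟨c (N.succ n), ?_, hn.trans ?_, h1 _⟩
        · rw [hc]; exact (hb _).2.1
        · rw [hc]; exact (hb _).1
    refine ⟨fun α k n hkn => ?_, fun α n => ?_, fun α β hβ => ?_⟩
    · obtain ⟨c, h1, h2, -⟩ := key α
      rw [h1, h1]
      refine N.induction (fun n => k < n → c k < c n) (fun h => absurd h (N.not_lt_zero _))
        (fun n ih h => ?_) n hkn
      rw [h2]
      rcases (N.lt_succ.1 h).lt_or_eq with h | rfl
      · exact (ih h).trans (hb _).1
      · exact (hb _).1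
    · obtain ⟨c, h1, -, h2, -⟩ := key α
      rw [h1]; exact h2 n
    · obtain ⟨c, h1, -, -, h2⟩ := key α
      obtain ⟨n, hn⟩ := h2 β hβ
      exact ⟨n, by rw [h1]; exact hn.le⟩
  · obtain ⟨s, h1, h2⟩ := (hfC α).2
    exact ⟨s, h1, fun β hβ => h2 _ (hf _ _ hβ) (hfC β).1⟩

theorem AD.arrow (hAD : AD M) {l : M} (hl : l ∈ κ) : Arrow κ l (two M) := by
  have : OrdSet l := ⟨hκ.out.1.of_mem hl⟩
  intro P hP
  obtain ⟨i, hi⟩ := Omega1.exists_inj hl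
  obtain ⟨C, hC, h⟩ := hAD.exists_club i hi
    (fun f : IFun M (El l) (El κ) => Maps P (code f) (0 : N M).1)
  have hC' (α : El κ) : ∃ β, C β ∧ α < β := by
    obtain ⟨_, hβ, h⟩ := hC.2.1 α.1 α.2
    obtain ⟨β, rfl, hβ'⟩ := (ISet.mem_code _ _).1 hβ
    exact ⟨β, hβ', h⟩
  let A : ISet M (El κ) := ISet.of M fun γ => IsSimpleLimit C γ
  have eA (γ) : A γ ↔ IsSimpleLimit C γ := ISet.of_apply _ _
  have hA : ∀ x, x ∈ (code A : M) → x ∈ κ := fun x hx => by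
    obtain ⟨y, rfl, -⟩ := (ISet.mem_code _ _).1 hx
    exact y.2
  have key (f : M) (hf : f ∈ incr (code A) l) : ∃ g : IFun M (El l) (El κ), code g = f ∧
      Correct g ∧ ∀ α, C (g α) := by
    obtain ⟨g, rfl, h1, h2⟩ := exists_increasing hA hf
    have h3 (α) : IsSimpleLimit C (g α) := (eA _).1 ((ISet.code_mem_code _ _).1 (h2 α))
    exact ⟨g, rfl, hAD.correct_of_isSimpleLimit hC' h1 h3, fun α => hC.mem_of_isLimitOf (h3 α).1⟩
  have hbij := hAD.exists_isBij A fun α => by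
    obtain ⟨γ, h1, h2⟩ := hAD.exists_isSimpleLimit hC' α
    exact ⟨γ, (eA _).2 h1, h2⟩
  rcases h with h | h
  · refine ⟨_, mem_two_iff.2 (Or.inl rfl), code A, hA, hbij, fun f hf => ?_⟩
    obtain ⟨f, rfl, hf1, hf2⟩ := key f hf
    exact h f hf1 hf2
  · refine ⟨_, mem_two_iff.2 (Or.inr rfl), code A, hA, hbij, fun f hf => ?_⟩
    obtain ⟨v, hv, -⟩ := hP.2 f (incr_mono hA hf)
    obtain ⟨f, rfl, hf1, hf2⟩ := key f hf
    rcases mem_two_iff.1 (hP.mem_of_maps hv).2 with rfl | rfl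
    · exact absurd hv (h f hf1 hf2)
    · exact hv

end Arrows

/-! ### The pointclass on the spaces `ℝ^n` and the good coding system -/

section Spaces
variable {M : Type*} [Membership M M] [ZFModel M]

theorem N.exists_bound₂ (f : IFun M (N M × N M) (N M)) (n k : N M) :
    ∃ b, ∀ i j, i < n → j < k → f (i, j) < b := by
  refine N.induction (fun n => ∃ b, ∀ i j, i < n → j < k → f (i, j) < b)
    ⟨0, fun i j h => absurd h (N.not_lt_zero _)⟩ ?_ n
  rintro n ⟨b, hb⟩
  obtain ⟨b', hb'⟩ := N.exists_bound (IFun.of M fun j => f (n, j)) k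
  refine ⟨max b b', fun i j hi hj => ?_⟩
  rcases (N.lt_succ.1 hi).lt_or_eq with hi | rfl
  · exact (hb i j hi hj).trans_le (le_max_left _ _)
  · have := hb' j hj
    rw [IFun.of_apply] at this
    exact this.trans_le (le_max_right _ _)

theorem range_R : {m | ∃ y : R M, code y = m} = Baire M := Set.ext fun _ => mem_Baire.symm

/-- The points of the `n`-dimensional space of reals. -/
abbrev Pt (n : N M) : Type _ := IFun M (El n.1) (R M)

theorem mem_realPow {n : N M} {m : M} : m ∈ RealPow n.1 ↔ ∃ x : Pt n, code x = m := by
  constructor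
  · intro h
    exact IFun.exists_code_eq (by rw [range_El, range_R]; exact h)
  · rintro ⟨x, rfl⟩
    have := x.isFun_code
    rwa [range_El, range_R] at this

theorem code_mem_realPow {n : N M} (x : Pt n) : code x ∈ RealPow n.1 := mem_realPow.2 ⟨x, rfl⟩

/-- The real that lists all the values of the coordinates of the point `m`. -/
noncomputable def encode (m : M) : R M := IFun.of M fun k => the fun v : N M =>
  ∃ i j, k = pi i j ∧ ∃ a : R M, Maps m i.1 (code a) ∧ v = a j

instance encode.df {X : Type*} [DType M X] {f : X → M} [h : DF M (fun x => f x)] :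
    DF M (no_index (fun x => encode (f x))) :=
  DF.comp (f := encode) (by unfold encode; infer_instance) h

/-- The coordinate index `i` as a natural number. -/
def coord {n : N M} (i : El n.1) : N M :=
  ⟨i.1, mem_omegaSet.2 (omega_of_mem (mem_omegaSet.1 n.2) i.2)⟩

variable (M) in
/-- The function that defines the topology of the `n`-dimensional space. -/
noncomputable def enc (n : N M) : IFun M (Pt n) (R M) := ⟨fun x => encode (code x), inferInstance⟩

theorem enc_apply (n : N M) (x : Pt n) : enc M n x = encode (code x) := rfl

theorem maps_code_pt {n : N M} {x : Pt n} {i : El n.1} {a : R M} :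
    Maps (code x) i.1 (code a) ↔ x i = a := IFun.maps_code_code x i a

theorem enc_pi {n : N M} (x : Pt n) (i : El n.1) (j : N M) :
    enc M n x (pi (coord i) j) = x i j := by
  rw [enc_apply, encode, IFun.of_apply]
  refine the_eq ⟨_, _, rfl, x i, maps_code_pt.2 rfl, rfl⟩ ?_
  rintro _ ⟨i', j', h, a, ha, rfl⟩
  obtain ⟨rfl, rfl⟩ := pi_inj h
  rw [maps_code_pt.1 ha]

/-- With `exists_modulus_enc`, this says that the topology given by `enc` is the product topology.
-/
theorem exists_modulus_pt (n k : N M) : ∃ l, ∀ x y : Pt n, agree l (enc M n x) (enc M n y) →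
    ∀ i, agree k (x i) (y i) := by
  obtain ⟨b, hb⟩ := N.exists_bound₂ (IFun.of M fun p : N M × N M => pi p.1 p.2) n k
  refine ⟨b, fun x y h i j hj => ?_⟩
  have := hb (coord i) j i.2 hj
  rw [IFun.of_apply] at this
  rw [← enc_pi, ← enc_pi]
  exact h _ this

theorem exists_modulus_enc (n k : N M) : ∃ l, ∀ x y : Pt n, (∀ i, agree l (x i) (y i)) →
    agree k (enc M n x) (enc M n y) := by
  -- A bound for the second components of all pairs with code below `k`: only these entries of the
  -- coordinates matter below `k`.
  obtain ⟨b, hb⟩ := N.exists_bound (IFun.of M fun k => the fun j : N M => ∃ i, k = pi i j) k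
  refine ⟨b, fun x y h k' hk => ?_⟩
  rw [enc_apply, enc_apply, encode, encode, IFun.of_apply, IFun.of_apply]
  have hb (i j) (hij : k' = pi i j) : j < b := by
    have := hb k' hk
    rwa [IFun.of_apply, the_eq (P := fun j : N M => ∃ i, k' = pi i j) ⟨i, hij⟩] at this
    rintro j' ⟨i', h'⟩
    exact (pi_inj (h'.symm.trans hij)).2
  congr 1
  funext v
  refine propext ⟨?_, ?_⟩
  · rintro ⟨i, j, e, a, ha, rfl⟩
    obtain ⟨i', hi, ha'⟩ := (IFun.maps_code _ _ _).1 ha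
    have ha' := DType.code_inj _ _ ha'
    subst ha'
    exact ⟨i, j, e, y i', hi ▸ maps_code_pt.2 rfl, h i' j (hb i j e)⟩
  · rintro ⟨i, j, e, a, ha, rfl⟩
    obtain ⟨i', hi, ha'⟩ := (IFun.maps_code _ _ _).1 ha
    have ha' := DType.code_inj _ _ ha'
    subst ha'
    exact ⟨i, j, e, x i', hi ▸ maps_code_pt.2 rfl, (h i' j (hb i j e)).symm⟩

theorem agree_iff {n k : N M} {x y : Pt n} :
    Agree n.1 k.1 (code x) (code y) ↔ ∀ i, agree k (x i) (y i) := by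
  constructor
  · intro h i j hj
    have := h i.1 _ _ i.2 (maps_code_pt.2 rfl) (maps_code_pt.2 rfl) j.1 _ hj
      ((IFun.maps_code_code (x i) j _).2 rfl)
    exact ((IFun.maps_code_code (y i) j _).1 this).symm
  · intro h i a b hi ha hb j t hj ht
    obtain ⟨i', rfl, rfl⟩ := (IFun.maps_code _ _ _).1 ha
    obtain ⟨i'', h1, rfl⟩ := (IFun.maps_code _ _ _).1 hb
    obtain rfl := DType.code_inj _ _ h1
    obtain ⟨j', rfl, rfl⟩ := (IFun.maps_code _ _ _).1 ht
    exact (IFun.maps_code_code (y i'') j' _).2 (h i'' j' hj).symm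

/-- The type of the sets of pairs that the points of all spaces belong to. -/
abbrev PtSet (M : Type*) [Membership M M] [ZFModel M] : Type _ := ISet M (N M × R M)

theorem exists_ptSet {n : N M} (x : Pt n) : ∃ z : PtSet M, (code z : M) = code x := by
  refine ISet.exists_code_eq fun m hm => ?_
  obtain ⟨i, hi, y, hy, hp⟩ := (code_mem_realPow x).1 m hm
  obtain ⟨a, rfl⟩ := mem_Baire.1 hy
  exact ⟨(⟨i, mem_omegaSet.2 (omega_of_mem (mem_omegaSet.1 n.2) hi)⟩, a), (isPair_iff.1 hp).symm⟩

/-- The set `A` is a projection of the closed set with code `c`. -/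
def IsProjection (n : M) (A : ISet M (PtSet M)) (c : R M) : Prop :=
  ∀ z, A z ↔ code z ∈ RealPow n ∧ ∃ w, InClosed c (encode (code z)) w

/-- The pointclass must be a single set covering all dimensions, so the points of all spaces are
placed in the common type `PtSet M`, and the dimension enters as a definable condition. -/
theorem exists_suslinClass : ∃ Γ : ISet M (N M × ISet M (PtSet M)), ∀ n A,
    Γ (n, A) ↔ ∃ c, IsProjection n.1 A c := by
  refine ⟨ISet.of M fun p => ∃ c, IsProjection p.1.1 p.2 c, fun n A => ?_⟩
  have : DP M (fun p : N M × ISet M (PtSet M) => ∃ c, IsProjection p.1.1 p.2 c) := by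
    unfold IsProjection RealPow IsFun Baire IsFun
    simp only [Set.mem_ofPred_eq]
    infer_instance
  exact ISet.of_apply _ _

variable (M) in
/-- The pointclass of the projections of closed sets. -/
noncomputable def suslinClass : M := code (exists_suslinClass (M := M)).choose

theorem isPointclass_suslinClass : IsPointclass (suslinClass M) := by
  intro p hp
  obtain ⟨⟨n, A⟩, rfl, h⟩ := (ISet.mem_code _ _).1 hp
  obtain ⟨c, hc⟩ := (exists_suslinClass.choose_spec n A).1 h
  refine ⟨_, _, mem_omegaSet.1 n.2, fun x hx => ?_, isPair_pr _ _⟩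
  obtain ⟨z, rfl, hz⟩ := (ISet.mem_code _ _).1 hx
  exact ((hc z).1 hz).1

/-- This is the dictionary between the pointclass in the model and `Suslin`; every closure property
is transferred through it. -/
theorem inClass_iff {n : N M} {S : Set M} : InClass (suslinClass M) n.1 S ↔
    S ⊆ RealPow n.1 ∧ Suslin (M := M) (X := Pt n) (enc M n) (fun x => code x ∈ S) := by
  constructor
  · rintro ⟨a, rfl, h⟩
    obtain ⟨⟨n', A⟩, e, h⟩ := (ISet.mem_code _ _).1 (maps_iff.1 h)
    obtain ⟨c, hc⟩ := (exists_suslinClass.choose_spec n' A).1 h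
    obtain ⟨e1, rfl⟩ := pr_inj e
    obtain rfl : n' = n := DType.code_inj _ _ e1
    refine ⟨fun x hx => ?_, c, fun x => ?_⟩
    · obtain ⟨z, rfl, hz⟩ := (ISet.mem_code _ _).1 hx
      exact ((hc z).1 hz).1
    · obtain ⟨z, hz⟩ := exists_ptSet x
      show code x ∈ (code A : M) ↔ _
      rw [enc_apply, ← hz]
      refine (ISet.code_mem_code A z).trans ((hc z).trans (and_iff_right ?_))
      rw [hz]; exact code_mem_realPow x
  · rintro ⟨hS, c, hc⟩
    let A : ISet M (PtSet M) := ISet.of M fun z =>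
      code z ∈ RealPow n.1 ∧ ∃ w, InClosed c (encode (code z)) w
    have hA : IsProjection n.1 A c := by
      have : DP M (fun z : PtSet M => code z ∈ RealPow n.1 ∧ ∃ w, InClosed c (encode (code z)) w) := by
        unfold RealPow IsFun Baire IsFun
        simp only [Set.mem_ofPred_eq]
        infer_instance
      exact fun z => ISet.of_apply _ _
    refine ⟨code A, Set.ext fun m => ?_,
      maps_iff.2 ((ISet.code_mem_code _ (n, A)).2 ((exists_suslinClass.choose_spec n A).2 ⟨c, hA⟩))⟩
    constructor
    · intro hm
      obtain ⟨z, rfl, hz⟩ := (ISet.mem_code _ _).1 hm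
      obtain ⟨h1, h2⟩ := (hA z).1 hz
      obtain ⟨x, hx⟩ := mem_realPow.1 h1
      rw [← hx] at h2 ⊢
      exact (hc x).2 h2
    · intro hm
      obtain ⟨x, rfl⟩ := mem_realPow.1 (hS hm)
      obtain ⟨z, hz⟩ := exists_ptSet x
      have h2 := (hc x).1 hm
      rw [enc_apply, ← hz] at h2
      rw [← hz]
      exact (ISet.code_mem_code A z).2 ((hA z).2 ⟨hz ▸ code_mem_realPow x, h2⟩)

theorem inDelta_iff {n : N M} {S : Set M} : InDelta (suslinClass M) n.1 S ↔
    S ⊆ RealPow n.1 ∧ BiSuslin (M := M) (X := Pt n) (enc M n) (fun x => code x ∈ S) := by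
  have e (x : Pt n) : code x ∈ RealPow n.1 \ S ↔ ¬ code x ∈ S := and_iff_right (code_mem_realPow x)
  unfold InDelta BiSuslin
  rw [inClass_iff, inClass_iff]
  constructor
  · rintro ⟨⟨h1, h2⟩, -, h3⟩
    exact ⟨h1, h2, h3.congr e⟩
  · rintro ⟨h1, h2, h3⟩
    exact ⟨⟨h1, h2⟩, Set.sdiff_subset, h3.congr fun x => (e x).symm⟩

theorem closedUnderContinuousSubstitution_suslinClass :
    ClosedUnderContinuousSubstitution (suslinClass M) := by
  intro F m n A hm hn hF hA
  obtain ⟨m, rfl⟩ : ∃ k : N M, k.1 = m := ⟨⟨m, mem_omegaSet.2 hm⟩, rfl⟩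
  obtain ⟨n, rfl⟩ : ∃ k : N M, k.1 = n := ⟨⟨n, mem_omegaSet.2 hn⟩, rfl⟩
  obtain ⟨hF, hc⟩ := hF
  obtain ⟨F, rfl⟩ := IFun.exists_code_eq (M := M) (Y := Pt m) (Z := Pt n) (a := F) (by
    convert hF using 1
    · exact Set.ext fun _ => mem_realPow.symm
    · exact Set.ext fun _ => mem_realPow.symm)
  refine inClass_iff.2 ⟨?_, ?_⟩
  · rintro x ⟨y, -, h⟩
    exact (hF.mem_of_maps h).1
  · refine ((inClass_iff.1 hA).2.comp F fun x k => ?_).congr fun x => ?_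
    · obtain ⟨k', hk'⟩ := exists_modulus_enc n k
      obtain ⟨l, hl, h⟩ := hc _ _ ((IFun.maps_code_code F x _).2 rfl) k'.1 (mem_omegaSet.1 k'.2)
      obtain ⟨l, rfl⟩ : ∃ k : N M, k.1 = l := ⟨⟨l, mem_omegaSet.2 hl⟩, rfl⟩
      obtain ⟨l', hl'⟩ := exists_modulus_pt m l
      refine ⟨l', fun x' hx' => hk' _ _ (agree_iff.1 ?_)⟩
      exact h _ _ ((IFun.maps_code_code F x' _).2 rfl) (agree_iff.2 (hl' x x' hx'))
    · constructor
      · exact fun h => ⟨_, h, (IFun.maps_code_code F x _).2 rfl⟩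
      · rintro ⟨y, hy, h⟩
        obtain ⟨x', h1, rfl⟩ := (IFun.maps_code _ _ _).1 h
        obtain rfl := DType.code_inj _ _ h1
        exact hy

theorem exists_append (n : N M) : ∃ F : IFun M (Pt n × R M) (Pt (N.succ n)), ∀ x w,
    (∀ (i : El n.1) (j : El (N.succ n).1), j.1 = i.1 → F (x, w) j = x i) ∧
    ∀ j : El (N.succ n).1, j.1 = n.1 → F (x, w) j = w := by
  refine ⟨IFun.of M fun p => IFun.of M fun j => the fun a : R M =>
    (∃ i : El n.1, j.1 = i.1 ∧ a = p.1 i) ∨ j.1 = n.1 ∧ a = p.2, fun x w => ⟨fun i j h => ?_,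
    fun j h => ?_⟩⟩
  · rw [IFun.of_apply, IFun.of_apply]
    refine the_eq (Or.inl ⟨i, h, rfl⟩) ?_
    rintro a (⟨i', h', rfl⟩ | ⟨h', -⟩)
    · rw [Subtype.ext (h.symm.trans h')]
    · have := i.2
      rw [← h, h'] at this
      exact absurd this (mem_irrefl _)
  · rw [IFun.of_apply, IFun.of_apply]
    refine the_eq (Or.inr ⟨h, rfl⟩) ?_
    rintro a (⟨i', h', rfl⟩ | ⟨-, rfl⟩)
    · have := i'.2
      rw [← h', h] at this
      exact absurd this (mem_irrefl _)
    · rfl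

theorem closedUnderExistsReal_suslinClass : ClosedUnderExistsReal (suslinClass M) := by
  intro n m B hn hm hB
  obtain ⟨n, rfl⟩ : ∃ k : N M, k.1 = n := ⟨⟨n, mem_omegaSet.2 hn⟩, rfl⟩
  obtain rfl := isSucc_unique hm (N.isSucc_succ n)
  refine inClass_iff.2 ⟨fun x hx => hx.1, ?_⟩
  obtain ⟨F, hF⟩ := exists_append n
  have hlt (j : El (N.succ n).1) : (∃ i : El n.1, j.1 = i.1) ∨ j.1 = n.1 :=
    ((N.isSucc_succ n j.1).1 j.2).imp_left fun h => ⟨⟨_, h⟩, rfl⟩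
  refine ((inClass_iff.1 hB).2.exReal F fun x w k => ?_).congr fun x => ⟨?_, ?_⟩
  · obtain ⟨k', hk'⟩ := exists_modulus_enc (N.succ n) k
    obtain ⟨l, hl⟩ := exists_modulus_pt n k'
    refine ⟨max l k', fun x' w' hx hw => hk' _ _ fun j => ?_⟩
    rcases hlt j with ⟨i, hi⟩ | hj
    · rw [(hF _ _).1 i j hi, (hF _ _).1 i j hi]
      exact hl _ _ (hx.mono (le_max_left _ _)) i
    · rw [(hF _ _).2 j hj, (hF _ _).2 j hj]
      exact hw.mono (le_max_right _ _)
  · rintro ⟨w, hw⟩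
    refine ⟨code_mem_realPow x, _, hw, fun i v hv => ?_⟩
    obtain ⟨i, rfl, rfl⟩ := (IFun.maps_code _ _ _).1 hv
    have hi : i.1 ∈ (N.succ n).1 := (N.isSucc_succ n _).2 (Or.inl i.2)
    exact (maps_code_pt (i := ⟨i.1, hi⟩)).2 ((hF x w).1 i ⟨i.1, hi⟩ rfl)
  · rintro ⟨-, z, hz, h⟩
    obtain ⟨z, rfl⟩ := mem_realPow.1 ((inClass_iff.1 hB).1 hz)
    have hn' : n.1 ∈ (N.succ n).1 := N.lt_succ_self n
    refine ⟨z ⟨n.1, hn'⟩, ?_⟩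
    convert hz using 2
    refine IFun.ext fun j => ?_
    rcases hlt j with ⟨i, hi⟩ | hj
    · rw [(hF _ _).1 i j hi]
      have := h i.1 _ (maps_code_pt.2 rfl)
      rw [← hi] at this
      exact (maps_code_pt.1 this).symm
    · rw [(hF _ _).2 j hj, show j = ⟨n.1, hn'⟩ from Subtype.ext hj]

variable {κ : M} [hκ : Omega1 κ]

/-- Lengths below `κ` are countable in `M`, so these are countable unions. -/
theorem AD.deltaClosedUnderUnions_suslinClass (hAD : AD M) :
    DeltaClosedUnderUnions (suslinClass M) κ := by
  intro n δ S hn hδ hS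
  obtain ⟨n, rfl⟩ : ∃ k : N M, k.1 = n := ⟨⟨n, mem_omegaSet.2 hn⟩, rfl⟩
  obtain ⟨i, hi⟩ := Omega1.exists_inj hδ
  refine inDelta_iff.2 ⟨?_, ?_⟩
  · rintro x ⟨α, a, h, hx⟩
    exact (inDelta_iff.1 (hS.mem_of_maps h).2).1 hx
  · refine (hAD.biSuslin_ex (Q := fun _ => True) i (fun s t _ _ => hi s t)
      (fun (α : El δ) (x : Pt n) => ∃ a, Maps S α.1 a ∧ code x ∈ a) fun α _ => ?_).congr fun x => ?_
    · obtain ⟨a, ha, hu⟩ := hS.2 α.1 α.2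
      refine (inDelta_iff.1 (hS.mem_of_maps ha).2).2.congr fun x => ⟨fun h => ⟨a, ha, h⟩, ?_⟩
      rintro ⟨b, hb, hx⟩
      rwa [hu b hb] at hx
    · constructor
      · rintro ⟨α, -, a, h⟩
        exact ⟨α.1, a, h⟩
      · rintro ⟨α, a, h, hx⟩
        exact ⟨⟨α, (hS.mem_of_maps h).1⟩, trivial, a, h, hx⟩

variable (M) in
/-- The number `1`. -/
noncomputable def oneN : N M := N.succ 0

variable (M) in
theorem isOne_oneN : IsOne (oneN M).1 := ⟨_, N.zero_val, N.isSucc_succ 0⟩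

theorem IsOne.eq {n : M} (h : IsOne n) : n = (oneN M).1 := by
  obtain ⟨z, hz, h⟩ := h
  rw [isEmpty_unique hz N.zero_val] at h
  exact isSucc_unique h (N.isSucc_succ 0)

variable (M) in
/-- The index of the coordinate of the points of the line. -/
noncomputable def zeroEl : El (oneN M).1 := ⟨(0 : N M).1, N.lt_succ_self 0⟩

theorem eq_zeroEl (i : El (oneN M).1) : i = zeroEl M := by
  rcases (N.isSucc_succ 0 i.1).1 i.2 with h | h
  · exact absurd h (N.zero_val _)
  · exact Subtype.ext h

theorem code_mem_asPow {A : Set M} {x : Pt (oneN M)} :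
    code x ∈ asPow A ↔ code (x (zeroEl M)) ∈ A := by
  constructor
  · rintro ⟨n, o, y, -, -, ho, h, hy⟩
    obtain ⟨i, -, rfl⟩ := (IFun.maps_code _ _ _).1 h
    rwa [eq_zeroEl i] at hy
  · intro h
    exact ⟨_, _, _, isOne_oneN M, code_mem_realPow x, N.zero_val,
      (maps_code_pt (i := zeroEl M)).2 rfl, h⟩

theorem asPow_subset (A : Set M) : asPow A ⊆ RealPow (oneN M).1 := by
  rintro z ⟨n, o, x, hn, hz, -⟩
  rwa [hn.eq] at hz

theorem realInDelta_of_biSuslin {A : Set M} (h : BiSuslin (idR M) (fun x => code x ∈ A)) :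
    RealInDelta (suslinClass M) A := by
  refine ⟨_, isOne_oneN M, inDelta_iff.2 ⟨asPow_subset A, ?_⟩⟩
  refine (BiSuslin.comp (X := Pt (oneN M)) (e := enc M (oneN M)) h (IFun.of M fun x : Pt (oneN M) => x (zeroEl M)) fun x k => ?_).congr
    fun x => ?_
  · obtain ⟨l, hl⟩ := exists_modulus_pt (oneN M) k
    refine ⟨l, fun x' h => ?_⟩
    rw [IFun.of_apply, IFun.of_apply]
    exact hl _ _ h _
  · rw [IFun.of_apply, code_mem_asPow]

/-- As Δ is contained in the pointclass, closure under `∃^ℝ` puts `∃^ℝ Δ` inside it; the real line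
and `ℝ^1` are then identified. -/
theorem suslin_of_realInExistsDelta {A : Set M} (h : RealInExistsDelta (suslinClass M) A) :
    Suslin (idR M) (fun x => code x ∈ A) := by
  obtain ⟨n, m, B, hn, hm, hB, h⟩ := h
  have h1 := closedUnderExistsReal_suslinClass n m B (hn.eq ▸ mem_omegaSet.1 (oneN M).2) hm hB.1
  rw [← h, hn.eq] at h1
  refine ((inClass_iff.1 h1).2.comp (e := idR M) (IFun.of M fun x => IFun.of M fun _ => x)
    fun x k => ?_).congr fun x => ?_
  · obtain ⟨l, hl⟩ := exists_modulus_enc (oneN M) k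
    refine ⟨l, fun x' h => hl _ _ fun i => ?_⟩
    rw [IFun.of_apply, IFun.of_apply, IFun.of_apply, IFun.of_apply]
    exact h
  · rw [code_mem_asPow, IFun.of_apply, IFun.of_apply]

theorem AD.isRegularCardinal (hAD : AD M) : IsRegularCardinal κ := by
  refine ⟨hκ.out.1, fun n hn => ?_, fun η hη => ?_, fun η h hη hh => ?_⟩
  · rcases IsOrd.trichotomy hn.1 hκ.out.1 with h | h | h
    · exact h
    all_goals
      -- If `κ` were at most a natural number, its inclusion in `ω` would be an injection.
      have hω (x : El κ) : x.1 ∈ omegaSet M := by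
        refine mem_omegaSet.2 (omega_of_mem hn ?_)
        first
          | exact h ▸ x.2
          | exact hn.1.mem_trans h x.2
      obtain ⟨α, β, h1, h2⟩ := Omega1.not_injective
        (IFun.of M fun x : El κ => (El.mk x.1 (hω x) : N M))
      rw [IFun.of_apply, IFun.of_apply] at h1
      have h3 : α = β := Subtype.ext (congrArg (fun n : N M => n.1) h1)
      exact absurd h3 h2
  · rintro ⟨f, ⟨hf, -⟩, hs⟩
    obtain ⟨i, hi⟩ := Omega1.exists_inj hη
    obtain ⟨f, rfl⟩ := exists_ifun_El hf
    obtain ⟨δ, hδ⟩ := hAD.exists_bound_of_inj i (fun _ => True) (fun s t _ _ => hi s t) f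
    obtain ⟨x, hx⟩ := hs δ.1 δ.2
    obtain ⟨α, rfl, h⟩ := (IFun.maps_code _ _ _).1 hx
    obtain rfl : f α = δ := DType.code_inj _ _ h
    exact lt_irrefl _ (hδ α trivial)
  · obtain ⟨i, hi⟩ := Omega1.exists_inj hη
    obtain ⟨f, rfl⟩ := exists_ifun_El hh
    obtain ⟨δ, hδ⟩ := hAD.exists_bound_of_inj i (fun _ => True) (fun s t _ _ => hi s t) f
    refine ⟨δ.1, δ.2, fun x y hxy => ?_⟩
    obtain ⟨α, rfl, rfl⟩ := (IFun.maps_code _ _ _).1 hxy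
    exact hδ α trivial

theorem AD.isReasonable (hAD : AD M) {l : M} (hl : l ∈ κ) : IsReasonable κ l := by
  have : OrdSet l := ⟨hκ.out.1.of_mem hl⟩
  obtain ⟨i, hi⟩ := Omega1.exists_inj hl
  -- Each section of a real codes at most one ordinal, so decoding gives a partial function and the
  -- uniqueness clause in `GC` is automatic.
  let d : IFun M (R M) (ISet M (El l × El κ)) := IFun.of M fun x => ISet.of M fun p => Val x (i p.1) p.2
  have hd (x β γ) : d x (β, γ) ↔ Val x (i β) γ := by
    rw [show d x = _ from IFun.of_apply _ _, ISet.of_apply]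
  have hdec (x : R M) (β : El l) (γ : El κ) : DecodesTo (code d) (code x) β.1 γ.1 ↔ Val x (i β) γ := by
    rw [← hd]
    constructor
    · rintro ⟨r, h1, h2⟩
      obtain ⟨x', h3, rfl⟩ := (IFun.maps_code _ _ _).1 h1
      obtain rfl := DType.code_inj _ _ h3
      exact (ISet.code_mem_code _ (β, γ)).1 (maps_iff.1 h2)
    · exact fun h => ⟨_, (IFun.maps_code_code d x _).2 rfl,
        maps_iff.2 ((ISet.code_mem_code _ (β, γ)).2 h)⟩
  have hGC (x : R M) (β : El l) (γ : El κ) : code x ∈ GC (code d) κ β.1 γ.1 ↔ Val x (i β) γ := by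
    constructor
    · rintro ⟨-, h, -⟩
      exact (hdec _ _ _).1 h
    · refine fun h => ⟨mem_Baire.2 ⟨x, rfl⟩, (hdec _ _ _).2 h, fun γ' hγ' h' => ?_⟩
      exact congrArg Subtype.val (h.unique ((hdec x β ⟨γ', hγ'⟩).1 h'))
  refine ⟨hAD.isRegularCardinal, Or.inl hl, suslinClass M, code d,
    ⟨isPointclass_suslinClass, closedUnderContinuousSubstitution_suslinClass,
      closedUnderExistsReal_suslinClass, ?_, fun f hf => ?_, fun β γ hβ hγ => ?_,
      fun β A hβ hA h => ?_, hAD.deltaClosedUnderUnions_suslinClass⟩⟩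
  · have := d.isFun_code
    rw [range_R] at this
    refine this.mono ?_
    rintro _ ⟨z, rfl⟩ p hp
    obtain ⟨⟨β, γ⟩, rfl, -⟩ := (ISet.mem_code _ _).1 hp
    exact ⟨_, _, β.2, γ.2, isPair_pr _ _⟩
  · obtain ⟨f, rfl⟩ := exists_ifun_El hf
    -- Countable choice picks a code of each value of `f`; assembled as sections, they form a real
    -- that decodes to `f`.
    obtain ⟨z', hz'⟩ := hAD.choice (fun n x => ∀ t, i t = n → Rk x 0 (f t)) fun n => by
      by_cases h : ∃ t, i t = n
      · obtain ⟨t, rfl⟩ := h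
        obtain ⟨x, hx⟩ := exists_rk_zero (f t)
        exact ⟨x, fun s hs => hi _ _ hs ▸ hx⟩
      · exact ⟨default, fun t ht => absurd ⟨t, ht⟩ h⟩
    obtain ⟨z, hz⟩ := exists_sec_eq z'
    have hzf (t) : Val z (i t) (f t) := by
      unfold Val
      rw [hz]
      exact hz' _ t rfl
    refine ⟨code z, mem_Baire.2 ⟨z, rfl⟩, ?_⟩
    rw [show (code f : M) = code f.graph from rfl]
    refine (IFun.maps_code_code d z _).2 (ISet.ext ?_)
    rintro ⟨β, γ⟩
    rw [hd]
    exact ⟨fun h => (hzf β).unique h, fun h => (show f β = γ from h) ▸ hzf β⟩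
  · refine realInDelta_of_biSuslin ((hAD.biSuslin_val (i ⟨β, hβ⟩) (⟨γ, hγ⟩ : El κ)).congr fun x => ?_)
    exact (hGC x ⟨β, hβ⟩ ⟨γ, hγ⟩).symm
  · have key (x : R M) (hx : code x ∈ A) : ∃ γ : El κ, Val x (i ⟨β, hβ⟩) γ := by
      obtain ⟨γ, hγ, hx⟩ := h hx
      exact ⟨⟨γ, hγ⟩, (hGC x ⟨β, hβ⟩ ⟨γ, hγ⟩).1 hx⟩
    -- Taking a section is continuous and maps `A` into the codes of ordinals, so boundedness
    -- applies.
    obtain ⟨δ, hδ⟩ := hAD.exists_bound_of_suslin (κ := κ) (suslin_of_realInExistsDelta hA)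
      (IFun.of M fun x => sec x (i ⟨β, hβ⟩))
      (fun w k => by
        obtain ⟨m, hm⟩ := exists_modulus_sec (i ⟨β, hβ⟩) k
        refine ⟨m, fun w' hw => ?_⟩
        rw [IFun.of_apply, IFun.of_apply]
        exact hm _ _ hw)
      (fun w hw => by
        rw [IFun.of_apply]
        exact key w hw)
    refine ⟨δ.1, δ.2, fun x hx => ?_⟩
    obtain ⟨-, -, hb, -⟩ := h hx
    obtain ⟨x, rfl⟩ := mem_Baire.1 hb
    obtain ⟨γ, hγ⟩ := key x hx
    refine ⟨γ.1, hδ x γ hx ?_, (hGC x ⟨β, hβ⟩ γ).2 hγ⟩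
    rw [IFun.of_apply]
    exact hγ

end Spaces
end SetModel

open SetModel in
theorem corollary4p10 {M : Type*} [Membership M M] (hZF : ZF M) (hAD : AD M)
    (κ : M) (hκ : IsOmega1 κ) :
    (∀ l : M, l ∈ κ → IsReasonable κ l) ∧
    (∀ l : M, l ∈ κ → ArrowStar κ l (two M)) ∧
    (∀ l : M, l ∈ κ → Arrow κ l (two M)) := by
  have : ZFModel M := ⟨hZF⟩
  have : Omega1 κ := ⟨hκ⟩
  exact ⟨fun l hl => hAD.isReasonable hl, fun l hl => hAD.arrowStar hl, fun l hl => hAD.arrow hl⟩
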